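/- Let $\mu,\varepsilon:\mathbb R\to\mathbb R$ be $1$-periodic, piecewise continuous functions (finitely many discontinuities in each bounded interval, finite one-sided limits everywhere) that are bounded below by a positive constant, and let $\tilde\mu,\tilde\varepsilon:\mathbb R\to\mathbb R$ be $1$-periodic and piecewise continuous. For such $\mu,\varepsilon$ put $\mathcal L\psi=-\frac1\varepsilon\left(\frac1\mu\psi'\right)'$; solutions of $\mathcal L\psi=E\psi$ are understood with $\psi$ and the flux $\frac1\mu\psi'$ locally absolutely continuous. For $k\in\mathbb R$ let $E_1(k)\le E_2(k)\le\cdots$ be the eigenvalues, repeated according to multiplicity, of $\mathcal L\psi=E\psi$ on $\mathbb R$, $\psi(x+1)=e^{ik}\psi(x)$, and put $E_j^-=\min_{k\in[-\pi,\pi]}E_j(k)$, $E_j^+=\max_{k\in[-\pi,\pi]}E_j(k)$. For $\delta\in\mathbb R$ let $\mathcal L_{\delta,\pm}$ be the operator with coefficients $\mu\pm\delta\tilde\mu$, $\varepsilon\pm\delta\tilde\varepsilon$, with band edges $E_{j,\delta,\pm}^{-},E_{j,\delta,\pm}^{+}$, let $\mathcal L_0$ be the operator with coefficients $\mu,\varepsilon$,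 and let $\tilde{\mathcal L}_\delta$ be the operator on $\mathbb R$ of the same form whose coefficients are $\mu-\delta\tilde\mu,\ \varepsilon-\delta\tilde\varepsilon$ for $x<0$ and $\mu+\delta\tilde\mu,\ \varepsilon+\delta\tilde\varepsilon$ for $x>0$ (with $\psi$ and the flux continuous at $x=0$). Assume that $\mathcal L_0$ has a Dirac point $(k^*,E^*)$ with $k^*\in\{0,\pi\}$ between the bands $j$ and $j+1$, $j\ge1$: $E_j(k^*)=E_{j+1}(k^*)=E^*$; there is $\alpha>0$ such that $E_j(k)=E^*-\alpha|k-k^*|+O((k-k^*)^2)$ and $E_{j+1}(k)=E^*+\alpha|k-k^*|+O((k-k^*)^2)$ for $k$ near $k^*$; and the space of solutions of $\mathcal L_0\psi=E^*\psi$ with $\psi(x+1)=e^{ik^*}\psi(x)$ has dimension two. Let $\psi_1,\psi_2$ be the solutions of $\mathcal L_0\psi=E^*\psi$ with $\psi_1(0)=1,\ \frac1\mu\psi_1'(0)=0$ and $\psi_2(0)=0,\ \frac1\mu\psi_2'(0)=1$, and let $u=(\psi_1,\frac1\mu\psi_1')^T$, $v=(\psi_2,\frac1\mu\psi_2')^T$,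 $F=\operatorname{diag}(E^*\tilde\varepsilon,\tilde\mu)$. Assume (Assumption 1) that either $$\int_0^1u^TFv\,dx\ge0\quad\text{and}\quad\left(\int_0^1u^TFv\,dx\right)^2>\int_0^1v^TFv\,dx\cdot\int_0^1u^TFu\,dx,$$ or $$\int_0^1u^TFv\,dx<0\quad\text{and}\quad\left(\int_0^1u^TFv\,dx\right)^2>2\int_0^1v^TFv\,dx\cdot\int_0^1u^TFu\,dx.$$ Then there are $\delta_0>0$ and $C>0$ such that for every $0<\delta<\delta_0$ the operator $\tilde{\mathcal L}_\delta$ has an interface mode: there are $E\in\mathbb R$ and a nonzero $\psi\in L^2(\mathbb R)$ with $\tilde{\mathcal L}_\delta\psi=E\psi$. Moreover, its energy $E$ can be taken in the common gap $$E\in(E_{j,\delta,+}^{+},E_{j+1,\delta,+}^{-})\cap(E_{j,\delta,-}^{+},E_{j+1,\delta,-}^{-}),\qquad |E-E^*|\le C\delta.$$ -/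

import Mathlib

open MeasureTheory Set Filter Topology

namespace Photonic

/-- Piecewise continuous on `ℝ`: continuous off a set that is finite in every bounded interval,
with finite one-sided limits at every point. -/
def PiecewiseContinuous (f : ℝ → ℝ) : Prop :=
  ∃ S : Set ℝ, (∀ a b : ℝ, (S ∩ Icc a b).Finite) ∧ (∀ x, x ∉ S → ContinuousAt f x) ∧
    ∀ x, (∃ l, Tendsto f (𝓝[<] x) (𝓝 l)) ∧ (∃ r, Tendsto f (𝓝[>] x) (𝓝 r))

/-- Admissible profile: piecewise continuous and `1`-periodic. -/
structure IsProfile (f : ℝ → ℝ) : Prop where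
  piecewiseContinuous : PiecewiseContinuous f
  periodic : ∀ x, f (x + 1) = f x

/-- Admissible material coefficient: a profile that is positive, including its one-sided limits,
that is, bounded below by a positive constant. -/
structure IsCoefficient (f : ℝ → ℝ) : Prop extends IsProfile f where
  pos : ∃ c : ℝ, 0 < c ∧ ∀ x, c ≤ f x

/-- `(ψ, p)` solves `-(1/ε) (ψ'/μ)' = E ψ` on `ℝ` with flux `p = ψ'/μ`: both `ψ` and `p` are
locally absolutely continuous, `ψ' = μ p` and `p' = - E ε ψ` almost everywhere.  This is written
in integrated form; in particular `ψ` and `p` are continuous, also where `μ`, `ε` jump. -/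
structure IsSolution {V : Type*} [NormedAddCommGroup V] [NormedSpace ℝ V]
    (μ ε : ℝ → ℝ) (E : ℝ) (ψ p : ℝ → V) : Prop where
  integrable_left : ∀ x, IntervalIntegrable (fun t => μ t • p t) volume 0 x
  integrable_right : ∀ x, IntervalIntegrable (fun t => ε t • ψ t) volume 0 x
  eq_left : ∀ x, ψ x = ψ 0 + ∫ t in (0 : ℝ)..x, μ t • p t
  eq_right : ∀ x, p x = p 0 - E • ∫ t in (0 : ℝ)..x, ε t • ψ t

/-- The space of Bloch modes with Bloch wavenumber `k` and energy `E`: the solutions of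
`ℒ ψ = E ψ` on `ℝ` with `ψ (x + 1) = e^{ik} ψ x`. -/
noncomputable def blochSpace (μ ε : ℝ → ℝ) (k E : ℝ) : Submodule ℂ (ℝ → ℂ) where
  carrier := {ψ | (∃ p : ℝ → ℂ, IsSolution μ ε E ψ p) ∧
    ∀ x, ψ (x + 1) = Complex.exp (Complex.I * k) * ψ x}
  zero_mem' := ⟨⟨0, by constructor <;> simp⟩, by simp⟩
  add_mem' := by
    rintro ψ φ ⟨⟨p, hp⟩, hψ⟩ ⟨⟨q, hq⟩, hφ⟩
    refine ⟨⟨p + q, ?_, ?_, ?_, ?_⟩, ?_⟩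
    · intro x
      simpa [smul_add] using (hp.integrable_left x).add (hq.integrable_left x)
    · intro x
      simpa [smul_add] using (hp.integrable_right x).add (hq.integrable_right x)
    · intro x
      simp only [Pi.add_apply, smul_add]
      rw [intervalIntegral.integral_add (hp.integrable_left x) (hq.integrable_left x),
        hp.eq_left x, hq.eq_left x]
      abel
    · intro x
      simp only [Pi.add_apply, smul_add]
      rw [intervalIntegral.integral_add (hp.integrable_right x) (hq.integrable_right x),
        hp.eq_right x, hq.eq_right x, smul_add]
      abel
    · intro x
      simp only [Pi.add_apply, hψ x, hφ x]
      ring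
  smul_mem' := by
    rintro c ψ ⟨⟨p, hp⟩, hψ⟩
    refine ⟨⟨c • p, ?_, ?_, ?_, ?_⟩, ?_⟩
    · intro x
      simpa [mul_left_comm] using (hp.integrable_left x).const_mul c
    · intro x
      simpa [mul_left_comm] using (hp.integrable_right x).const_mul c
    · intro x
      simp only [Pi.smul_apply, smul_comm _ c]
      rw [intervalIntegral.integral_smul, hp.eq_left x, smul_add]
    · intro x
      simp only [Pi.smul_apply, smul_comm _ c]
      rw [intervalIntegral.integral_smul, hp.eq_right x, smul_sub, smul_comm E c]
    · intro x
      simp only [Pi.smul_apply, hψ x, smul_eq_mul]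
      ring

/-- Multiplicity of the Bloch modes at `(k, E)`. -/
noncomputable def multiplicity (μ ε : ℝ → ℝ) (k E : ℝ) : ℕ :=
  Module.finrank ℂ (blochSpace μ ε k E)

/-- Number of eigenvalues `≤ t` at the wavenumber `k`, repeated according to multiplicity. -/
noncomputable def eigenvalueCount (μ ε : ℝ → ℝ) (k t : ℝ) : ℕ∞ :=
  Set.encard {q : ℝ × ℕ | q.1 ≤ t ∧ q.2 < multiplicity μ ε k q.1}

/-- The dispersion relation `E_j(k)`: the `j`-th eigenvalue (`j ≥ 1`) at the wavenumber `k`, in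
nondecreasing order and repeated according to multiplicity. -/
noncomputable def band (μ ε : ℝ → ℝ) (j : ℕ) (k : ℝ) : ℝ :=
  sInf {t : ℝ | (j : ℕ∞) ≤ eigenvalueCount μ ε k t}

/-- Lower edge `E_j^-` of the `j`-th band over the Brillouin zone `[-π, π]`. -/
noncomputable def bandMin (μ ε : ℝ → ℝ) (j : ℕ) : ℝ :=
  sInf (band μ ε j '' Icc (-Real.pi) Real.pi)

/-- Upper edge `E_j^+` of the `j`-th band over the Brillouin zone `[-π, π]`. -/
noncomputable def bandMax (μ ε : ℝ → ℝ) (j : ℕ) : ℝ :=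
  sSup (band μ ε j '' Icc (-Real.pi) Real.pi)

/-- `(kStar, EStar)` is a Dirac point at the intersection of the `j`-th and `(j+1)`-th bands. -/
structure IsDiracPoint (μ ε : ℝ → ℝ) (j : ℕ) (kStar EStar : ℝ) : Prop where
  one_le : 1 ≤ j
  band_eq : band μ ε j kStar = EStar
  band_succ_eq : band μ ε (j + 1) kStar = EStar
  conical : ∃ α > 0, ∃ r > 0, ∃ C : ℝ, ∀ k : ℝ, |k - kStar| < r →
    |band μ ε j k - (EStar - α * |k - kStar|)| ≤ C * (k - kStar) ^ 2 ∧
    |band μ ε (j + 1) k - (EStar + α * |k - kStar|)| ≤ C * (k - kStar) ^ 2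
  multiplicity_eq : multiplicity μ ε kStar EStar = 2

/-- `∫₀¹ yᵀ F z dx` with `F = diag (E ε₁, μ₁)`, `y = (y₁, y₂)` and `z = (z₁, z₂)`. -/
noncomputable def perturbForm (μ₁ ε₁ : ℝ → ℝ) (E : ℝ) (y₁ y₂ z₁ z₂ : ℝ → ℝ) : ℝ :=
  ∫ x in (0 : ℝ)..1, (y₁ x * (E * ε₁ x) * z₁ x + y₂ x * μ₁ x * z₂ x)

/-- The condition on the perturbation `(μ₁, ε₁)` of `(μ, ε)` at the energy `E`.  Here
`u = (u₁, u₂)` and `v = (v₁, v₂)` are the columns of the transfer matrix at energy `E`, that is,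
the (unique) solutions, with their fluxes, with data `(1, 0)` and `(0, 1)` at `x = 0`. -/
def PerturbationCondition (μ ε μ₁ ε₁ : ℝ → ℝ) (E : ℝ) : Prop :=
  ∃ u₁ u₂ v₁ v₂ : ℝ → ℝ,
    (IsSolution μ ε E u₁ u₂ ∧ u₁ 0 = 1 ∧ u₂ 0 = 0) ∧
    (IsSolution μ ε E v₁ v₂ ∧ v₁ 0 = 0 ∧ v₂ 0 = 1) ∧
    ((0 ≤ perturbForm μ₁ ε₁ E u₁ u₂ v₁ v₂ ∧
        perturbForm μ₁ ε₁ E v₁ v₂ v₁ v₂ * perturbForm μ₁ ε₁ E u₁ u₂ u₁ u₂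
          < perturbForm μ₁ ε₁ E u₁ u₂ v₁ v₂ ^ 2) ∨
      (perturbForm μ₁ ε₁ E u₁ u₂ v₁ v₂ < 0 ∧
        2 * (perturbForm μ₁ ε₁ E v₁ v₂ v₁ v₂ * perturbForm μ₁ ε₁ E u₁ u₂ u₁ u₂)
          < perturbForm μ₁ ε₁ E u₁ u₂ v₁ v₂ ^ 2))

/-- The perturbed coefficient `f + δ f₁`; the two half-line structures use `δ` and `-δ`. -/
def perturbed (f f₁ : ℝ → ℝ) (δ : ℝ) : ℝ → ℝ := fun x => f x + δ * f₁ x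

/-- The coefficient of the joint structure: `f - δ f₁` for `x < 0`, `f + δ f₁` for `x > 0`
(the value at the single point `0` plays no role). -/
noncomputable def joint (f f₁ : ℝ → ℝ) (δ : ℝ) : ℝ → ℝ :=
  fun x => if x < 0 then perturbed f f₁ (-δ) x else perturbed f f₁ δ x

/-- `ψ` is an interface mode with energy level `E` of the operator with coefficients `μ`, `ε`:
a nonzero square integrable solution on `ℝ`. -/
def IsInterfaceMode (μ ε : ℝ → ℝ) (E : ℝ) (ψ : ℝ → ℂ) : Prop :=
  ψ ≠ 0 ∧ MemLp ψ 2 volume ∧ ∃ p : ℝ → ℂ, IsSolution μ ε E ψ p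

end Photonic

/-! ### Calculus for locally bounded functions with countably many discontinuities. -/

namespace Photonic

/-! At the Dirac point the monodromy matrix over one period is a scalar `s = ±1`
(`IsDiracPoint.monodromy`), so to first order the perturbed problem is linear algebra. At the energy
`E = EStar + δ l` the monodromy matrix of the structure with parameter `δ` is `s (1 + δ N) + O(δ²)`,
where `N = n + l n₀` is traceless with rows `(b + l b₀, c + l c₀)` and `(-(a + l a₀), -(b + l b₀))`.
Here `a, b, c` are the integrals of the perturbation form and `a₀, b₀, c₀` those of the weight `ε`
(`exists_monodromy_expansion`). The assumption gives `a c < b²`, so for small `l` the matrix `N` has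
real eigenvalues `±κ` with `κ > 0`.

For `δ > 0` the eigenvalue `-κ` gives a multiplier smaller than one in absolute value, hence decay
to the right; with `-δ` in place of `δ` it gives a multiplier larger than one, hence decay to the
left. The pairs `(δ, l)` and `(-δ, -l)` belong to the same energy, so an interface mode exists once
their `-κ` directions coincide (`exists_interfaceMode`). The determinant of the two directions
tends, as `δ → 0`, to the one comparing `n + l n₀` with `n - l n₀`. This limit is odd in `l`, and it
does not vanish at small `l ≠ 0`: a common direction would be a null vector of the positive definite
form with coefficients `a₀, b₀, c₀` (`stable_det_ne_zero`). The intermediate value theorem then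
yields `l` (`exists_stable_crossing`).

It remains to see that a window `|E - EStar| ≤ η δ` lies in the gap between the bands `j` and `j +
1` of both structures. Real multipliers different from `±1` mean that the discriminant exceeds `2`
in absolute value, so no band meets the window; the difficulty is the numbering. The eigenvalues at
wavenumber `k` are the solutions of `disc E = 2 cos k` with the right multiplicity
(`multiplicity_eq_levelMult`). The Dirichlet energies are found by the Prüfer angle, which crosses
multiples of `π` only upwards (`rotation_upcrossing`), and between consecutive ones the discriminant
can cross a level in `[-2, 2]` in one direction only. Hence each Dirichlet interval carries exactly
one eigenvalue (`ncard_slots`, `IsDirichletSeq.band`). The angle depends continuously on `(δ, E)`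
and equals `j π` at the Dirac point, so near this point it identifies the two bands adjacent to the
window (`bands_separated`). -/

/-- Locally bounded functions which are continuous off a countable set. -/
structure IsTame (f : ℝ → ℝ) : Prop where
  continuousAt : ∃ S : Set ℝ, S.Countable ∧ ∀ x, x ∉ S → ContinuousAt f x
  bdd : ∀ r : ℝ, ∃ L : ℝ, ∀ x, |x| ≤ r → |f x| ≤ L

namespace IsTame

variable {f g : ℝ → ℝ}

lemma of_continuous (hf : Continuous f) : IsTame f := by
  refine ⟨⟨∅, by simp, fun x _ => hf.continuousAt⟩, fun r => ?_⟩
  obtain ⟨L, hL⟩ := (isCompact_Icc (a := -r) (b := r)).exists_bound_of_continuousOn hf.continuousOn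
  exact ⟨L, fun x hx => hL x (abs_le.1 hx)⟩

lemma add (hf : IsTame f) (hg : IsTame g) : IsTame (fun x => f x + g x) := by
  obtain ⟨S, hS, h1⟩ := hf.continuousAt
  obtain ⟨T, hT, h2⟩ := hg.continuousAt
  refine ⟨⟨S ∪ T, hS.union hT, fun x hx => ?_⟩, fun r => ?_⟩
  · simp only [mem_union, not_or] at hx
    exact (h1 x hx.1).add (h2 x hx.2)
  · obtain ⟨L, hL⟩ := hf.bdd r
    obtain ⟨K, hK⟩ := hg.bdd r
    exact ⟨L + K, fun x hx => (abs_add_le _ _).trans (add_le_add (hL x hx) (hK x hx))⟩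

lemma mul (hf : IsTame f) (hg : IsTame g) : IsTame (fun x => f x * g x) := by
  obtain ⟨S, hS, h1⟩ := hf.continuousAt
  obtain ⟨T, hT, h2⟩ := hg.continuousAt
  refine ⟨⟨S ∪ T, hS.union hT, fun x hx => ?_⟩, fun r => ?_⟩
  · simp only [mem_union, not_or] at hx
    exact (h1 x hx.1).mul (h2 x hx.2)
  · obtain ⟨L, hL⟩ := hf.bdd r
    obtain ⟨K, hK⟩ := hg.bdd r
    refine ⟨L * K, fun x hx => ?_⟩
    rw [abs_mul]
    exact mul_le_mul (hL x hx) (hK x hx) (abs_nonneg _) ((abs_nonneg _).trans (hL x hx))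

lemma const (c : ℝ) : IsTame (fun _ => c) := of_continuous continuous_const

lemma const_mul (hf : IsTame f) (c : ℝ) : IsTame (fun x => c * f x) := (const c).mul hf

lemma neg (hf : IsTame f) : IsTame (fun x => -f x) := by simpa using hf.const_mul (-1)

lemma sub (hf : IsTame f) (hg : IsTame g) : IsTame (fun x => f x - g x) := by
  simpa [sub_eq_add_neg] using hf.add hg.neg

lemma mul_continuous (hf : IsTame f) (hg : Continuous g) : IsTame (fun x => f x * g x) :=
  hf.mul (of_continuous hg)

lemma comp_add_const (hf : IsTame f) (c : ℝ) : IsTame (fun x => f (x + c)) := by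
  obtain ⟨S, hS, h1⟩ := hf.continuousAt
  refine ⟨⟨(fun x => x + c) ⁻¹' S, hS.preimage (add_left_injective c), fun x hx => ?_⟩, fun r => ?_⟩
  · exact ContinuousAt.comp (f := fun x => x + c) (h1 (x + c) hx) (by fun_prop)
  · obtain ⟨L, hL⟩ := hf.bdd (r + |c|)
    exact ⟨L, fun x hx => hL _ ((abs_add_le _ _).trans (by linarith))⟩

lemma aestronglyMeasurable (hf : IsTame f) (ν : Measure ℝ) [NullSingletonClass ν] :
    AEStronglyMeasurable f ν := by
  obtain ⟨S, hS, h1⟩ := hf.continuousAt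
  have hc : ContinuousOn f Sᶜ := fun x hx => (h1 x hx).continuousWithinAt
  have h2 := hc.aestronglyMeasurable (μ := ν) hS.measurableSet.compl
  have h3 : ν.restrict Sᶜ = ν := by
    rw [Measure.restrict_eq_self_of_ae_mem]
    have := hS.measure_zero ν
    rw [ae_iff]
    simpa using this
  rwa [h3] at h2

lemma intervalIntegrable (hf : IsTame f) (a b : ℝ) : IntervalIntegrable f volume a b := by
  obtain ⟨L, hL⟩ := hf.bdd (max |a| |b|)
  refine (intervalIntegrable_const (c := L)).mono_fun (hf.aestronglyMeasurable _) ?_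
  refine (ae_restrict_iff' measurableSet_uIoc).2 (Eventually.of_forall fun x hx => ?_)
  simp only [Real.norm_eq_abs]
  refine (hL x ?_).trans (le_abs_self _)
  have hx' : x ∈ uIcc a b := uIoc_subset_uIcc hx
  rcases le_total a b with h | h
  · rw [uIcc_of_le h] at hx'
    exact abs_le_max_abs_abs hx'.1 hx'.2
  · rw [uIcc_of_ge h] at hx'
    rw [max_comm]
    exact abs_le_max_abs_abs hx'.1 hx'.2

end IsTame

/-- The one-sided limits bound the function near every point, and compactness makes the bound
uniform on bounded intervals. -/
lemma PiecewiseContinuous.isTame {f : ℝ → ℝ} (hf : PiecewiseContinuous f) : IsTame f := by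
  obtain ⟨S, hS, hc, hl⟩ := hf
  refine ⟨⟨S, ?_, hc⟩, fun r => ?_⟩
  · have : S = ⋃ n : ℕ, S ∩ Icc (-(n : ℝ)) n := by
      ext x
      simp only [mem_iUnion, mem_inter_iff, mem_Icc, exists_and_left, iff_self_and]
      intro _
      obtain ⟨n, hn⟩ := exists_nat_ge |x|
      exact ⟨n, abs_le.1 hn⟩
    rw [this]
    exact countable_iUnion fun n => (hS _ _).countable
  · have key : ∃ L : ℝ, ∀ x ∈ Icc (-r) r, |f x| ≤ L := by
      refine (isCompact_Icc (a := -r) (b := r)).induction_on (p := fun s => ∃ L : ℝ, ∀ x ∈ s, |f x| ≤ L)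
        ⟨0, by simp⟩ (fun s t hst ⟨L, h⟩ => ⟨L, fun x hx => h x (hst hx)⟩)
        (fun s t ⟨L, h⟩ ⟨K, h'⟩ => ⟨max L K, fun x hx => ?_⟩) (fun x _ => ?_)
      · rcases hx with hx | hx
        · exact (h x hx).trans (le_max_left _ _)
        · exact (h' x hx).trans (le_max_right _ _)
      · obtain ⟨⟨l, h1⟩, ⟨r', h2⟩⟩ := hl x
        have e1 := h1.abs.eventually_le_const (lt_add_one |l|)
        have e2 := h2.abs.eventually_le_const (lt_add_one |r'|)
        rw [eventually_nhdsWithin_iff] at e1 e2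
        refine ⟨{y | |f y| ≤ max |f x| (max (|l| + 1) (|r'| + 1))},
          mem_nhdsWithin_of_mem_nhds ?_, _, fun y hy => hy⟩
        filter_upwards [e1, e2] with y h1 h2
        rcases lt_trichotomy y x with h | h | h
        · exact (h1 h).trans ((le_max_left _ _).trans (le_max_right _ _))
        · subst h; exact le_max_left _ _
        · exact (h2 h).trans ((le_max_right _ _).trans (le_max_right _ _))
    obtain ⟨L, hL⟩ := key
    exact ⟨L, fun x hx => hL x (abs_le.1 hx)⟩

lemma IsProfile.isTame {f : ℝ → ℝ} (hf : IsProfile f) : IsTame f := hf.piecewiseContinuous.isTame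

lemma IsProfile.bounded {f : ℝ → ℝ} (hf : IsProfile f) : ∃ L : ℝ, 0 < L ∧ ∀ x, |f x| ≤ L := by
  obtain ⟨L, hL⟩ := hf.isTame.bdd 1
  have hp : Function.Periodic f 1 := hf.periodic
  have h2 : ∀ x, |f x| ≤ L := fun x => by
    obtain ⟨y, hy, he⟩ := hp.exists_mem_Ico₀ one_pos x
    rw [he]
    exact hL y (abs_le.2 ⟨by linarith [hy.1], hy.2.le⟩)
  exact ⟨L + 1, by linarith [abs_nonneg (f 0), h2 0], fun x => (h2 x).trans (by linarith)⟩

/-- `f` is a primitive of the tame function `f'`. -/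
structure IsPrim (f f' : ℝ → ℝ) : Prop where
  continuous : Continuous f
  tame : IsTame f'
  hasDerivAt : ∃ S : Set ℝ, S.Countable ∧ ∀ x, x ∉ S → HasDerivAt f (f' x) x

namespace IsPrim

variable {f f' g g' : ℝ → ℝ}

lemma congr (h : IsPrim f f') (hg : ∀ x, f' x = g x) : IsPrim f g := by
  rwa [← (funext hg : f' = g)]

lemma of_integral (h : IsTame f') (c : ℝ) : IsPrim (fun x => c + ∫ t in (0 : ℝ)..x, f' t) f' := by
  refine ⟨?_, h, ?_⟩
  · exact continuous_const.add
      (intervalIntegral.continuous_primitive (fun a b => h.intervalIntegrable a b) 0)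
  · obtain ⟨S, hS, h1⟩ := h.continuousAt
    refine ⟨S, hS, fun x hx => ?_⟩
    refine HasDerivAt.const_add c ?_
    exact intervalIntegral.integral_hasDerivAt_right (h.intervalIntegrable 0 x)
      ⟨univ, univ_mem, (h.aestronglyMeasurable _)⟩ (h1 x hx)

/-- Continuity of `f` lets the fundamental theorem of calculus tolerate a countable exceptional set;
all later identities for solutions are obtained this way instead of through almost everywhere
derivatives. -/
lemma integral_eq (h : IsPrim f f') (a b : ℝ) : ∫ t in a..b, f' t = f b - f a := by
  obtain ⟨S, hS, h1⟩ := h.hasDerivAt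
  exact integral_eq_of_hasDerivAt_off_countable f f' hS
    h.continuous.continuousOn (fun x hx => h1 x hx.2) (h.tame.intervalIntegrable a b)

lemma add (h : IsPrim f f') (k : IsPrim g g') :
    IsPrim (fun x => f x + g x) (fun x => f' x + g' x) := by
  obtain ⟨S, hS, h1⟩ := h.hasDerivAt
  obtain ⟨T, hT, h2⟩ := k.hasDerivAt
  refine ⟨h.continuous.add k.continuous, h.tame.add k.tame, S ∪ T, hS.union hT, fun x hx => ?_⟩
  simp only [mem_union, not_or] at hx
  exact (h1 x hx.1).add (h2 x hx.2)

lemma mul (h : IsPrim f f') (k : IsPrim g g') :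
    IsPrim (fun x => f x * g x) (fun x => f' x * g x + f x * g' x) := by
  obtain ⟨S, hS, h1⟩ := h.hasDerivAt
  obtain ⟨T, hT, h2⟩ := k.hasDerivAt
  refine ⟨h.continuous.mul k.continuous, (h.tame.mul_continuous k.continuous).add
    ((IsTame.of_continuous h.continuous).mul k.tame), S ∪ T, hS.union hT, fun x hx => ?_⟩
  simp only [mem_union, not_or] at hx
  exact (h1 x hx.1).mul (h2 x hx.2)

lemma comp (h : IsPrim f f') {φ φ' : ℝ → ℝ} (hφ : ∀ x, HasDerivAt φ (φ' (f x)) (f x))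
    (hc : Continuous fun x => φ' (f x)) : IsPrim (fun x => φ (f x)) (fun x => φ' (f x) * f' x) := by
  obtain ⟨S, hS, h1⟩ := h.hasDerivAt
  refine ⟨continuous_iff_continuousAt.2 fun x =>
    ContinuousAt.comp (f := f) (hφ x).continuousAt h.continuous.continuousAt,
    (IsTame.of_continuous hc).mul h.tame, S, hS, fun x hx => ?_⟩
  exact HasDerivAt.comp x (hφ x) (h1 x hx)

lemma const (c : ℝ) : IsPrim (fun _ => c) (fun _ => 0) :=
  ⟨continuous_const, IsTame.const 0, ∅, by simp, fun x _ => hasDerivAt_const x c⟩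

lemma const_mul (h : IsPrim f f') (c : ℝ) : IsPrim (fun x => c * f x) (fun x => c * f' x) :=
  ((const c).mul h).congr fun x => by ring

lemma neg (h : IsPrim f f') : IsPrim (fun x => -f x) (fun x => -f' x) := by
  simpa using h.const_mul (-1)

lemma sub (h : IsPrim f f') (k : IsPrim g g') :
    IsPrim (fun x => f x - g x) (fun x => f' x - g' x) := by
  simpa [sub_eq_add_neg] using h.add k.neg

lemma comp_add_const (h : IsPrim f f') (c : ℝ) :
    IsPrim (fun x => f (x + c)) (fun x => f' (x + c)) := by
  obtain ⟨S, hS, h1⟩ := h.hasDerivAt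
  refine ⟨h.continuous.comp (by fun_prop), h.tame.comp_add_const c,
    (fun x => x + c) ⁻¹' S, hS.preimage (add_left_injective c), fun x hx => ?_⟩
  exact HasDerivAt.comp_add_const x c (h1 (x + c) hx)

lemma inv (h : IsPrim f f') (h0 : ∀ x, f x ≠ 0) :
    IsPrim (fun x => (f x)⁻¹) (fun x => -((f x) ^ 2)⁻¹ * f' x) :=
  h.comp (φ := fun y => y⁻¹) (φ' := fun y => -(y ^ 2)⁻¹) (fun x => hasDerivAt_inv (h0 x))
    ((h.continuous.pow 2).inv₀ fun x => pow_ne_zero 2 (h0 x)).neg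

lemma sin (h : IsPrim f f') : IsPrim (fun x => Real.sin (f x)) (fun x => Real.cos (f x) * f' x) :=
  h.comp (fun x => Real.hasDerivAt_sin (f x)) (Real.continuous_cos.comp h.continuous)

lemma cos (h : IsPrim f f') : IsPrim (fun x => Real.cos (f x)) (fun x => -Real.sin (f x) * f' x) :=
  h.comp (φ' := fun y => -Real.sin y) (fun x => Real.hasDerivAt_cos (f x))
    (Real.continuous_sin.comp h.continuous).neg

lemma eq_of_zero (h : IsPrim f f') (h0 : ∀ x, f' x = 0) (a b : ℝ) : f a = f b := by
  have := h.integral_eq a b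
  simp only [h0, intervalIntegral.integral_zero] at this
  linarith

lemma monotone (h : IsPrim f f') {a b : ℝ} (hab : a ≤ b) (h0 : ∀ x ∈ Icc a b, 0 ≤ f' x) :
    f a ≤ f b := by
  have := h.integral_eq a b
  have h2 : 0 ≤ ∫ t in a..b, f' t := intervalIntegral.integral_nonneg hab h0
  linarith

end IsPrim

/-! ### The first order system, Wronskians and uniqueness. -/

/-- Real solutions of the first order system `ψ' = m p`, `p' = - q ψ`. -/
structure IsFlow (m q ψ p : ℝ → ℝ) : Prop where
  left : IsPrim ψ (fun x => m x * p x)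
  right : IsPrim p (fun x => -(q x * ψ x))

namespace IsFlow

variable {m q ψ p φ r : ℝ → ℝ}

lemma comb (h : IsFlow m q ψ p) (k : IsFlow m q φ r) (a b : ℝ) :
    IsFlow m q (fun x => a * ψ x + b * φ x) (fun x => a * p x + b * r x) :=
  ⟨((h.left.const_mul a).add (k.left.const_mul b)).congr fun x => by ring,
    ((h.right.const_mul a).add (k.right.const_mul b)).congr fun x => by ring⟩

lemma shift (h : IsFlow m q ψ p) (hm : ∀ x, m (x + 1) = m x) (hq : ∀ x, q (x + 1) = q x) :
    IsFlow m q (fun x => ψ (x + 1)) (fun x => p (x + 1)) :=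
  ⟨(h.left.comp_add_const 1).congr fun x => by rw [hm], (h.right.comp_add_const 1).congr
    fun x => by rw [hq]⟩

lemma wronskian (h : IsFlow m q ψ p) (k : IsFlow m q φ r) (x : ℝ) :
    ψ x * r x - p x * φ x = ψ 0 * r 0 - p 0 * φ 0 :=
  ((h.left.mul k.right).sub (h.right.mul k.left)).eq_of_zero (fun x => by ring) x 0

/-- Variation of constants. -/
lemma duhamel {m' q' : ℝ → ℝ} (h : IsFlow m' q' ψ p) (k : IsFlow m q φ r) (x : ℝ) :
    ψ x * r x - p x * φ x = ψ 0 * r 0 - p 0 * φ 0 +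
      ∫ t in (0 : ℝ)..x, ((m' t - m t) * (p t * r t) + (q' t - q t) * (ψ t * φ t)) := by
  have := (((h.left.mul k.right).sub (h.right.mul k.left)).congr (g := fun t =>
    (m' t - m t) * (p t * r t) + (q' t - q t) * (ψ t * φ t)) (fun x => by ring)).integral_eq 0 x
  linarith

end IsFlow

/-- A fundamental system of the first order system. -/
structure IsFundamental (m q u₁ u₂ v₁ v₂ : ℝ → ℝ) : Prop where
  u : IsFlow m q u₁ u₂
  v : IsFlow m q v₁ v₂
  u₁_zero : u₁ 0 = 1
  u₂_zero : u₂ 0 = 0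
  v₁_zero : v₁ 0 = 0
  v₂_zero : v₂ 0 = 1

namespace IsFundamental

variable {m q u₁ u₂ v₁ v₂ ψ p : ℝ → ℝ}

lemma det (h : IsFundamental m q u₁ u₂ v₁ v₂) (x : ℝ) : u₁ x * v₂ x - u₂ x * v₁ x = 1 := by
  rw [h.u.wronskian h.v, h.u₁_zero, h.u₂_zero, h.v₁_zero, h.v₂_zero]; norm_num

/-- The Wronskians with the two fundamental solutions are constant, and Cramer's rule with
determinant one recovers the solution. This also gives uniqueness of the initial value problem
without a Gronwall estimate. -/
lemma eq_comb (h : IsFundamental m q u₁ u₂ v₁ v₂) (k : IsFlow m q ψ p) (x : ℝ) :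
    ψ x = ψ 0 * u₁ x + p 0 * v₁ x ∧ p x = ψ 0 * u₂ x + p 0 * v₂ x := by
  have h1 := k.wronskian h.u x
  have h2 := k.wronskian h.v x
  have h3 := h.det x
  rw [h.u₁_zero, h.u₂_zero] at h1
  rw [h.v₁_zero, h.v₂_zero] at h2
  constructor
  · linear_combination (-ψ x) * h3 - v₁ x * h1 + u₁ x * h2
  · linear_combination (-p x) * h3 - v₂ x * h1 + u₂ x * h2

end IsFundamental

end Photonic

/-! ### Global existence by a contraction, and a priori bounds. -/

namespace Photonic

/-- Integrating `exp (K |t|)` gains a factor `1 / K`; in the norm weighted by `exp (-K |x|)` the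
Volterra operators thus become contractions on the whole line at once. -/
lemma exp_neg_mul_abs_integral_le {K G : ℝ} (hK : 0 < K) (hG : 0 ≤ G) {g : ℝ → ℝ}
    (hg : ∀ t, |g t| ≤ G * Real.exp (K * |t|)) (x : ℝ) :
    Real.exp (-(K * |x|)) * |∫ t in (0 : ℝ)..x, g t| ≤ G / K := by
  have pos : ∀ {g : ℝ → ℝ}, (∀ t, |g t| ≤ G * Real.exp (K * |t|)) → ∀ x, 0 ≤ x →
      Real.exp (-(K * |x|)) * |∫ t in (0 : ℝ)..x, g t| ≤ G / K := by
    intro g hg x hx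
    have h1 : |∫ t in (0 : ℝ)..x, g t| ≤ ∫ t in (0 : ℝ)..x, G * Real.exp (K * t) := by
      rw [← Real.norm_eq_abs]
      refine intervalIntegral.norm_integral_le_of_norm_le hx (Eventually.of_forall fun t ht => ?_)
        ((by fun_prop : Continuous fun t => G * Real.exp (K * t)).intervalIntegrable _ _)
      have := hg t
      rwa [abs_of_pos ht.1] at this
    have h2 : ∫ t in (0 : ℝ)..x, G * Real.exp (K * t) = G / K * (Real.exp (K * x) - 1) := by
      have hd : ∀ t, HasDerivAt (fun t => G / K * Real.exp (K * t)) (G * Real.exp (K * t)) t := by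
        intro t
        have := (((hasDerivAt_id t).const_mul K).exp).const_mul (G / K)
        simp only [id, mul_one] at this
        exact this.congr_deriv (by field_simp)
      rw [intervalIntegral.integral_eq_sub_of_hasDerivAt (fun t _ => hd t)
        ((by fun_prop : Continuous fun t => G * Real.exp (K * t)).intervalIntegrable _ _)]
      simp
      ring
    rw [h2] at h1
    rw [abs_of_nonneg hx]
    have h3 : Real.exp (-(K * x)) * Real.exp (K * x) = 1 := by
      rw [← Real.exp_add]; simp
    have hGK : 0 ≤ G / K := by positivity
    calc Real.exp (-(K * x)) * |∫ t in (0 : ℝ)..x, g t|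
        ≤ Real.exp (-(K * x)) * (G / K * (Real.exp (K * x) - 1)) :=
          mul_le_mul_of_nonneg_left h1 (Real.exp_pos _).le
      _ = G / K * (Real.exp (-(K * x)) * Real.exp (K * x)) - G / K * Real.exp (-(K * x)) := by ring
      _ ≤ G / K := by rw [h3]; nlinarith [Real.exp_pos (-(K * x))]
  rcases le_total 0 x with hx | hx
  · exact pos hg x hx
  · have h1 : ∫ t in (0 : ℝ)..x, g t = -∫ t in (0 : ℝ)..(-x), g (-t) := by
      rw [intervalIntegral.integral_comp_neg, neg_neg, neg_zero, intervalIntegral.integral_symm]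
    have := pos (g := fun t => g (-t)) (fun t => by simpa using hg (-t)) (-x) (by linarith)
    rw [h1, abs_neg]
    rwa [abs_neg] at this

lemma IsTame.integrand {f : ℝ → ℝ} (hf : IsTame f) (K : ℝ) (w : BoundedContinuousFunction ℝ ℝ) :
    IsTame (fun t => f t * (Real.exp (K * |t|) * w t)) :=
  hf.mul_continuous ((by fun_prop : Continuous fun t : ℝ => Real.exp (K * |t|)).mul w.continuous)

lemma abs_integrand_le {f : ℝ → ℝ} {L K : ℝ} (hL : ∀ x, |f x| ≤ L)
    (w : BoundedContinuousFunction ℝ ℝ) (t : ℝ) :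
    |f t * (Real.exp (K * |t|) * w t)| ≤ L * ‖w‖ * Real.exp (K * |t|) := by
  have h0 : 0 ≤ L := (abs_nonneg _).trans (hL 0)
  have h1 : |w t| ≤ ‖w‖ := w.norm_coe_le_norm t
  rw [abs_mul, abs_mul, abs_of_pos (Real.exp_pos _)]
  calc |f t| * (Real.exp (K * |t|) * |w t|) ≤ L * (Real.exp (K * |t|) * ‖w‖) := by
        gcongr
        exact hL t
    _ = _ := by ring

/-- The exponentially weighted Volterra operator `w ↦ e^{-K|x|} (a + ∫₀ˣ f e^{K|t|} w)`. -/
noncomputable def volterra (K : ℝ) (hK : 0 < K) (f : ℝ → ℝ) (hf : IsTame f) (L : ℝ)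
    (hL : ∀ x, |f x| ≤ L) (a : ℝ) (w : BoundedContinuousFunction ℝ ℝ) :
    BoundedContinuousFunction ℝ ℝ :=
  BoundedContinuousFunction.ofNormedAddCommGroup
    (fun x => Real.exp (-(K * |x|)) * (a + ∫ t in (0 : ℝ)..x, f t * (Real.exp (K * |t|) * w t)))
    ((by fun_prop : Continuous fun x : ℝ => Real.exp (-(K * |x|))).mul
      (IsPrim.of_integral (hf.integrand K w) a).continuous)
    (|a| + L * ‖w‖ / K) (fun x => by
      have h0 : 0 ≤ L := (abs_nonneg _).trans (hL 0)
      have h1 := exp_neg_mul_abs_integral_le hK (mul_nonneg h0 (norm_nonneg w))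
        (abs_integrand_le hL w) x
      have h2 : Real.exp (-(K * |x|)) ≤ 1 := Real.exp_le_one_iff.2 (by
        have := mul_nonneg hK.le (abs_nonneg x); linarith)
      rw [Real.norm_eq_abs, abs_mul, abs_of_pos (Real.exp_pos _)]
      have h3 := abs_add_le a (∫ t in (0 : ℝ)..x, f t * (Real.exp (K * |t|) * w t))
      have h4 := mul_le_mul_of_nonneg_left h3 (Real.exp_pos (-(K * |x|))).le
      nlinarith [abs_nonneg a])

lemma dist_volterra_le {K : ℝ} (hK : 0 < K) {f : ℝ → ℝ} (hf : IsTame f) {L : ℝ}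
    (hL : ∀ x, |f x| ≤ L) (a : ℝ) (w z : BoundedContinuousFunction ℝ ℝ) :
    dist (volterra K hK f hf L hL a w) (volterra K hK f hf L hL a z) ≤ L / K * dist w z := by
  have h0 : 0 ≤ L := (abs_nonneg _).trans (hL 0)
  refine (BoundedContinuousFunction.dist_le (by positivity)).2 fun x => ?_
  have h1 := exp_neg_mul_abs_integral_le hK (mul_nonneg h0 (norm_nonneg (w - z)))
    (abs_integrand_le hL (w - z)) x
  have h2 : ∫ t in (0 : ℝ)..x, f t * (Real.exp (K * |t|) * (w - z) t) =
      (∫ t in (0 : ℝ)..x, f t * (Real.exp (K * |t|) * w t)) -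
      ∫ t in (0 : ℝ)..x, f t * (Real.exp (K * |t|) * z t) := by
    rw [← intervalIntegral.integral_sub ((hf.integrand K w).intervalIntegrable _ _)
      ((hf.integrand K z).intervalIntegrable _ _)]
    congr 1
    ext t
    simp only [BoundedContinuousFunction.coe_sub, Pi.sub_apply]
    ring
  rw [dist_eq_norm w z, Real.dist_eq]
  simp only [volterra, BoundedContinuousFunction.coe_ofNormedAddCommGroup]
  rw [← mul_sub, add_sub_add_left_eq_sub, ← h2, abs_mul, abs_of_pos (Real.exp_pos _)]
  calc _ ≤ _ := h1
    _ = _ := by ring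

/-- Banach's fixed point theorem for the pair of weighted Volterra operators; multiplying the fixed
point by `exp (K |x|)` undoes the weight. -/
lemma exists_isFlow {m q : ℝ → ℝ} (hm : IsTame m) (hq : IsTame q) {L : ℝ}
    (hmL : ∀ x, |m x| ≤ L) (hqL : ∀ x, |q x| ≤ L) (a b : ℝ) :
    ∃ ψ p : ℝ → ℝ, IsFlow m q ψ p ∧ ψ 0 = a ∧ p 0 = b := by
  have h0 : 0 ≤ L := (abs_nonneg _).trans (hmL 0)
  -- Chosen so that the Lipschitz constant `L / K` is at most `1 / 2`, also when `L = 0`.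
  set K : ℝ := 2 * L + 1 with hKdef
  have hK : 0 < K := by positivity
  have hqL' : ∀ x, |-q x| ≤ L := fun x => by rw [abs_neg]; exact hqL x
  let F : BoundedContinuousFunction ℝ ℝ × BoundedContinuousFunction ℝ ℝ →
      BoundedContinuousFunction ℝ ℝ × BoundedContinuousFunction ℝ ℝ := fun w =>
    (volterra K hK m hm L hmL a w.2, volterra K hK (fun x => -q x) hq.neg L hqL' b w.1)
  have hLK : L / K ≤ 1 / 2 := by
    rw [div_le_iff₀ hK]; linarith
  have hF : ContractingWith (1 / 2) F := by
    refine ⟨by norm_num, LipschitzWith.of_dist_le_mul fun w z => ?_⟩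
    have e1 := dist_volterra_le hK hm hmL a w.2 z.2
    have e2 := dist_volterra_le hK hq.neg hqL' b w.1 z.1
    have e3 : dist w.2 z.2 ≤ dist w z := le_max_right _ _
    have e4 : dist w.1 z.1 ≤ dist w z := le_max_left _ _
    rw [Prod.dist_eq]
    push_cast
    refine max_le (e1.trans ?_) (e2.trans ?_)
    · exact mul_le_mul hLK e3 dist_nonneg (by norm_num)
    · exact mul_le_mul hLK e4 dist_nonneg (by norm_num)
  obtain ⟨w, hw⟩ : ∃ w, F w = w := ⟨_, hF.fixedPoint_isFixedPt⟩
  have hexp : ∀ x : ℝ, Real.exp (K * |x|) * Real.exp (-(K * |x|)) = 1 := fun x => by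
    rw [← Real.exp_add]; simp
  have hw1 : ∀ x, Real.exp (K * |x|) * w.1 x =
      a + ∫ t in (0 : ℝ)..x, m t * (Real.exp (K * |t|) * w.2 t) := fun x => by
    have : w.1 x = (volterra K hK m hm L hmL a w.2) x := by
      conv_lhs => rw [← hw]
    rw [this]
    simp only [volterra, BoundedContinuousFunction.coe_ofNormedAddCommGroup]
    rw [← mul_assoc, hexp, one_mul]
  have hw2 : ∀ x, Real.exp (K * |x|) * w.2 x =
      b + ∫ t in (0 : ℝ)..x, -q t * (Real.exp (K * |t|) * w.1 t) := fun x => by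
    have : w.2 x = (volterra K hK (fun x => -q x) hq.neg L hqL' b w.1) x := by
      conv_lhs => rw [← hw]
    rw [this]
    simp only [volterra, BoundedContinuousFunction.coe_ofNormedAddCommGroup]
    rw [← mul_assoc, hexp, one_mul]
  refine ⟨fun x => Real.exp (K * |x|) * w.1 x, fun x => Real.exp (K * |x|) * w.2 x, ⟨?_, ?_⟩, ?_, ?_⟩
  · have := IsPrim.of_integral (hm.integrand K w.2) a
    rwa [← funext hw1] at this
  · have := IsPrim.of_integral (hq.neg.integrand K w.1) b
    rw [← funext hw2] at this
    exact this.congr fun x => by ring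
  · simp only [hw1]; simp
  · simp only [hw2]; simp

lemma exists_isFundamental {m q : ℝ → ℝ} (hm : IsTame m) (hq : IsTame q) {L : ℝ}
    (hmL : ∀ x, |m x| ≤ L) (hqL : ∀ x, |q x| ≤ L) :
    ∃ u₁ u₂ v₁ v₂ : ℝ → ℝ, IsFundamental m q u₁ u₂ v₁ v₂ := by
  obtain ⟨u₁, u₂, hu, h1, h2⟩ := exists_isFlow hm hq hmL hqL 1 0
  obtain ⟨v₁, v₂, hv, h3, h4⟩ := exists_isFlow hm hq hmL hqL 0 1
  exact ⟨u₁, u₂, v₁, v₂, hu, hv, h1, h2, h3, h4⟩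

/-- A priori bound. -/
lemma IsFlow.sq_add_sq_le {m q ψ p : ℝ → ℝ} (h : IsFlow m q ψ p) {L : ℝ}
    (hmL : ∀ x, |m x| ≤ L) (hqL : ∀ x, |q x| ≤ L) {x : ℝ} (hx : x ∈ Icc (0 : ℝ) 1) :
    ψ x ^ 2 + p x ^ 2 ≤ (ψ 0 ^ 2 + p 0 ^ 2) * Real.exp (2 * L) := by
  have h0 : 0 ≤ L := (abs_nonneg _).trans (hmL 0)
  -- The derivative of `ψ² + p²` is `2 (m - q) ψ p`, at most `2 L (ψ² + p²)`, so this weight makes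
  -- `ψ² + p²` nonincreasing.
  have hexp : IsPrim (fun x => Real.exp (-(2 * L * x))) (fun x => -(2 * L) * Real.exp (-(2 * L * x))) := by
    refine ⟨by fun_prop, IsTame.of_continuous (by fun_prop), ∅, by simp, fun x _ => ?_⟩
    have := (((hasDerivAt_id x).const_mul (2 * L)).neg).exp
    simp only [id, mul_one] at this
    exact this.congr_deriv (by simp only [Pi.neg_apply]; ring)
  have hP := (((h.left.mul h.left).add (h.right.mul h.right)).mul hexp).neg
  have key := hP.monotone hx.1 (fun t _ => ?_)
  · simp only [mul_zero, neg_zero, Real.exp_zero, mul_one] at key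
    have e1 : Real.exp (-(2 * L * x)) * Real.exp (2 * L) ≥ 1 := by
      rw [← Real.exp_add, ge_iff_le, Real.one_le_exp_iff]
      nlinarith [hx.2]
    have e2 : 0 < Real.exp (2 * L) := Real.exp_pos _
    have e3 : 0 ≤ ψ x ^ 2 + p x ^ 2 := by positivity
    calc ψ x ^ 2 + p x ^ 2 ≤ (ψ x ^ 2 + p x ^ 2) * (Real.exp (-(2 * L * x)) * Real.exp (2 * L)) :=
          le_mul_of_one_le_right e3 e1
      _ = ((ψ x * ψ x + p x * p x) * Real.exp (-(2 * L * x))) * Real.exp (2 * L) := by ring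
      _ ≤ (ψ 0 ^ 2 + p 0 ^ 2) * Real.exp (2 * L) := by
          refine mul_le_mul_of_nonneg_right ?_ e2.le
          linarith
  · have e1 : m t - q t ≤ 2 * L := by
      have := abs_le.1 (hmL t); have := abs_le.1 (hqL t); linarith
    have e2 : -(2 * L) ≤ m t - q t := by
      have := abs_le.1 (hmL t); have := abs_le.1 (hqL t); linarith
    have e3 : (m t - q t) * (2 * (ψ t * p t)) ≤ 2 * L * (ψ t * ψ t + p t * p t) := by
      nlinarith [mul_nonneg (sub_nonneg.2 e1) (sq_nonneg (ψ t + p t)),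
        mul_nonneg (by linarith : 0 ≤ 2 * L + (m t - q t)) (sq_nonneg (ψ t - p t))]
    have e4 := mul_nonneg (sub_nonneg.2 e3) (Real.exp_pos (-(2 * L * t))).le
    linarith

lemma IsFlow.abs_le {m q ψ p : ℝ → ℝ} (h : IsFlow m q ψ p) {L : ℝ}
    (hmL : ∀ x, |m x| ≤ L) (hqL : ∀ x, |q x| ≤ L) (h1 : ψ 0 ^ 2 + p 0 ^ 2 ≤ 1)
    {x : ℝ} (hx : x ∈ Icc (0 : ℝ) 1) : |ψ x| ≤ Real.exp L ∧ |p x| ≤ Real.exp L := by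
  have h2 := h.sq_add_sq_le hmL hqL hx
  have h3 : Real.exp (2 * L) = Real.exp L ^ 2 := by rw [two_mul, Real.exp_add, sq]
  have h4 : ψ x ^ 2 + p x ^ 2 ≤ Real.exp L ^ 2 := by
    rw [← h3]
    exact h2.trans (mul_le_of_le_one_left (Real.exp_pos _).le h1)
  exact ⟨abs_le_of_sq_le_sq (by nlinarith [sq_nonneg (p x)]) (Real.exp_pos _).le,
    abs_le_of_sq_le_sq (by nlinarith [sq_nonneg (ψ x)]) (Real.exp_pos _).le⟩

end Photonic

/-! ### Dependence of solutions on the coefficients. -/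

namespace Photonic

lemma abs_integral_le_of_abs_le {g : ℝ → ℝ} {G x : ℝ} (hx : x ∈ Icc (0 : ℝ) 1)
    (hg : ∀ t ∈ Icc (0 : ℝ) 1, |g t| ≤ G) : |∫ t in (0 : ℝ)..x, g t| ≤ G := by
  have hG : 0 ≤ G := (abs_nonneg _).trans (hg 0 (by simp))
  have := intervalIntegral.norm_integral_le_of_norm_le_const (a := (0 : ℝ)) (b := x) (f := g) (C := G)
    (fun t ht => by
      rw [uIoc_of_le hx.1] at ht
      exact hg t ⟨ht.1.le, ht.2.trans hx.2⟩)
  rw [Real.norm_eq_abs, sub_zero, abs_of_nonneg hx.1] at this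
  exact this.trans (mul_le_of_le_one_right hG hx.2)

/-- The bilinear form `∫₀¹ (f y₂ z₂ + g y₁ z₁)`. -/
noncomputable def gram (f g y₁ y₂ z₁ z₂ : ℝ → ℝ) : ℝ :=
  ∫ x in (0 : ℝ)..1, (f x * (y₂ x * z₂ x) + g x * (y₁ x * z₁ x))

section Perturbation

variable {m q m' q' u₁ u₂ v₁ v₂ ψ p : ℝ → ℝ} {L η : ℝ}

lemma IsFundamental.abs_le (hf : IsFundamental m q u₁ u₂ v₁ v₂) (hmL : ∀ x, |m x| ≤ L)
    (hqL : ∀ x, |q x| ≤ L) {t : ℝ} (ht : t ∈ Icc (0 : ℝ) 1) :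
    (|u₁ t| ≤ Real.exp L ∧ |u₂ t| ≤ Real.exp L) ∧ (|v₁ t| ≤ Real.exp L ∧ |v₂ t| ≤ Real.exp L) :=
  ⟨hf.u.abs_le hmL hqL (by simp [hf.u₁_zero, hf.u₂_zero]) ht,
    hf.v.abs_le hmL hqL (by simp [hf.v₁_zero, hf.v₂_zero]) ht⟩

lemma abs_bilin_le {a b c d B e : ℝ} {α β : ℝ} (hα : |α| ≤ η) (hβ : |β| ≤ η)
    (ha : |a| ≤ e) (hb : |b| ≤ B) (hc : |c| ≤ e) (hd : |d| ≤ B) :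
    |α * (a * b) + β * (c * d)| ≤ 2 * η * e * B := by
  have hη : 0 ≤ η := (abs_nonneg _).trans hα
  have he : 0 ≤ e := (abs_nonneg _).trans ha
  have h1 : |α * (a * b)| ≤ η * (e * B) := by
    rw [abs_mul, abs_mul]; gcongr
  have h2 : |β * (c * d)| ≤ η * (e * B) := by
    rw [abs_mul, abs_mul]; gcongr
  calc _ ≤ _ := abs_add_le _ _
    _ ≤ η * (e * B) + η * (e * B) := add_le_add h1 h2
    _ = _ := by ring

lemma abs_sub_mul_le {a b c d B e : ℝ} (ha : |a| ≤ e) (hb : |b| ≤ B) (hc : |c| ≤ e)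
    (hd : |d| ≤ B) : |a * b - c * d| ≤ 2 * e * B := by
  have he : 0 ≤ e := (abs_nonneg _).trans ha
  have h1 : |a * b| ≤ e * B := by rw [abs_mul]; gcongr
  have h2 : |c * d| ≤ e * B := by rw [abs_mul]; gcongr
  calc _ ≤ _ := abs_sub _ _
    _ ≤ e * B + e * B := add_le_add h1 h2
    _ = _ := by ring

/-- Lipschitz dependence of solutions on the coefficients. -/
lemma IsFlow.abs_sub_le (h : IsFlow m' q' ψ p) (hf : IsFundamental m q u₁ u₂ v₁ v₂)
    (hmL : ∀ x, |m x| ≤ L) (hqL : ∀ x, |q x| ≤ L) (hmL' : ∀ x, |m' x| ≤ L) (hqL' : ∀ x, |q' x| ≤ L)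
    (hm : ∀ x, |m' x - m x| ≤ η) (hq : ∀ x, |q' x - q x| ≤ η) (h1 : ψ 0 ^ 2 + p 0 ^ 2 ≤ 1)
    {x : ℝ} (hx : x ∈ Icc (0 : ℝ) 1) :
    |ψ x - (ψ 0 * u₁ x + p 0 * v₁ x)| ≤ 4 * Real.exp L ^ 3 * η ∧
    |p x - (ψ 0 * u₂ x + p 0 * v₂ x)| ≤ 4 * Real.exp L ^ 3 * η := by
  have eu := h.duhamel hf.u x
  have ev := h.duhamel hf.v x
  rw [hf.u₁_zero, hf.u₂_zero] at eu
  rw [hf.v₁_zero, hf.v₂_zero] at ev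
  set I := ∫ t in (0 : ℝ)..x, ((m' t - m t) * (p t * u₂ t) + (q' t - q t) * (ψ t * u₁ t))
  set J := ∫ t in (0 : ℝ)..x, ((m' t - m t) * (p t * v₂ t) + (q' t - q t) * (ψ t * v₁ t))
  have hI : |I| ≤ 2 * η * Real.exp L * Real.exp L := abs_integral_le_of_abs_le hx fun t ht =>
    abs_bilin_le (hm t) (hq t) (h.abs_le hmL' hqL' h1 ht).2 (hf.abs_le hmL hqL ht).1.2
      (h.abs_le hmL' hqL' h1 ht).1 (hf.abs_le hmL hqL ht).1.1
  have hJ : |J| ≤ 2 * η * Real.exp L * Real.exp L := abs_integral_le_of_abs_le hx fun t ht =>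
    abs_bilin_le (hm t) (hq t) (h.abs_le hmL' hqL' h1 ht).2 (hf.abs_le hmL hqL ht).2.2
      (h.abs_le hmL' hqL' h1 ht).1 (hf.abs_le hmL hqL ht).2.1
  obtain ⟨⟨b1, b2⟩, b3, b4⟩ := hf.abs_le hmL hqL hx
  have hd := hf.det x
  constructor
  -- The two Duhamel identities are a linear system for `(ψ x, p x)` with determinant one; this is
  -- its solution.
  · have e : ψ x - (ψ 0 * u₁ x + p 0 * v₁ x) = J * u₁ x - I * v₁ x := by
      linear_combination (-ψ x) * hd + u₁ x * ev - v₁ x * eu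
    rw [e]
    exact (abs_sub_mul_le hJ b1 hI b3).trans (le_of_eq (by ring))
  · have e : p x - (ψ 0 * u₂ x + p 0 * v₂ x) = J * u₂ x - I * v₂ x := by
      linear_combination (-p x) * hd + u₂ x * ev - v₂ x * eu
    rw [e]
    exact (abs_sub_mul_le hJ b2 hI b4).trans (le_of_eq (by ring))

lemma gram_sub_le {y₁ y₂ z₁ z₂ w₁ w₂ f g : ℝ → ℝ} (hf : IsTame f) (hg : IsTame g)
    (hy₁ : Continuous y₁) (hy₂ : Continuous y₂) (hz₁ : Continuous z₁) (hz₂ : Continuous z₂)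
    (hw₁ : Continuous w₁) (hw₂ : Continuous w₂) (hfη : ∀ x, |f x| ≤ η) (hgη : ∀ x, |g x| ≤ η)
    {e B : ℝ} (hy : ∀ t ∈ Icc (0 : ℝ) 1, |y₁ t - w₁ t| ≤ e ∧ |y₂ t - w₂ t| ≤ e)
    (hz : ∀ t ∈ Icc (0 : ℝ) 1, |z₁ t| ≤ B ∧ |z₂ t| ≤ B) :
    |gram f g y₁ y₂ z₁ z₂ - gram f g w₁ w₂ z₁ z₂| ≤ 2 * η * e * B := by
  unfold gram
  rw [← intervalIntegral.integral_sub]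
  · refine abs_integral_le_of_abs_le (by simp) fun t ht => ?_
    have := abs_bilin_le (hfη t) (hgη t) (hy t ht).2 (hz t ht).2 (hy t ht).1 (hz t ht).1
    convert this using 2
    ring
  · exact ((hf.mul_continuous (hy₂.mul hz₂)).add (hg.mul_continuous
      (hy₁.mul hz₁))).intervalIntegrable _ _
  · exact ((hf.mul_continuous (hw₂.mul hz₂)).add (hg.mul_continuous
      (hw₁.mul hz₁))).intervalIntegrable _ _

/-- First order expansion of the solutions at `x = 1` in the coefficients. -/
lemma IsFlow.first_order (h : IsFlow m' q' ψ p) (hf : IsFundamental m q u₁ u₂ v₁ v₂)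
    (tm : IsTame m) (tq : IsTame q) (tm' : IsTame m') (tq' : IsTame q')
    (hmL : ∀ x, |m x| ≤ L) (hqL : ∀ x, |q x| ≤ L) (hmL' : ∀ x, |m' x| ≤ L) (hqL' : ∀ x, |q' x| ≤ L)
    (hm : ∀ x, |m' x - m x| ≤ η) (hq : ∀ x, |q' x - q x| ≤ η) (h1 : ψ 0 ^ 2 + p 0 ^ 2 ≤ 1)
    {y₁ y₂ : ℝ → ℝ} (hy₁ : ∀ x, y₁ x = ψ 0 * u₁ x + p 0 * v₁ x)
    (hy₂ : ∀ x, y₂ x = ψ 0 * u₂ x + p 0 * v₂ x) :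
    |ψ 1 - (y₁ 1 + gram (fun x => m' x - m x) (fun x => q' x - q x) y₁ y₂ v₁ v₂ * u₁ 1
      - gram (fun x => m' x - m x) (fun x => q' x - q x) y₁ y₂ u₁ u₂ * v₁ 1)|
        ≤ 16 * Real.exp L ^ 5 * η ^ 2 ∧
    |p 1 - (y₂ 1 + gram (fun x => m' x - m x) (fun x => q' x - q x) y₁ y₂ v₁ v₂ * u₂ 1
      - gram (fun x => m' x - m x) (fun x => q' x - q x) y₁ y₂ u₁ u₂ * v₂ 1)|
        ≤ 16 * Real.exp L ^ 5 * η ^ 2 := by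
  have eu := h.duhamel hf.u 1
  have ev := h.duhamel hf.v 1
  rw [hf.u₁_zero, hf.u₂_zero] at eu
  rw [hf.v₁_zero, hf.v₂_zero] at ev
  have hc₁ : Continuous y₁ := by
    rw [funext hy₁]
    exact (continuous_const.mul hf.u.left.continuous).add (continuous_const.mul hf.v.left.continuous)
  have hc₂ : Continuous y₂ := by
    rw [funext hy₂]
    exact (continuous_const.mul hf.u.right.continuous).add
      (continuous_const.mul hf.v.right.continuous)
  -- The Duhamel integrals already carry a factor `η`; replacing the true solution in them by the
  -- unperturbed one with the same data costs another factor `η`.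
  have hclose : ∀ t ∈ Icc (0 : ℝ) 1, |ψ t - y₁ t| ≤ 4 * Real.exp L ^ 3 * η ∧
      |p t - y₂ t| ≤ 4 * Real.exp L ^ 3 * η := fun t ht => by
    rw [hy₁, hy₂]
    exact h.abs_sub_le hf hmL hqL hmL' hqL' hm hq h1 ht
  have hI := gram_sub_le (tm'.sub tm) (tq'.sub tq) h.left.continuous h.right.continuous
    hf.u.left.continuous hf.u.right.continuous hc₁ hc₂ hm hq hclose
    (fun t ht => (hf.abs_le hmL hqL ht).1)
  have hJ := gram_sub_le (tm'.sub tm) (tq'.sub tq) h.left.continuous h.right.continuous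
    hf.v.left.continuous hf.v.right.continuous hc₁ hc₂ hm hq hclose
    (fun t ht => (hf.abs_le hmL hqL ht).2)
  change _ = _ + gram (fun x => m' x - m x) (fun x => q' x - q x) ψ p u₁ u₂ at eu
  change _ = _ + gram (fun x => m' x - m x) (fun x => q' x - q x) ψ p v₁ v₂ at ev
  obtain ⟨⟨b1, b2⟩, b3, b4⟩ := hf.abs_le hmL hqL (t := 1) (by simp)
  have hd := hf.det 1
  set I := gram (fun x => m' x - m x) (fun x => q' x - q x) ψ p u₁ u₂
  set J := gram (fun x => m' x - m x) (fun x => q' x - q x) ψ p v₁ v₂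
  set I' := gram (fun x => m' x - m x) (fun x => q' x - q x) y₁ y₂ u₁ u₂
  set J' := gram (fun x => m' x - m x) (fun x => q' x - q x) y₁ y₂ v₁ v₂
  constructor
  · have e : ψ 1 - (y₁ 1 + J' * u₁ 1 - I' * v₁ 1) = (J - J') * u₁ 1 - (I - I') * v₁ 1 := by
      rw [hy₁]
      linear_combination (-ψ 1) * hd + u₁ 1 * ev - v₁ 1 * eu
    rw [e]
    exact (abs_sub_mul_le hJ b1 hI b3).trans (le_of_eq (by ring))
  · have e : p 1 - (y₂ 1 + J' * u₂ 1 - I' * v₂ 1) = (J - J') * u₂ 1 - (I - I') * v₂ 1 := by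
      rw [hy₂]
      linear_combination (-p 1) * hd + u₂ 1 * ev - v₂ 1 * eu
    rw [e]
    exact (abs_sub_mul_le hJ b2 hI b4).trans (le_of_eq (by ring))

end Perturbation

lemma hasDerivAt_of_abs_sub_le_sq {f : ℝ → ℝ} {d x C : ℝ}
    (h : ∀ y, |y - x| ≤ 1 → |f y - f x - (y - x) * d| ≤ C * (y - x) ^ 2) : HasDerivAt f d x := by
  rw [hasDerivAt_iff_isLittleO]
  have h1 : (fun y => f y - f x - (y - x) • d) =O[𝓝 x] fun y => (y - x) ^ 2 := by
    refine Asymptotics.IsBigO.of_bound C ?_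
    filter_upwards [Metric.closedBall_mem_nhds x one_pos] with y hy
    rw [Metric.mem_closedBall, Real.dist_eq] at hy
    rw [smul_eq_mul, Real.norm_eq_abs, Real.norm_eq_abs, abs_of_nonneg (sq_nonneg (y - x))]
    exact h y hy
  refine h1.trans_isLittleO ?_
  have h2 : Tendsto (fun y => y - x) (𝓝 x) (𝓝 0) := by
    have : ContinuousAt (fun y => y - x) x := by fun_prop
    simpa [ContinuousAt] using this
  exact (Asymptotics.isLittleO_pow_id (𝕜 := ℝ) one_lt_two).comp_tendsto h2

open Classical in
/-- A fundamental system of the first order system, as a quadruple. -/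
noncomputable def fund (m q : ℝ → ℝ) : (ℝ → ℝ) × (ℝ → ℝ) × (ℝ → ℝ) × (ℝ → ℝ) :=
  Classical.epsilon fun f => IsFundamental m q f.1 f.2.1 f.2.2.1 f.2.2.2

lemma isFundamental_fund {m q : ℝ → ℝ} (hm : IsTame m) (hq : IsTame q) {L : ℝ}
    (hmL : ∀ x, |m x| ≤ L) (hqL : ∀ x, |q x| ≤ L) :
    IsFundamental m q (fund m q).1 (fund m q).2.1 (fund m q).2.2.1 (fund m q).2.2.2 := by
  obtain ⟨u₁, u₂, v₁, v₂, h⟩ := exists_isFundamental hm hq hmL hqL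
  exact Classical.epsilon_spec
    (p := fun f : (ℝ → ℝ) × (ℝ → ℝ) × (ℝ → ℝ) × (ℝ → ℝ) => IsFundamental m q f.1 f.2.1 f.2.2.1 f.2.2.2)
    ⟨(u₁, u₂, v₁, v₂), h⟩

/-! ### The transfer matrix and its derivative in the energy. -/

section Structure

variable (μ ε : ℝ → ℝ) (E : ℝ)

/-- First component of the first column of the transfer matrix. -/
noncomputable def colU₁ : ℝ → ℝ := (fund μ fun x => E * ε x).1
/-- Second component of the first column of the transfer matrix. -/
noncomputable def colU₂ : ℝ → ℝ := (fund μ fun x => E * ε x).2.1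
/-- First component of the second column of the transfer matrix. -/
noncomputable def colV₁ : ℝ → ℝ := (fund μ fun x => E * ε x).2.2.1
/-- Second component of the second column of the transfer matrix. -/
noncomputable def colV₂ : ℝ → ℝ := (fund μ fun x => E * ε x).2.2.2

/-- The discriminant: the trace of the monodromy matrix. -/
noncomputable def disc : ℝ := colU₁ μ ε E 1 + colV₂ μ ε E 1

variable {μ ε}

lemma isFundamental_col (hμ : IsProfile μ) (hε : IsProfile ε) :
    IsFundamental μ (fun x => E * ε x) (colU₁ μ ε E) (colU₂ μ ε E) (colV₁ μ ε E) (colV₂ μ ε E) := by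
  obtain ⟨L, hL0, hL⟩ := hμ.bounded
  obtain ⟨K, hK0, hK⟩ := hε.bounded
  refine isFundamental_fund hμ.isTame (hε.isTame.const_mul E) (L := L + |E| * K) (fun x => ?_)
    (fun x => ?_)
  · exact (hL x).trans (by have : 0 ≤ |E| * K := by positivity
                           linarith)
  · rw [abs_mul]
    have := mul_le_mul_of_nonneg_left (hK x) (abs_nonneg E)
    linarith

variable (μ ε)

/-- `∫₀¹ ε u₁²`. -/
noncomputable def weightUU : ℝ := ∫ x in (0 : ℝ)..1, ε x * (colU₁ μ ε E x * colU₁ μ ε E x)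
/-- `∫₀¹ ε u₁ v₁`. -/
noncomputable def weightUV : ℝ := ∫ x in (0 : ℝ)..1, ε x * (colU₁ μ ε E x * colV₁ μ ε E x)
/-- `∫₀¹ ε v₁²`. -/
noncomputable def weightVV : ℝ := ∫ x in (0 : ℝ)..1, ε x * (colV₁ μ ε E x * colV₁ μ ε E x)

variable {μ ε}

/-- This is `IsFlow.first_order` with unchanged `μ`: only `q = E ε` moves, by `(E' - E) ε`, so the
Gram integrals reduce to the weights. The quadratic remainder gives differentiability in `E`. -/
lemma exists_abs_expansion_le (hμ : IsProfile μ) (hε : IsProfile ε) : ∃ C : ℝ, ∀ E', |E' - E| ≤ 1 →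
    (|colU₁ μ ε E' 1 - colU₁ μ ε E 1 - (E' - E) * (weightUV μ ε E * colU₁ μ ε E 1
        - weightUU μ ε E * colV₁ μ ε E 1)| ≤ C * (E' - E) ^ 2 ∧
      |colU₂ μ ε E' 1 - colU₂ μ ε E 1 - (E' - E) * (weightUV μ ε E * colU₂ μ ε E 1
        - weightUU μ ε E * colV₂ μ ε E 1)| ≤ C * (E' - E) ^ 2) ∧
    (|colV₁ μ ε E' 1 - colV₁ μ ε E 1 - (E' - E) * (weightVV μ ε E * colU₁ μ ε E 1
        - weightUV μ ε E * colV₁ μ ε E 1)| ≤ C * (E' - E) ^ 2 ∧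
      |colV₂ μ ε E' 1 - colV₂ μ ε E 1 - (E' - E) * (weightVV μ ε E * colU₂ μ ε E 1
        - weightUV μ ε E * colV₂ μ ε E 1)| ≤ C * (E' - E) ^ 2) := by
  obtain ⟨L₀, hL0, hL⟩ := hμ.bounded
  obtain ⟨K, hK0, hK⟩ := hε.bounded
  set L := L₀ + (|E| + 1) * K with hLdef
  have hmL : ∀ x, |μ x| ≤ L := fun x => (hL x).trans (by
    have : 0 ≤ (|E| + 1) * K := by positivity
    linarith)
  have hqL : ∀ E', |E' - E| ≤ 1 → ∀ x, |E' * ε x| ≤ L := fun E' hE' x => by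
    rw [abs_mul]
    have h1 : |E'| ≤ |E| + 1 := by
      have := abs_sub_abs_le_abs_sub E' E; linarith
    have := mul_le_mul h1 (hK x) (abs_nonneg _) (by positivity)
    linarith
  have hf := isFundamental_col E hμ hε
  have g1 : ∀ (h : ℝ) (y₁ y₂ z₁ z₂ : ℝ → ℝ), gram (fun x => μ x - μ x) (fun x => (E + h) * ε x - E * ε x)
      y₁ y₂ z₁ z₂ = h * ∫ x in (0 : ℝ)..1, ε x * (y₁ x * z₁ x) := by
    intro h y₁ y₂ z₁ z₂
    unfold gram
    rw [← intervalIntegral.integral_const_mul]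
    congr 1
    ext x
    ring
  refine ⟨16 * Real.exp L ^ 5 * K ^ 2, fun E' hE' => ?_⟩
  obtain ⟨h, rfl⟩ : ∃ h, E' = E + h := ⟨E' - E, by ring⟩
  have hf' := isFundamental_col (E + h) hμ hε
  rw [add_sub_cancel_left] at hE' ⊢
  have hη1 : ∀ x, |μ x - μ x| ≤ |h| * K := fun x => by simp; positivity
  have hη2 : ∀ x, |(E + h) * ε x - E * ε x| ≤ |h| * K := fun x => by
    rw [← sub_mul, add_sub_cancel_left, abs_mul]
    exact mul_le_mul_of_nonneg_left (hK x) (abs_nonneg h)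
  have hC : 16 * Real.exp L ^ 5 * (|h| * K) ^ 2 = 16 * Real.exp L ^ 5 * K ^ 2 * h ^ 2 := by
    rw [mul_pow, sq_abs]; ring
  have eu := hf'.u.first_order hf hμ.isTame (hε.isTame.const_mul E) hμ.isTame
    (hε.isTame.const_mul (E + h)) hmL (hqL E (by simp)) hmL (hqL (E + h) (by simpa using hE')) hη1 hη2
    (by simp [hf'.u₁_zero, hf'.u₂_zero]) (y₁ := colU₁ μ ε E) (y₂ := colU₂ μ ε E)
    (by simp [hf'.u₁_zero, hf'.u₂_zero]) (by simp [hf'.u₁_zero, hf'.u₂_zero])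
  have ev := hf'.v.first_order hf hμ.isTame (hε.isTame.const_mul E) hμ.isTame
    (hε.isTame.const_mul (E + h)) hmL (hqL E (by simp)) hmL (hqL (E + h) (by simpa using hE')) hη1 hη2
    (by simp [hf'.v₁_zero, hf'.v₂_zero]) (y₁ := colV₁ μ ε E) (y₂ := colV₂ μ ε E)
    (by simp [hf'.v₁_zero, hf'.v₂_zero]) (by simp [hf'.v₁_zero, hf'.v₂_zero])
  rw [hC] at eu ev
  simp only [g1] at eu ev
  have hsymm : ∫ x in (0 : ℝ)..1, ε x * (colV₁ μ ε E x * colU₁ μ ε E x) = weightUV μ ε E := by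
    unfold weightUV
    congr 1
    ext x
    ring
  rw [hsymm] at ev
  change |_ - (_ + h * weightUV μ ε E * _ - h * weightUU μ ε E * _)| ≤ _ ∧
    |_ - (_ + h * weightUV μ ε E * _ - h * weightUU μ ε E * _)| ≤ _ at eu
  change |_ - (_ + h * weightVV μ ε E * _ - _)| ≤ _ ∧ |_ - (_ + h * weightVV μ ε E * _ - _)| ≤ _ at ev
  refine ⟨⟨?_, ?_⟩, ?_, ?_⟩
  · convert eu.1 using 2; ring
  · convert eu.2 using 2; ring
  · convert ev.1 using 2; ring
  · convert ev.2 using 2; ring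

lemma hasDerivAt_colU₁ (hμ : IsProfile μ) (hε : IsProfile ε) :
    HasDerivAt (fun E => colU₁ μ ε E 1) (weightUV μ ε E * colU₁ μ ε E 1
      - weightUU μ ε E * colV₁ μ ε E 1) E :=
  let ⟨_, hC⟩ := exists_abs_expansion_le E hμ hε
  hasDerivAt_of_abs_sub_le_sq fun E' h => (hC E' h).1.1

lemma hasDerivAt_colU₂ (hμ : IsProfile μ) (hε : IsProfile ε) :
    HasDerivAt (fun E => colU₂ μ ε E 1) (weightUV μ ε E * colU₂ μ ε E 1
      - weightUU μ ε E * colV₂ μ ε E 1) E :=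
  let ⟨_, hC⟩ := exists_abs_expansion_le E hμ hε
  hasDerivAt_of_abs_sub_le_sq fun E' h => (hC E' h).1.2

lemma hasDerivAt_colV₁ (hμ : IsProfile μ) (hε : IsProfile ε) :
    HasDerivAt (fun E => colV₁ μ ε E 1) (weightVV μ ε E * colU₁ μ ε E 1
      - weightUV μ ε E * colV₁ μ ε E 1) E :=
  let ⟨_, hC⟩ := exists_abs_expansion_le E hμ hε
  hasDerivAt_of_abs_sub_le_sq fun E' h => (hC E' h).2.1

lemma hasDerivAt_colV₂ (hμ : IsProfile μ) (hε : IsProfile ε) :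
    HasDerivAt (fun E => colV₂ μ ε E 1) (weightVV μ ε E * colU₂ μ ε E 1
      - weightUV μ ε E * colV₂ μ ε E 1) E :=
  let ⟨_, hC⟩ := exists_abs_expansion_le E hμ hε
  hasDerivAt_of_abs_sub_le_sq fun E' h => (hC E' h).2.2

end Structure

end Photonic

/-! ### The Prüfer angle and its growth with the energy. -/

namespace Photonic

lemma pos_of_continuous_of_ne_zero {f : ℝ → ℝ} (hf : Continuous f) (h0 : ∀ x, f x ≠ 0) {a : ℝ}
    (ha : 0 < f a) (x : ℝ) : 0 < f x := by
  by_contra hx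
  obtain ⟨y, hy⟩ := mem_range_of_exists_le_of_exists_ge hf ⟨x, not_lt.1 hx⟩ ⟨a, ha.le⟩
  exact h0 y hy

/-- The angle of the curve `(p, ψ)`. -/
noncomputable def angle (m q ψ p : ℝ → ℝ) (x : ℝ) : ℝ :=
  ∫ t in (0 : ℝ)..x, (m t * (p t ^ 2 / (ψ t ^ 2 + p t ^ 2)) + q t * (ψ t ^ 2 / (ψ t ^ 2 + p t ^ 2)))

namespace IsFlow

variable {m q ψ p : ℝ → ℝ}

lemma isTame_angle (h : IsFlow m q ψ p) (hm : IsTame m) (hq : IsTame q)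
    (h0 : ∀ x, ψ x ^ 2 + p x ^ 2 ≠ 0) :
    IsTame fun t => m t * (p t ^ 2 / (ψ t ^ 2 + p t ^ 2)) + q t * (ψ t ^ 2 / (ψ t ^ 2 + p t ^ 2)) := by
  have h1 := h.left.continuous
  have h2 := h.right.continuous
  have h3 : Continuous fun t => ψ t ^ 2 + p t ^ 2 := by fun_prop
  exact (hm.mul_continuous ((h2.pow 2).div h3 h0)).add (hq.mul_continuous ((h1.pow 2).div h3 h0))

lemma isPrim_angle (h : IsFlow m q ψ p) (hm : IsTame m) (hq : IsTame q)
    (h0 : ∀ x, ψ x ^ 2 + p x ^ 2 ≠ 0) :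
    IsPrim (angle m q ψ p) fun t =>
      m t * (p t ^ 2 / (ψ t ^ 2 + p t ^ 2)) + q t * (ψ t ^ 2 / (ψ t ^ 2 + p t ^ 2)) := by
  have := IsPrim.of_integral (h.isTame_angle hm hq h0) 0
  simp only [zero_add] at this
  exact this

/-- The angle is defined as an integral, and this identifies it with the polar angle of `(p, ψ)`.
The component `Y = ψ cos θ - p sin θ` orthogonal to the direction `θ` vanishes at `0` and stays
zero, while the component along `θ` is continuous, never zero and positive at `0`. -/
lemma polar (h : IsFlow m q ψ p) (hm : IsTame m) (hq : IsTame q)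
    (h0 : ∀ x, ψ x ^ 2 + p x ^ 2 ≠ 0) (hψ : ψ 0 = 0) (hp : p 0 = 1) (x : ℝ) :
    ∃ r : ℝ, 0 < r ∧ ψ x = r * Real.sin (angle m q ψ p x) ∧
      p x = r * Real.cos (angle m q ψ p x) := by
  have hθ := h.isPrim_angle hm hq h0
  set θ := angle m q ψ p with hθdef
  have hθ0 : θ 0 = 0 := by simp [hθdef, angle]
  have hr := (h.left.mul h.left).add (h.right.mul h.right)
  have h0' : ∀ x, ψ x * ψ x + p x * p x ≠ 0 := fun x => by simpa [sq] using h0 x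
  have hY := (h.left.mul hθ.cos).sub (h.right.mul hθ.sin)
  -- `Y²` and `ψ² + p²` satisfy the same linear equation, with rate `2 (m - q) ψ p / (ψ² + p²)`, so
  -- their quotient is constant.
  have hG := (hY.mul hY).mul (hr.inv h0')
  have hY0 : ∀ x, ψ x * Real.cos (θ x) - p x * Real.sin (θ x) = 0 := fun x => by
    have := hG.eq_of_zero (fun t => ?_) x 0
    · simp only [hψ, hθ0, Real.sin_zero, mul_zero, zero_mul, sub_zero] at this
      have h1 := (mul_eq_zero.1 this).resolve_right (inv_ne_zero (h0' x))
      exact mul_self_eq_zero.1 h1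
    · have e := h0 t
      have e' := h0' t
      have e2 : (ψ t * ψ t + p t * p t) = ψ t ^ 2 + p t ^ 2 := by ring
      rw [e2]
      field_simp
      ring
  have hcX : Continuous fun x => p x * Real.cos (θ x) + ψ x * Real.sin (θ x) := by
    have h1 := h.left.continuous
    have h2 := h.right.continuous
    have h3 := hθ.continuous
    fun_prop
  refine ⟨p x * Real.cos (θ x) + ψ x * Real.sin (θ x), ?_, ?_, ?_⟩
  · refine pos_of_continuous_of_ne_zero hcX (fun y hy => h0 y ?_) (a := 0) ?_ x
    · have h1 := Real.sin_sq_add_cos_sq (θ y)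
      have h2 := hY0 y
      calc ψ y ^ 2 + p y ^ 2 = (ψ y ^ 2 + p y ^ 2) * (Real.sin (θ y) ^ 2 + Real.cos (θ y) ^ 2) := by
            rw [h1, mul_one]
        _ = (ψ y * Real.cos (θ y) - p y * Real.sin (θ y)) ^ 2
            + (p y * Real.cos (θ y) + ψ y * Real.sin (θ y)) ^ 2 := by ring
        _ = 0 := by rw [h2, hy]; norm_num
    · simp [hp, hθ0]
  · linear_combination (-ψ x) * Real.sin_sq_add_cos_sq (θ x) + Real.cos (θ x) * hY0 x
  · linear_combination (-p x) * Real.sin_sq_add_cos_sq (θ x) - Real.sin (θ x) * hY0 x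

/-- Rescaling the first component changes the angle by less than `π / 2`. -/
lemma angle_scale_sub_lt (h : IsFlow m q ψ p) (hm : IsTame m) (hq : IsTame q)
    (h0 : ∀ x, ψ x ^ 2 + p x ^ 2 ≠ 0) (hψ : ψ 0 = 0) (hp : p 0 = 1) {s : ℝ} (hs : 0 < s) (x : ℝ) :
    angle (fun t => s * m t) (fun t => s⁻¹ * q t) (fun t => s * ψ t) p x - angle m q ψ p x
      < Real.pi / 2 := by
  have h0' : ∀ x, (s * ψ x) ^ 2 + p x ^ 2 ≠ 0 := fun x hx => by
    have h1 : (s * ψ x) ^ 2 = 0 := by nlinarith [sq_nonneg (s * ψ x), sq_nonneg (p x)]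
    have h2 : p x ^ 2 = 0 := by nlinarith [sq_nonneg (s * ψ x), sq_nonneg (p x)]
    have h3 : ψ x = 0 := by
      have := pow_eq_zero_iff (two_ne_zero) |>.1 h1
      exact (mul_eq_zero.1 this).resolve_left hs.ne'
    exact h0 x (by rw [h2, h3]; norm_num)
  have k : IsFlow (fun t => s * m t) (fun t => s⁻¹ * q t) (fun t => s * ψ t) p :=
    ⟨(h.left.const_mul s).congr fun x => by ring, h.right.congr fun x => by field_simp⟩
  have hc1 := (h.isPrim_angle hm hq h0).continuous
  have hc2 := (k.isPrim_angle (hm.const_mul s) (hq.const_mul s⁻¹) h0').continuous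
  by_contra hcon
  rw [not_lt] at hcon
  -- The difference of angles starts at zero, so it would have to equal `π / 2` somewhere.
  obtain ⟨y, hy⟩ := mem_range_of_exists_le_of_exists_ge (hc2.sub hc1) (c := Real.pi / 2)
    ⟨0, by simp [angle]; positivity⟩ ⟨x, hcon⟩
  obtain ⟨r, hr, e1, e2⟩ := h.polar hm hq h0 hψ hp y
  obtain ⟨r', hr', e3, e4⟩ := k.polar (hm.const_mul s) (hq.const_mul s⁻¹) h0' (by simp [hψ]) hp y
  simp only [Pi.sub_apply] at hy
  have hcos : Real.cos (angle (fun t => s * m t) (fun t => s⁻¹ * q t) (fun t => s * ψ t) p y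
      - angle m q ψ p y) = 0 := by rw [hy, Real.cos_pi_div_two]
  rw [Real.cos_sub] at hcos
  -- At such a point the vectors `(p, ψ)` and `(p, s ψ)` would be orthogonal, but their inner
  -- product `p² + s ψ²` is positive.
  have e5 : p y * p y + s * (ψ y * ψ y) = 0 := by
    set θ := angle m q ψ p y
    set θ' := angle (fun t => s * m t) (fun t => s⁻¹ * q t) (fun t => s * ψ t) p y
    linear_combination r * r' * hcos + p y * e4 + r' * Real.cos θ' * e2 + ψ y * e3
      + r' * Real.sin θ' * e1
  have e6 : ψ y * ψ y = 0 := by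
    have h1 := mul_nonneg hs.le (mul_self_nonneg (ψ y))
    have h2 := mul_self_nonneg (p y)
    have : s * (ψ y * ψ y) = 0 := by linarith
    exact (mul_eq_zero.1 this).resolve_left hs.ne'
  exact h0 y (by rw [sq, sq, e6]; rw [e6] at e5; linarith)

end IsFlow

lemma IsFundamental.v_ne_zero {m q u₁ u₂ v₁ v₂ : ℝ → ℝ} (h : IsFundamental m q u₁ u₂ v₁ v₂)
    (x : ℝ) : v₁ x ^ 2 + v₂ x ^ 2 ≠ 0 := fun hx => by
  have h1 : v₁ x = 0 := by nlinarith [sq_nonneg (v₁ x), sq_nonneg (v₂ x)]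
  have h2 : v₂ x = 0 := by nlinarith [sq_nonneg (v₁ x), sq_nonneg (v₂ x)]
  have := h.det x
  rw [h1, h2] at this
  norm_num at this

/-- The angle at `x = 1` of the solution with data `(0, 1)` at `x = 0`. -/
noncomputable def rotation (μ ε : ℝ → ℝ) (E : ℝ) : ℝ :=
  angle μ (fun x => E * ε x) (colV₁ μ ε E) (colV₂ μ ε E) 1

variable {μ ε : ℝ → ℝ}

lemma exists_polar (hμ : IsProfile μ) (hε : IsProfile ε) (E : ℝ) :
    ∃ r : ℝ, 0 < r ∧ colV₁ μ ε E 1 = r * Real.sin (rotation μ ε E) ∧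
      colV₂ μ ε E 1 = r * Real.cos (rotation μ ε E) := by
  have hf := isFundamental_col E hμ hε
  exact hf.v.polar hμ.isTame (hε.isTame.const_mul E) hf.v_ne_zero hf.v₁_zero hf.v₂_zero 1

/-- Scaling `ψ` by `√E` turns the coefficients into `√E μ` and `√E ε`. The angular speed is then a
convex combination of the two, hence at least `c √E`, and the rescaling costs less than `π / 2`. -/
lemma rotation_lower_bound (hμ : IsProfile μ) (hε : IsProfile ε) {c : ℝ} (hc : 0 < c)
    (hcμ : ∀ x, c ≤ μ x) (hcε : ∀ x, c ≤ ε x) {E : ℝ} (hE : 0 < E) :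
    c * √E - Real.pi / 2 < rotation μ ε E := by
  have hf := isFundamental_col E hμ hε
  have hs : 0 < √E := Real.sqrt_pos.2 hE
  have h1 := hf.v.angle_scale_sub_lt hμ.isTame (hε.isTame.const_mul E) hf.v_ne_zero hf.v₁_zero
    hf.v₂_zero hs 1
  change _ - rotation μ ε E < _ at h1
  suffices c * √E ≤ angle (fun t => √E * μ t) (fun t => (√E)⁻¹ * (E * ε t))
      (fun t => √E * colV₁ μ ε E t) (colV₂ μ ε E) 1 by linarith
  have hne : ∀ x, (√E * colV₁ μ ε E x) ^ 2 + colV₂ μ ε E x ^ 2 ≠ 0 := fun x hx => by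
    have h2 : (√E * colV₁ μ ε E x) ^ 2 = 0 := by
      nlinarith [sq_nonneg (√E * colV₁ μ ε E x), sq_nonneg (colV₂ μ ε E x)]
    have h3 : colV₂ μ ε E x ^ 2 = 0 := by
      nlinarith [sq_nonneg (√E * colV₁ μ ε E x), sq_nonneg (colV₂ μ ε E x)]
    have h4 : colV₁ μ ε E x = 0 :=
      (mul_eq_zero.1 (pow_eq_zero_iff (two_ne_zero) |>.1 h2)).resolve_left hs.ne'
    exact hf.v_ne_zero x (by rw [h3, h4]; norm_num)
  have k : IsFlow (fun t => √E * μ t) (fun t => (√E)⁻¹ * (E * ε t)) (fun t => √E * colV₁ μ ε E t)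
      (colV₂ μ ε E) :=
    ⟨(hf.v.left.const_mul _).congr fun x => by ring, hf.v.right.congr fun x => by field_simp⟩
  have ht := k.isTame_angle (hμ.isTame.const_mul _) ((hε.isTame.const_mul E).const_mul _) hne
  have h5 := intervalIntegral.integral_mono_on (a := 0) (b := 1) zero_le_one
    (intervalIntegrable_const (c := c * √E)) (ht.intervalIntegrable 0 1) (fun t _ => ?_)
  · simpa [angle] using h5
  · have e1 : (√E)⁻¹ * (E * ε t) = √E * ε t := by
      nth_rewrite 2 [← Real.mul_self_sqrt hE.le]
      field_simp
    rw [e1]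
    have hpos : 0 < (√E * colV₁ μ ε E t) ^ 2 + colV₂ μ ε E t ^ 2 :=
      lt_of_le_of_ne (by positivity) (hne t).symm
    set A := (√E * colV₁ μ ε E t) ^ 2
    set B := colV₂ μ ε E t ^ 2 with hB
    have hA0 : 0 ≤ A := sq_nonneg _
    have hB0 : 0 ≤ B := sq_nonneg _
    calc c * √E = √E * c * (B / (A + B)) + √E * c * (A / (A + B)) := by field_simp; ring
      _ ≤ √E * μ t * (B / (A + B)) + √E * ε t * (A / (A + B)) := by
        gcongr
        · exact hcμ t
        · exact hcε t

lemma tendsto_rotation (hμ : IsCoefficient μ) (hε : IsCoefficient ε) :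
    Tendsto (rotation μ ε) atTop atTop := by
  obtain ⟨c, hc, hcμ⟩ := hμ.pos
  obtain ⟨d, hd, hdε⟩ := hε.pos
  have h1 : Tendsto (fun E : ℝ => min c d * √E + -(Real.pi / 2)) atTop atTop :=
    tendsto_atTop_add_const_right _ _ (Tendsto.const_mul_atTop (lt_min hc hd) Real.tendsto_sqrt_atTop)
  refine tendsto_atTop_mono' _ ?_ h1
  filter_upwards [eventually_gt_atTop 0] with E hE
  have := rotation_lower_bound hμ.toIsProfile hε.toIsProfile (lt_min hc hd)
    (fun x => (min_le_left _ _).trans (hcμ x)) (fun x => (min_le_right _ _).trans (hdε x)) hE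
  linarith

end Photonic

/-! ### Joint continuity in the perturbation parameter and the energy. -/

namespace Photonic

lemma PiecewiseContinuous.perturbed {f g : ℝ → ℝ} (hf : PiecewiseContinuous f)
    (hg : PiecewiseContinuous g) (δ : ℝ) : PiecewiseContinuous (perturbed f g δ) := by
  obtain ⟨S, hS, hc, hl⟩ := hf
  obtain ⟨T, hT, hd, hk⟩ := hg
  refine ⟨S ∪ T, fun a b => ?_, fun x hx => ?_, fun x => ?_⟩
  · rw [union_inter_distrib_right]
    exact (hS a b).union (hT a b)
  · simp only [mem_union, not_or] at hx
    exact (hc x hx.1).add ((hd x hx.2).const_mul δ)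
  · obtain ⟨⟨l, h1⟩, r, h2⟩ := hl x
    obtain ⟨⟨l', h3⟩, r', h4⟩ := hk x
    exact ⟨⟨_, h1.add (h3.const_mul δ)⟩, _, h2.add (h4.const_mul δ)⟩

lemma IsProfile.perturbed {f g : ℝ → ℝ} (hf : IsProfile f) (hg : IsProfile g) (δ : ℝ) :
    IsProfile (perturbed f g δ) :=
  ⟨hf.piecewiseContinuous.perturbed hg.piecewiseContinuous δ, fun x => by
    simp only [Photonic.perturbed, hf.periodic, hg.periodic]⟩

lemma IsCoefficient.exists_perturbed {f g : ℝ → ℝ} (hf : IsCoefficient f) (hg : IsProfile g) :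
    ∃ δ₀ > 0, ∀ δ : ℝ, |δ| < δ₀ → IsCoefficient (Photonic.perturbed f g δ) := by
  obtain ⟨c, hc, hcf⟩ := hf.pos
  obtain ⟨L, hL0, hL⟩ := hg.bounded
  refine ⟨c / (2 * L), by positivity, fun δ hδ => ⟨hf.toIsProfile.perturbed hg δ, c / 2, by positivity,
    fun x => ?_⟩⟩
  have h1 : |δ * g x| ≤ c / (2 * L) * L := by
    rw [abs_mul]
    exact mul_le_mul hδ.le (hL x) (abs_nonneg _) (by positivity)
  have h2 : c / (2 * L) * L = c / 2 := by field_simp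
  have := (abs_le.1 (h1.trans h2.le)).1
  simp only [Photonic.perturbed]
  linarith [hcf x]

section Continuity

variable {μ ε μ₁ ε₁ : ℝ → ℝ}

/-- The coefficients of the first order system differ by at most `ζ s` in the supremum norm, and
solutions are Lipschitz in the coefficients. The bound is stated on a whole period because the angle
depends on the whole solution. -/
lemma exists_abs_col_sub_le (hμ : IsProfile μ) (hε : IsProfile ε) (hμ₁ : IsProfile μ₁)
    (hε₁ : IsProfile ε₁) (s₀ : ℝ × ℝ) : ∃ η : ℝ × ℝ → ℝ, Tendsto η (𝓝 s₀) (𝓝 0) ∧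
      ∀ᶠ s in 𝓝 s₀, ∀ t ∈ Icc (0 : ℝ) 1,
      (|colU₁ (perturbed μ μ₁ s.1) (perturbed ε ε₁ s.1) s.2 t
        - colU₁ (perturbed μ μ₁ s₀.1) (perturbed ε ε₁ s₀.1) s₀.2 t| ≤ η s ∧
       |colU₂ (perturbed μ μ₁ s.1) (perturbed ε ε₁ s.1) s.2 t
        - colU₂ (perturbed μ μ₁ s₀.1) (perturbed ε ε₁ s₀.1) s₀.2 t| ≤ η s) ∧
      (|colV₁ (perturbed μ μ₁ s.1) (perturbed ε ε₁ s.1) s.2 t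
        - colV₁ (perturbed μ μ₁ s₀.1) (perturbed ε ε₁ s₀.1) s₀.2 t| ≤ η s ∧
       |colV₂ (perturbed μ μ₁ s.1) (perturbed ε ε₁ s.1) s.2 t
        - colV₂ (perturbed μ μ₁ s₀.1) (perturbed ε ε₁ s₀.1) s₀.2 t| ≤ η s) := by
  obtain ⟨K₁, h10, h1⟩ := hμ.bounded
  obtain ⟨K₂, h20, h2⟩ := hε.bounded
  obtain ⟨K₃, h30, h3⟩ := hμ₁.bounded
  obtain ⟨K₄, h40, h4⟩ := hε₁.bounded
  obtain ⟨δ₀, E₀⟩ := s₀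
  set A := |δ₀| + 1
  set B := |E₀| + 1
  have hA : 0 < A := by positivity
  have hB : 0 < B := by positivity
  set L := K₁ + A * K₃ + B * (K₂ + A * K₄)
  set ζ : ℝ × ℝ → ℝ := fun s => |s.1 - δ₀| * K₃ + |s.2 - E₀| * (K₂ + A * K₄) + B * (|s.1 - δ₀| * K₄)
  have bd1 : ∀ δ, |δ| ≤ A → ∀ x, |perturbed μ μ₁ δ x| ≤ L := fun δ hδ x => by
    have e1 : |δ * μ₁ x| ≤ A * K₃ := by rw [abs_mul]; gcongr; exact h3 x
    have e2 : 0 ≤ B * (K₂ + A * K₄) := by positivity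
    have e3 := abs_add_le (μ x) (δ * μ₁ x)
    have e4 := h1 x
    simp only [perturbed]
    linarith
  have bd2' : ∀ δ, |δ| ≤ A → ∀ x, |perturbed ε ε₁ δ x| ≤ K₂ + A * K₄ := fun δ hδ x => by
    have e1 : |δ * ε₁ x| ≤ A * K₄ := by rw [abs_mul]; gcongr; exact h4 x
    have e3 := abs_add_le (ε x) (δ * ε₁ x)
    have e4 := h2 x
    simp only [perturbed]
    linarith
  have bd2 : ∀ δ E, |δ| ≤ A → |E| ≤ B → ∀ x, |E * perturbed ε ε₁ δ x| ≤ L := fun δ E hδ hE x => by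
    have e1 : |E * perturbed ε ε₁ δ x| ≤ B * (K₂ + A * K₄) := by
      rw [abs_mul]; gcongr; exact bd2' δ hδ x
    have e2 : 0 ≤ K₁ + A * K₃ := by positivity
    linarith
  refine ⟨fun s => 4 * Real.exp L ^ 3 * ζ s, ?_, ?_⟩
  · have : Continuous fun s => 4 * Real.exp L ^ 3 * ζ s := by fun_prop
    have h := this.tendsto (δ₀, E₀)
    simpa [ζ] using h
  · have n1 : ∀ᶠ s in 𝓝 (δ₀, E₀), |s.1 - δ₀| < 1 :=
      (by fun_prop : Continuous fun s : ℝ × ℝ => |s.1 - δ₀|).continuousAt.eventually_lt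
        continuousAt_const (by simp)
    have n2 : ∀ᶠ s in 𝓝 (δ₀, E₀), |s.2 - E₀| < 1 :=
      (by fun_prop : Continuous fun s : ℝ × ℝ => |s.2 - E₀|).continuousAt.eventually_lt
        continuousAt_const (by simp)
    filter_upwards [n1, n2] with s hs1 hs2 t ht
    obtain ⟨δ, E⟩ := s
    simp only at hs1 hs2 ⊢
    have hδA : |δ| ≤ A := by have := abs_sub_abs_le_abs_sub δ δ₀; simp only [A]; linarith
    have hEB : |E| ≤ B := by have := abs_sub_abs_le_abs_sub E E₀; simp only [B]; linarith
    have hδA0 : |δ₀| ≤ A := by simp only [A]; linarith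
    have hEB0 : |E₀| ≤ B := by simp only [B]; linarith
    have hf := isFundamental_col E (hμ.perturbed hμ₁ δ) (hε.perturbed hε₁ δ)
    have hf₀ := isFundamental_col E₀ (hμ.perturbed hμ₁ δ₀) (hε.perturbed hε₁ δ₀)
    have c1 : ∀ x, |perturbed μ μ₁ δ x - perturbed μ μ₁ δ₀ x| ≤ ζ (δ, E) := fun x => by
      have e1 : perturbed μ μ₁ δ x - perturbed μ μ₁ δ₀ x = (δ - δ₀) * μ₁ x := by
        simp only [perturbed]; ring
      have e2 : |(δ - δ₀) * μ₁ x| ≤ |δ - δ₀| * K₃ := by rw [abs_mul]; gcongr; exact h3 x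
      have e3 : 0 ≤ |E - E₀| * (K₂ + A * K₄) + B * (|δ - δ₀| * K₄) := by positivity
      rw [e1]; simp only [ζ]; linarith
    have c2 : ∀ x, |E * perturbed ε ε₁ δ x - E₀ * perturbed ε ε₁ δ₀ x| ≤ ζ (δ, E) := fun x => by
      have e1 : E * perturbed ε ε₁ δ x - E₀ * perturbed ε ε₁ δ₀ x
          = (E - E₀) * perturbed ε ε₁ δ x + E₀ * ((δ - δ₀) * ε₁ x) := by
        simp only [perturbed]; ring
      have e2 : |(E - E₀) * perturbed ε ε₁ δ x| ≤ |E - E₀| * (K₂ + A * K₄) := by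
        rw [abs_mul]; gcongr; exact bd2' δ hδA x
      have e3 : |E₀ * ((δ - δ₀) * ε₁ x)| ≤ B * (|δ - δ₀| * K₄) := by
        rw [abs_mul, abs_mul]; gcongr; exact h4 x
      have e4 : 0 ≤ |δ - δ₀| * K₃ := by positivity
      have e5 := abs_add_le ((E - E₀) * perturbed ε ε₁ δ x) (E₀ * ((δ - δ₀) * ε₁ x))
      rw [e1]; simp only [ζ]; linarith
    have eu := hf.u.abs_sub_le hf₀ (bd1 _ hδA0) (bd2 _ _ hδA0 hEB0) (bd1 _ hδA) (bd2 _ _ hδA hEB)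
      c1 c2 (by simp [hf.u₁_zero, hf.u₂_zero]) ht
    have ev := hf.v.abs_sub_le hf₀ (bd1 _ hδA0) (bd2 _ _ hδA0 hEB0) (bd1 _ hδA) (bd2 _ _ hδA hEB)
      c1 c2 (by simp [hf.v₁_zero, hf.v₂_zero]) ht
    simp only [hf.u₁_zero, hf.u₂_zero, one_mul, zero_mul, add_zero] at eu
    simp only [hf.v₁_zero, hf.v₂_zero, one_mul, zero_mul, zero_add] at ev
    exact ⟨eu, ev⟩

lemma continuous_of_abs_sub_le {f : ℝ × ℝ → ℝ} (h : ∀ s₀, ∃ η : ℝ × ℝ → ℝ,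
    Tendsto η (𝓝 s₀) (𝓝 0) ∧ ∀ᶠ s in 𝓝 s₀, |f s - f s₀| ≤ η s) : Continuous f := by
  refine continuous_iff_continuousAt.2 fun s₀ => ?_
  obtain ⟨η, h1, h2⟩ := h s₀
  have := squeeze_zero_norm' (h2.mono fun s hs => by rwa [Real.norm_eq_abs]) h1
  rw [ContinuousAt, ← tendsto_sub_nhds_zero_iff]
  exact this

lemma continuous_colU₁ (hμ : IsProfile μ) (hε : IsProfile ε) (hμ₁ : IsProfile μ₁)
    (hε₁ : IsProfile ε₁) {t : ℝ} (ht : t ∈ Icc (0 : ℝ) 1) :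
    Continuous fun s : ℝ × ℝ => colU₁ (perturbed μ μ₁ s.1) (perturbed ε ε₁ s.1) s.2 t :=
  continuous_of_abs_sub_le fun s₀ =>
    let ⟨η, h1, h2⟩ := exists_abs_col_sub_le hμ hε hμ₁ hε₁ s₀
    ⟨η, h1, h2.mono fun _ hs => (hs t ht).1.1⟩

lemma continuous_colU₂ (hμ : IsProfile μ) (hε : IsProfile ε) (hμ₁ : IsProfile μ₁)
    (hε₁ : IsProfile ε₁) {t : ℝ} (ht : t ∈ Icc (0 : ℝ) 1) :
    Continuous fun s : ℝ × ℝ => colU₂ (perturbed μ μ₁ s.1) (perturbed ε ε₁ s.1) s.2 t :=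
  continuous_of_abs_sub_le fun s₀ =>
    let ⟨η, h1, h2⟩ := exists_abs_col_sub_le hμ hε hμ₁ hε₁ s₀
    ⟨η, h1, h2.mono fun _ hs => (hs t ht).1.2⟩

lemma continuous_colV₁ (hμ : IsProfile μ) (hε : IsProfile ε) (hμ₁ : IsProfile μ₁)
    (hε₁ : IsProfile ε₁) {t : ℝ} (ht : t ∈ Icc (0 : ℝ) 1) :
    Continuous fun s : ℝ × ℝ => colV₁ (perturbed μ μ₁ s.1) (perturbed ε ε₁ s.1) s.2 t :=
  continuous_of_abs_sub_le fun s₀ =>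
    let ⟨η, h1, h2⟩ := exists_abs_col_sub_le hμ hε hμ₁ hε₁ s₀
    ⟨η, h1, h2.mono fun _ hs => (hs t ht).2.1⟩

lemma continuous_colV₂ (hμ : IsProfile μ) (hε : IsProfile ε) (hμ₁ : IsProfile μ₁)
    (hε₁ : IsProfile ε₁) {t : ℝ} (ht : t ∈ Icc (0 : ℝ) 1) :
    Continuous fun s : ℝ × ℝ => colV₂ (perturbed μ μ₁ s.1) (perturbed ε ε₁ s.1) s.2 t :=
  continuous_of_abs_sub_le fun s₀ =>
    let ⟨η, h1, h2⟩ := exists_abs_col_sub_le hμ hε hμ₁ hε₁ s₀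
    ⟨η, h1, h2.mono fun _ hs => (hs t ht).2.2⟩

/-- Dominated convergence: the fractions in the angular speed lie in `[0, 1]`, so the coefficient
bounds dominate, and the speed is continuous in the parameters at each fixed `t`. -/
lemma continuous_rotation (hμ : IsProfile μ) (hε : IsProfile ε) (hμ₁ : IsProfile μ₁)
    (hε₁ : IsProfile ε₁) :
    Continuous fun s : ℝ × ℝ => rotation (perturbed μ μ₁ s.1) (perturbed ε ε₁ s.1) s.2 := by
  refine continuous_iff_continuousAt.2 fun s₀ => ?_
  obtain ⟨K₁, h10, h1⟩ := hμ.bounded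
  obtain ⟨K₂, h20, h2⟩ := hε.bounded
  obtain ⟨K₃, h30, h3⟩ := hμ₁.bounded
  obtain ⟨K₄, h40, h4⟩ := hε₁.bounded
  obtain ⟨δ₀, E₀⟩ := s₀
  set A := |δ₀| + 1
  set B := |E₀| + 1
  have hA : 0 < A := by positivity
  have hB : 0 < B := by positivity
  refine intervalIntegral.tendsto_integral_filter_of_dominated_convergence
    (fun _ => K₁ + A * K₃ + B * (K₂ + A * K₄)) (Eventually.of_forall fun s => ?_) ?_
    intervalIntegrable_const (Eventually.of_forall fun t ht => ?_)
  · have hf := isFundamental_col s.2 (hμ.perturbed hμ₁ s.1) (hε.perturbed hε₁ s.1)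
    exact (hf.v.isTame_angle (hμ.perturbed hμ₁ s.1).isTame ((hε.perturbed hε₁ s.1).isTame.const_mul _)
      hf.v_ne_zero).aestronglyMeasurable _
  · have n1 : ∀ᶠ s in 𝓝 (δ₀, E₀), |s.1 - δ₀| < 1 :=
      (by fun_prop : Continuous fun s : ℝ × ℝ => |s.1 - δ₀|).continuousAt.eventually_lt
        continuousAt_const (by simp)
    have n2 : ∀ᶠ s in 𝓝 (δ₀, E₀), |s.2 - E₀| < 1 :=
      (by fun_prop : Continuous fun s : ℝ × ℝ => |s.2 - E₀|).continuousAt.eventually_lt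
        continuousAt_const (by simp)
    filter_upwards [n1, n2] with s hs1 hs2
    refine Eventually.of_forall fun t _ => ?_
    obtain ⟨δ, E⟩ := s
    simp only at hs1 hs2 ⊢
    have hδA : |δ| ≤ A := by have := abs_sub_abs_le_abs_sub δ δ₀; simp only [A]; linarith
    have hEB : |E| ≤ B := by have := abs_sub_abs_le_abs_sub E E₀; simp only [B]; linarith
    have e1 : |perturbed μ μ₁ δ t| ≤ K₁ + A * K₃ := by
      refine (abs_add_le _ _).trans (add_le_add (h1 t) ?_)
      rw [abs_mul]; gcongr; exact h3 t
    have e2 : |E * perturbed ε ε₁ δ t| ≤ B * (K₂ + A * K₄) := by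
      rw [abs_mul]; gcongr
      refine (abs_add_le _ _).trans (add_le_add (h2 t) ?_)
      rw [abs_mul]; gcongr; exact h4 t
    have frac : ∀ a b : ℝ, |a ^ 2 / (b ^ 2 + a ^ 2)| ≤ 1 := fun a b => by
      rw [abs_of_nonneg (by positivity)]
      exact div_le_one_of_le₀ (by nlinarith [sq_nonneg b]) (by positivity)
    rw [Real.norm_eq_abs]
    refine (abs_add_le _ _).trans (add_le_add ?_ ?_)
    · rw [abs_mul]
      exact (mul_le_of_le_one_right (abs_nonneg _) (frac _ _)).trans e1
    · rw [abs_mul, add_comm (_ ^ 2)]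
      exact (mul_le_of_le_one_right (abs_nonneg _) (frac _ _)).trans e2
  · have ht' : t ∈ Icc (0 : ℝ) 1 := by
      rw [uIoc_of_le zero_le_one] at ht
      exact Ioc_subset_Icc_self ht
    have hf₀ := isFundamental_col E₀ (hμ.perturbed hμ₁ δ₀) (hε.perturbed hε₁ δ₀)
    have c1 := continuous_colV₁ hμ hε hμ₁ hε₁ ht'
    have c2 := continuous_colV₂ hμ hε hμ₁ hε₁ ht'
    have k1 := (c1.pow 2).tendsto (δ₀, E₀)
    have k2 := (c2.pow 2).tendsto (δ₀, E₀)
    have k3 : Tendsto (fun s : ℝ × ℝ => perturbed μ μ₁ s.1 t) (𝓝 (δ₀, E₀)) (𝓝 (perturbed μ μ₁ δ₀ t)) :=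
      (by unfold perturbed; fun_prop : Continuous fun s : ℝ × ℝ => perturbed μ μ₁ s.1 t).tendsto _
    have k4 : Tendsto (fun s : ℝ × ℝ => s.2 * perturbed ε ε₁ s.1 t) (𝓝 (δ₀, E₀))
        (𝓝 (E₀ * perturbed ε ε₁ δ₀ t)) :=
      (by unfold perturbed; fun_prop :
        Continuous fun s : ℝ × ℝ => s.2 * perturbed ε ε₁ s.1 t).tendsto _
    exact (k3.mul (k2.div (k1.add k2) (hf₀.v_ne_zero t))).add
      (k4.mul (k1.div (k1.add k2) (hf₀.v_ne_zero t)))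

lemma perturbed_zero (f g : ℝ → ℝ) : perturbed f g 0 = f := by
  ext x
  simp [perturbed]

lemma continuous_rotation_right (hμ : IsProfile μ) (hε : IsProfile ε) : Continuous (rotation μ ε) := by
  have := (continuous_rotation hμ hε hμ hε).comp
    (by fun_prop : Continuous fun E : ℝ => ((0 : ℝ), E))
  simpa [Function.comp_def, perturbed_zero] using this

end Continuity

end Photonic

/-! ### One-directional crossings, energies below zero, and the Dirichlet energies. -/

namespace Photonic

section Upcrossing

variable {f : ℝ → ℝ} {x y : ℝ}

/-- At the first point where `f ≤ 0` the function would vanish with positive values just to the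
left, against the upcrossing condition. -/
lemma pos_of_pos_of_upcrossing (hxy : x ≤ y) (hc : ContinuousOn f (Icc x y))
    (h : ∀ z ∈ Icc x y, f z = 0 → ∀ᶠ w in 𝓝[<] z, f w < 0) (hx : 0 < f x) : 0 < f y := by
  by_contra hy
  rw [not_lt] at hy
  set S := Icc x y ∩ f ⁻¹' Iic 0
  have hS : IsClosed S := hc.preimage_isClosed_of_isClosed isClosed_Icc isClosed_Iic
  have hSb : BddBelow S := ⟨x, fun w hw => hw.1.1⟩
  have hne : S.Nonempty := ⟨y, ⟨hxy, le_rfl⟩, hy⟩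
  have hz := hS.csInf_mem hne hSb
  set z := sInf S with hzdef
  have hlt : ∀ w, x ≤ w → w < z → 0 < f w := fun w h1 h2 => by
    by_contra h3
    exact absurd (csInf_le hSb (show w ∈ S from ⟨⟨h1, h2.le.trans hz.1.2⟩, not_lt.1 h3⟩))
      (not_le.2 h2)
  have hxz : x < z := by
    refine lt_of_le_of_ne hz.1.1 fun h => ?_
    have := hz.2
    rw [← h] at this
    exact absurd this (not_le.2 hx)
  have hev : ∀ᶠ w in 𝓝[<] z, 0 < f w := by
    filter_upwards [Ioo_mem_nhdsLT hxz] with w hw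
    exact hlt w hw.1.le hw.2
  have hz0 : f z = 0 := by
    refine le_antisymm hz.2 ?_
    have : Tendsto f (𝓝[<] z) (𝓝 (f z)) := by
      refine ((hc z hz.1).mono_of_mem_nhdsWithin ?_)
      exact mem_of_superset (Ioo_mem_nhdsLT hxz) fun w hw => ⟨hw.1.le, hw.2.le.trans hz.1.2⟩
    exact ge_of_tendsto this (hev.mono fun w hw => hw.le)
  obtain ⟨w, hw1, hw2⟩ := (hev.and (h z hz.1 hz0)).exists
  exact lt_asymm hw1 hw2

lemma pos_right_of_upcrossing (hxy : x < y) (hc : ContinuousOn f (Icc x y))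
    (h : ∀ z ∈ Icc x y, f z = 0 → (∀ᶠ w in 𝓝[<] z, f w < 0) ∧ ∀ᶠ w in 𝓝[>] z, 0 < f w)
    (hx : f x = 0) : 0 < f y := by
  have h1 := (h x ⟨le_rfl, hxy.le⟩ hx).2
  obtain ⟨w, hw, hw1, hw2⟩ := (h1.and (Ioo_mem_nhdsGT hxy)).exists
  exact pos_of_pos_of_upcrossing hw2.le (hc.mono (Icc_subset_Icc hw1.le le_rfl))
    (fun z hz hz0 => (h z ⟨hw1.le.trans hz.1, hz.2⟩ hz0).1) hw

lemma neg_left_of_upcrossing (hxy : x < y) (hc : ContinuousOn f (Icc x y))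
    (h : ∀ z ∈ Icc x y, f z = 0 → (∀ᶠ w in 𝓝[<] z, f w < 0) ∧ ∀ᶠ w in 𝓝[>] z, 0 < f w)
    (hy : f y = 0) : f x < 0 := by
  rcases lt_trichotomy (f x) 0 with h1 | h1 | h1
  · exact h1
  · exact absurd (pos_right_of_upcrossing hxy hc h h1) (by rw [hy]; exact lt_irrefl _)
  · exact absurd (pos_of_pos_of_upcrossing hxy.le hc (fun z hz hz0 => (h z hz hz0).1) h1)
      (by rw [hy]; exact lt_irrefl _)

lemma eventually_of_hasDerivAt_pos {d : ℝ} (hd : HasDerivAt f d x) (hpos : 0 < d) (h0 : f x = 0) :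
    (∀ᶠ w in 𝓝[<] x, f w < 0) ∧ ∀ᶠ w in 𝓝[>] x, 0 < f w := by
  have h1 := (hasDerivAt_iff_tendsto_slope.1 hd).eventually (lt_mem_nhds hpos)
  have hl := h1.filter_mono (nhdsWithin_mono x (fun w (hw : w < x) => hw.ne))
  have hr := h1.filter_mono (nhdsWithin_mono x (fun w (hw : x < w) => hw.ne'))
  constructor
  · filter_upwards [hl, self_mem_nhdsWithin] with w hw hwx
    rw [slope_def_field, h0, sub_zero] at hw
    rcases div_pos_iff.1 hw with h | h
    · exact absurd h.2 (not_lt.2 (sub_nonpos.2 (le_of_lt hwx)))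
    · exact h.1
  · filter_upwards [hr, self_mem_nhdsWithin] with w hw hwx
    rw [slope_def_field, h0, sub_zero] at hw
    rcases div_pos_iff.1 hw with h | h
    · exact h.1
    · exact absurd h.2 (not_lt.2 (sub_nonneg.2 (le_of_lt hwx)))

end Upcrossing

variable {μ ε : ℝ → ℝ}

lemma IsCoefficient.integral_pos (hμ : IsCoefficient μ) : 0 < ∫ x in (0 : ℝ)..1, μ x := by
  obtain ⟨c, hc, hcμ⟩ := hμ.pos
  exact intervalIntegral.intervalIntegral_pos_of_pos (hμ.isTame.intervalIntegrable _ _)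
    (fun x => hc.trans_le (hcμ x)) one_pos

/-- The form is `∫ ε w²` with `w = x u₁ + y v₁`. If `w` vanished on the period, its value at `0`
would give `x = 0`, its flux would be the constant `y`, and `y ∫ μ = 0` would give `y = 0`. -/
lemma weight_pos (hμ : IsCoefficient μ) (hε : IsCoefficient ε) (E : ℝ) {x y : ℝ}
    (hxy : x ≠ 0 ∨ y ≠ 0) :
    0 < x ^ 2 * weightUU μ ε E + 2 * x * y * weightUV μ ε E + y ^ 2 * weightVV μ ε E := by
  have hf := isFundamental_col E hμ.toIsProfile hε.toIsProfile
  obtain ⟨c, hc, hcε⟩ := hε.pos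
  have k := hf.u.comb hf.v x y
  set w := fun t => x * colU₁ μ ε E t + y * colV₁ μ ε E t with hw
  set w₂ := fun t => x * colU₂ μ ε E t + y * colV₂ μ ε E t with hw₂
  have hwc : Continuous w := k.left.continuous
  have cu := hf.u.left.continuous
  have cv := hf.v.left.continuous
  have hex : ∃ t ∈ Icc (0 : ℝ) 1, w t ≠ 0 := by
    by_contra hcon
    push Not at hcon
    have hx : x = 0 := by
      have := hcon 0 (by simp)
      simpa [hw, hf.u₁_zero, hf.v₁_zero] using this
    have h2 : ∀ t ∈ Icc (0 : ℝ) 1, w₂ t = y := fun t ht => by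
      have h3 := k.right.integral_eq 0 t
      rw [intervalIntegral.integral_congr (g := fun _ => 0)] at h3
      · simp only [intervalIntegral.integral_zero] at h3
        have : w₂ 0 = y := by simp [hw₂, hf.u₂_zero, hf.v₂_zero]
        simp only [hw₂] at this ⊢
        linarith
      · intro s hs
        rw [uIcc_of_le ht.1] at hs
        have := hcon s ⟨hs.1, hs.2.trans ht.2⟩
        simp only [this, mul_zero, neg_zero]
    have h3 := k.left.integral_eq 0 1
    rw [intervalIntegral.integral_congr (g := fun t => μ t * y)] at h3
    · have e0 := hcon 0 (by simp)
      have e1 := hcon 1 (by simp)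
      rw [e0, e1, intervalIntegral.integral_mul_const, sub_zero] at h3
      have := (mul_eq_zero.1 h3).resolve_left hμ.integral_pos.ne'
      rcases hxy with h | h
      · exact h hx
      · exact h this
    · intro s hs
      rw [uIcc_of_le zero_le_one] at hs
      have := h2 s hs
      simp only [this]
  have e : x ^ 2 * weightUU μ ε E + 2 * x * y * weightUV μ ε E + y ^ 2 * weightVV μ ε E =
      ∫ t in (0 : ℝ)..1, ε t * (w t * w t) := by
    have i1 : IntervalIntegrable (fun t => ε t * (colU₁ μ ε E t * colU₁ μ ε E t)) volume 0 1 :=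
      (hε.isTame.mul_continuous (cu.mul cu)).intervalIntegrable 0 1
    have i2 : IntervalIntegrable (fun t => ε t * (colU₁ μ ε E t * colV₁ μ ε E t)) volume 0 1 :=
      (hε.isTame.mul_continuous (cu.mul cv)).intervalIntegrable 0 1
    have i3 : IntervalIntegrable (fun t => ε t * (colV₁ μ ε E t * colV₁ μ ε E t)) volume 0 1 :=
      (hε.isTame.mul_continuous (cv.mul cv)).intervalIntegrable 0 1
    unfold weightUU weightUV weightVV
    rw [← intervalIntegral.integral_const_mul, ← intervalIntegral.integral_const_mul,
      ← intervalIntegral.integral_const_mul, ← intervalIntegral.integral_add (i1.const_mul _)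
      (i2.const_mul _), ← intervalIntegral.integral_add ((i1.const_mul _).add (i2.const_mul _))
      (i3.const_mul _)]
    congr 1
    ext t
    simp only [hw]
    ring
  rw [e]
  have h1 : 0 < ∫ t in (0 : ℝ)..1, c * (w t * w t) := by
    refine intervalIntegral.integral_pos one_pos (by fun_prop)
      (fun t _ => mul_nonneg hc.le (mul_self_nonneg _)) ?_
    obtain ⟨t, ht, h0⟩ := hex
    exact ⟨t, ht, mul_pos hc (mul_self_pos.2 h0)⟩
  refine h1.trans_le (intervalIntegral.integral_mono_on zero_le_one
    ((by fun_prop : Continuous fun t => c * (w t * w t)).intervalIntegrable _ _)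
    ((hε.isTame.mul_continuous (hwc.mul hwc)).intervalIntegrable _ _) fun t _ => ?_)
  exact mul_le_mul_of_nonneg_right (hcε t) (mul_self_nonneg _)

lemma weightUU_pos (hμ : IsCoefficient μ) (hε : IsCoefficient ε) (E : ℝ) : 0 < weightUU μ ε E := by
  simpa using weight_pos hμ hε E (x := 1) (y := 0) (by simp)

lemma weightVV_pos (hμ : IsCoefficient μ) (hε : IsCoefficient ε) (E : ℝ) : 0 < weightVV μ ε E := by
  simpa using weight_pos hμ hε E (x := 0) (y := 1) (by simp)

lemma weight_det_pos (hμ : IsCoefficient μ) (hε : IsCoefficient ε) (E : ℝ) :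
    weightUV μ ε E ^ 2 < weightUU μ ε E * weightVV μ ε E := by
  have h1 := weightUU_pos hμ hε E
  -- For this vector the form equals `weightUU` times the determinant.
  have h2 := weight_pos hμ hε E (x := -weightUV μ ε E) (y := weightUU μ ε E) (Or.inr h1.ne')
  have h3 : 0 < weightUU μ ε E * (weightUU μ ε E * weightVV μ ε E - weightUV μ ε E ^ 2) := by
    calc (0 : ℝ) < _ := h2
      _ = _ := by ring
  have := (pos_iff_pos_of_mul_pos h3).1 h1
  linarith

/-- Below the energy `0` the discriminant exceeds `2` in absolute value. -/
lemma four_lt_disc_sq_of_neg (hμ : IsCoefficient μ) (hε : IsCoefficient ε) {E : ℝ} (hE : E < 0) :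
    4 < disc μ ε E ^ 2 := by
  have hf := isFundamental_col E hμ.toIsProfile hε.toIsProfile
  obtain ⟨c, hc, hcμ⟩ := hμ.pos
  obtain ⟨d, hd, hdε⟩ := hε.pos
  -- For `E < 0` the derivative `μ p² - E ε ψ²` of `ψ p` is nonnegative; starting from zero, `ψ p`
  -- stays nonnegative, which makes `u₁²` and `v₂²` nondecreasing.
  have nonneg : ∀ {ψ p : ℝ → ℝ}, IsFlow μ (fun x => E * ε x) ψ p → ∀ x, 0 ≤
      μ x * p x * p x + ψ x * -(E * ε x * ψ x) := fun {ψ p} _ x => by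
    have h1 := mul_nonneg (hc.le.trans (hcμ x)) (mul_self_nonneg (p x))
    have h2 := mul_nonneg (mul_nonneg (neg_nonneg.2 hE.le) (hd.le.trans (hdε x)))
      (mul_self_nonneg (ψ x))
    nlinarith
  have prod_nonneg : ∀ {ψ p : ℝ → ℝ}, IsFlow μ (fun x => E * ε x) ψ p → ψ 0 * p 0 = 0 →
      ∀ x, 0 ≤ x → 0 ≤ ψ x * p x := fun {ψ p} h h0 x hx => by
    have := (h.left.mul h.right).monotone hx (fun t _ => nonneg h t)
    linarith
  have u_ge : ∀ x ∈ Icc (0 : ℝ) 1, 1 ≤ colU₁ μ ε E x ^ 2 := fun x hx => by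
    have := (hf.u.left.mul hf.u.left).monotone hx.1 (fun t ht => by
      have h1 := prod_nonneg hf.u (by simp [hf.u₂_zero]) t ht.1
      have h2 := mul_nonneg (hc.le.trans (hcμ t)) h1
      nlinarith)
    rw [hf.u₁_zero] at this
    nlinarith
  have v_ge : ∀ x ∈ Icc (0 : ℝ) 1, 1 ≤ colV₂ μ ε E x ^ 2 := fun x hx => by
    have := (hf.v.right.mul hf.v.right).monotone hx.1 (fun t ht => by
      have h1 := prod_nonneg hf.v (by simp [hf.v₁_zero]) t ht.1
      have h2 := mul_nonneg (mul_nonneg (neg_nonneg.2 hE.le) (hd.le.trans (hdε t))) h1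
      nlinarith)
    rw [hf.v₂_zero] at this
    nlinarith
  have key : ∀ {f : ℝ → ℝ}, Continuous f → f 0 = 1 → (∀ x ∈ Icc (0 : ℝ) 1, 1 ≤ f x ^ 2) → 0 < f 1 := by
    intro f hfc hf0 hf1
    by_contra hcon
    obtain ⟨t, ht, h0⟩ := intermediate_value_Icc' zero_le_one hfc.continuousOn
      (show (0 : ℝ) ∈ Icc (f 1) (f 0) from ⟨not_lt.1 hcon, by rw [hf0]; norm_num⟩)
    have := hf1 t ht
    rw [h0] at this
    norm_num at this
  have hu := key hf.u.left.continuous hf.u₁_zero u_ge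
  have hv := key hf.v.right.continuous hf.v₂_zero v_ge
  have strict : ∀ {ψ p : ℝ → ℝ}, IsFlow μ (fun x => E * ε x) ψ p → ψ 0 * p 0 = 0 →
      (∃ e : ℝ, 0 < e ∧ ∀ x ∈ Icc (0 : ℝ) 1, e ≤ μ x * p x * p x + ψ x * -(E * ε x * ψ x)) →
      0 < ψ 1 * p 1 := by
    rintro ψ p h h0 ⟨e, he, hle⟩
    have h1 := (h.left.mul h.right).integral_eq 0 1
    have h2 := intervalIntegral.integral_mono_on (a := 0) (b := 1) zero_le_one
      (intervalIntegrable_const (c := e)) ((h.left.mul h.right).tame.intervalIntegrable 0 1) hle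
    simp only [intervalIntegral.integral_const, smul_eq_mul, sub_zero, one_mul] at h2
    linarith
  have su : 0 < colU₁ μ ε E 1 * colU₂ μ ε E 1 := by
    refine strict hf.u (by simp [hf.u₂_zero]) ⟨-E * d, by nlinarith, fun x hx => ?_⟩
    have h1 := mul_nonneg (hc.le.trans (hcμ x)) (mul_self_nonneg (colU₂ μ ε E x))
    have h2 : -E * d ≤ -E * ε x * colU₁ μ ε E x ^ 2 := by
      calc -E * d = -E * d * 1 := by ring
        _ ≤ -E * ε x * colU₁ μ ε E x ^ 2 := by
          have := neg_nonneg.2 hE.le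
          have := hd.le.trans (hdε x)
          gcongr
          · exact hdε x
          · exact u_ge x hx
    nlinarith
  have sv : 0 < colV₁ μ ε E 1 * colV₂ μ ε E 1 := by
    refine strict hf.v (by simp [hf.v₁_zero]) ⟨c, hc, fun x hx => ?_⟩
    have h1 : c ≤ μ x * colV₂ μ ε E x ^ 2 := by
      calc c = c * 1 := by ring
        _ ≤ μ x * colV₂ μ ε E x ^ 2 := by
          have := hc.le.trans (hcμ x)
          gcongr
          · exact hcμ x
          · exact v_ge x hx
    have h2 := mul_nonneg (mul_nonneg (neg_nonneg.2 hE.le) (hd.le.trans (hdε x)))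
      (mul_self_nonneg (colV₁ μ ε E x))
    nlinarith
  -- All entries are now positive, so determinant one gives `u₁ v₂ = 1 + u₂ v₁ > 1`, and `(u₁ + v₂)²
  -- ≥ 4 u₁ v₂ > 4`.
  have h1 := (pos_iff_pos_of_mul_pos su).1 hu
  have h2 := (pos_iff_pos_of_mul_pos sv).2 hv
  have h3 := hf.det 1
  have h4 := mul_pos h1 h2
  unfold disc
  nlinarith [sq_nonneg (colU₁ μ ε E 1 - colV₂ μ ε E 1)]

section Zero

lemma colV₂_zero_energy (hμ : IsProfile μ) (hε : IsProfile ε) (x : ℝ) : colV₂ μ ε 0 x = 1 := by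
  have hf := isFundamental_col 0 hμ hε
  rw [hf.v.right.eq_of_zero (fun t => by ring) x 0, hf.v₂_zero]

lemma disc_zero_energy (hμ : IsProfile μ) (hε : IsProfile ε) : disc μ ε 0 = 2 := by
  have hf := isFundamental_col 0 hμ hε
  have h2 : ∀ x, colU₂ μ ε 0 x = 0 := fun x => by
    rw [hf.u.right.eq_of_zero (fun t => by ring) x 0, hf.u₂_zero]
  have h1 : colU₁ μ ε 0 1 = 1 := by
    rw [hf.u.left.eq_of_zero (fun t => by rw [h2]; ring) 1 0, hf.u₁_zero]
  rw [disc, h1, colV₂_zero_energy hμ hε]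
  norm_num

lemma colV₁_zero_energy_pos (hμ : IsCoefficient μ) (hε : IsProfile ε) : 0 < colV₁ μ ε 0 1 := by
  have hf := isFundamental_col 0 hμ.toIsProfile hε
  have h1 := hf.v.left.integral_eq 0 1
  simp only [colV₂_zero_energy hμ.toIsProfile hε, mul_one, hf.v₁_zero, sub_zero] at h1
  rw [← h1]
  exact hμ.integral_pos

/-- At zero energy `v₂ = 1`, so the angle and `arctan v₁` have the same derivative `μ / (1 + v₁²)`.
The resulting bound by `π / 2` puts all Dirichlet energies above zero. -/
lemma rotation_zero_energy (hμ : IsProfile μ) (hε : IsProfile ε) :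
    rotation μ ε 0 = Real.arctan (colV₁ μ ε 0 1) := by
  have hf := isFundamental_col 0 hμ hε
  have h1 := hf.v.isPrim_angle hμ.isTame (hε.isTame.const_mul 0) hf.v_ne_zero
  have h2 := hf.v.left.comp (φ := Real.arctan) (φ' := fun y => 1 / (1 + y ^ 2))
    (fun x => Real.hasDerivAt_arctan _)
    (by have := hf.v.left.continuous
        refine continuous_const.div (by fun_prop) fun x => by positivity)
  have := (h1.sub h2).eq_of_zero (fun t => by
    rw [colV₂_zero_energy hμ hε]
    have : 1 + colV₁ μ ε 0 t ^ 2 ≠ 0 := by positivity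
    field_simp
    ring) 1 0
  simp only [hf.v₁_zero, Real.arctan_zero, angle, intervalIntegral.integral_same, sub_zero] at this
  simp only [rotation, angle]
  linarith

/-- Lower bound for the angle on the first interval, which has no Dirichlet energy at its left end.
-/
lemma rotation_pos (hμ : IsCoefficient μ) (hε : IsCoefficient ε) {E : ℝ} (hE : 0 ≤ E) :
    0 < rotation μ ε E := by
  rcases hE.eq_or_lt with rfl | hE
  · rw [rotation_zero_energy hμ.toIsProfile hε.toIsProfile, Real.arctan_pos]
    exact colV₁_zero_energy_pos hμ hε.toIsProfile
  · have hf := isFundamental_col E hμ.toIsProfile hε.toIsProfile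
    obtain ⟨c, hc, hcμ⟩ := hμ.pos
    obtain ⟨d, hd, hdε⟩ := hε.pos
    refine intervalIntegral.intervalIntegral_pos_of_pos ((hf.v.isTame_angle hμ.isTame
      (hε.isTame.const_mul E) hf.v_ne_zero).intervalIntegrable _ _) (fun t => ?_) one_pos
    have h1 : 0 < colV₁ μ ε E t ^ 2 + colV₂ μ ε E t ^ 2 :=
      lt_of_le_of_ne (by positivity) (hf.v_ne_zero t).symm
    have h2 := hc.trans_le (hcμ t)
    have h3 := hd.trans_le (hdε t)
    rw [← mul_div_assoc, ← mul_div_assoc, ← add_div]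
    refine div_pos ?_ h1
    have h4 : 0 < E * ε t := mul_pos hE h3
    rcases (sq_nonneg (colV₁ μ ε E t)).eq_or_lt with h | h
    · rw [← h] at h1 ⊢
      rw [zero_add] at h1
      have := mul_pos h2 h1
      linarith
    · have := mul_pos h4 h
      have := mul_nonneg h2.le (sq_nonneg (colV₂ μ ε E t))
      linarith

end Zero

lemma sin_eq_neg_one_pow_mul (m : ℕ) (x : ℝ) :
    Real.sin x = (-1) ^ m * Real.sin (x - m * Real.pi) := by
  rw [Real.sin_sub_nat_mul_pi, ← mul_assoc, ← mul_pow]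
  norm_num

/-- The rotation crosses the multiples of `π` upwards. -/
lemma rotation_upcrossing (hμ : IsCoefficient μ) (hε : IsCoefficient ε) (m : ℕ) {E : ℝ}
    (hE : rotation μ ε E - m * Real.pi = 0) :
    (∀ᶠ w in 𝓝[<] E, rotation μ ε w - m * Real.pi < 0) ∧
      ∀ᶠ w in 𝓝[>] E, 0 < rotation μ ε w - m * Real.pi := by
  have hf := isFundamental_col E hμ.toIsProfile hε.toIsProfile
  obtain ⟨r, hr, h1, h2⟩ := exists_polar hμ.toIsProfile hε.toIsProfile E
  have hR : rotation μ ε E = m * Real.pi := by linarith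
  rw [hR] at h1 h2
  rw [Real.sin_nat_mul_pi, mul_zero] at h1
  rw [Real.cos_nat_mul_pi] at h2
  have hd := hf.det 1
  rw [h1, h2, mul_zero, sub_zero] at hd
  have hder := (hasDerivAt_colV₁ E hμ.toIsProfile hε.toIsProfile).const_mul ((-1 : ℝ) ^ m)
  rw [h1, mul_zero, sub_zero] at hder
  -- Here `v₁ = 0`, so its derivative in `E` is `weightVV * u₁`; by `u₁ v₂ = 1` the sign of `u₁` is
  -- that of `v₂`, namely `(-1) ^ m`.
  have hpos : 0 < (-1) ^ m * (weightVV μ ε E * colU₁ μ ε E 1) := by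
    have : 0 < r * ((-1) ^ m * (weightVV μ ε E * colU₁ μ ε E 1)) := by
      calc (0 : ℝ) < weightVV μ ε E := weightVV_pos hμ hε E
        _ = weightVV μ ε E * (colU₁ μ ε E 1 * (r * (-1) ^ m)) := by rw [hd, mul_one]
        _ = _ := by ring
    exact (pos_iff_pos_of_mul_pos this).1 hr
  have hev := eventually_of_hasDerivAt_pos hder hpos (by rw [h1, mul_zero])
  have hcont : Continuous fun w => rotation μ ε w - m * Real.pi :=
    (continuous_rotation_right hμ.toIsProfile hε.toIsProfile).sub continuous_const
  -- While the angle is within `π` of `m π`, the sign of the sine is the sign of the deviation, so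
  -- the crossing of `v₁` carries over to the angle.
  have hn1 : ∀ᶠ w in 𝓝 E, rotation μ ε w - m * Real.pi < Real.pi :=
    hcont.continuousAt.eventually_lt continuousAt_const (by rw [hE]; exact Real.pi_pos)
  have hn2 : ∀ᶠ w in 𝓝 E, -Real.pi < rotation μ ε w - m * Real.pi :=
    continuousAt_const.eventually_lt hcont.continuousAt (by rw [hE]; linarith [Real.pi_pos])
  have hval : ∀ w, ∃ r : ℝ, 0 < r ∧ (-1) ^ m * colV₁ μ ε w 1 =
      r * Real.sin (rotation μ ε w - m * Real.pi) := fun w => by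
    obtain ⟨r, hr, h, -⟩ := exists_polar hμ.toIsProfile hε.toIsProfile w
    refine ⟨r, hr, ?_⟩
    rw [h, sin_eq_neg_one_pow_mul m (rotation μ ε w)]
    have : (-1 : ℝ) ^ m * (-1) ^ m = 1 := by rw [← mul_pow]; norm_num
    linear_combination (r * Real.sin (rotation μ ε w - m * Real.pi)) * this
  constructor
  · filter_upwards [hev.1, nhdsWithin_le_nhds hn1] with w hw h
    obtain ⟨r, hr, e⟩ := hval w
    rw [e] at hw
    by_contra hcon
    exact absurd (mul_nonneg hr.le (Real.sin_nonneg_of_nonneg_of_le_pi (not_lt.1 hcon) h.le))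
      (not_le.2 hw)
  · filter_upwards [hev.2, nhdsWithin_le_nhds hn2] with w hw h
    obtain ⟨r, hr, e⟩ := hval w
    rw [e] at hw
    by_contra hcon
    exact absurd (mul_nonpos_of_nonneg_of_nonpos hr.le
      (Real.sin_nonpos_of_nonpos_of_neg_pi_le (not_lt.1 hcon) h.le)) (not_le.2 hw)

/-- The Dirichlet energies, preceded by `0`. -/
lemma exists_dirichlet (hμ : IsCoefficient μ) (hε : IsCoefficient ε) : ∃ a : ℕ → ℝ, a 0 = 0 ∧
    StrictMono a ∧ (∀ m, rotation μ ε (a (m + 1)) = (m + 1 : ℕ) * Real.pi) ∧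
    (∀ m E, a (m + 1) < E → (m + 1 : ℕ) * Real.pi < rotation μ ε E) ∧
    (∀ m E, E < a (m + 1) → rotation μ ε E < (m + 1 : ℕ) * Real.pi) := by
  have hc := continuous_rotation_right hμ.toIsProfile hε.toIsProfile
  have h0 : rotation μ ε 0 < Real.pi / 2 := by
    rw [rotation_zero_energy hμ.toIsProfile hε.toIsProfile]
    exact Real.arctan_lt_pi_div_two _
  have hex : ∀ m : ℕ, ∃ E, 0 < E ∧ rotation μ ε E = (m + 1 : ℕ) * Real.pi := fun m => by
    have hm : Real.pi / 2 < (m + 1 : ℕ) * Real.pi := by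
      have := Real.pi_pos
      push_cast
      nlinarith [Nat.cast_nonneg (α := ℝ) m]
    obtain ⟨B, hB0, hB⟩ := ((tendsto_rotation hμ hε).eventually_ge_atTop ((m + 1 : ℕ) * Real.pi)
      |>.and (eventually_ge_atTop 0)).exists
    obtain ⟨E, hE, he⟩ := intermediate_value_Icc hB hc.continuousOn
      (show (m + 1 : ℕ) * Real.pi ∈ Icc (rotation μ ε 0) (rotation μ ε B) from
        ⟨(h0.trans hm).le, hB0⟩)
    refine ⟨E, lt_of_le_of_ne hE.1 fun h => ?_, he⟩
    rw [← h] at he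
    linarith
  choose b hb0 hb using hex
  -- Since all crossings are upward, a level once attained is never attained again.
  have hup : ∀ m E, b m < E → (m + 1 : ℕ) * Real.pi < rotation μ ε E := fun m E hE => by
    have := pos_right_of_upcrossing (f := fun w => rotation μ ε w - (m + 1 : ℕ) * Real.pi) hE
      (hc.sub continuous_const).continuousOn (fun z _ hz => rotation_upcrossing hμ hε (m + 1) hz)
      (sub_eq_zero.2 (hb m))
    linarith
  have hdown : ∀ m E, E < b m → rotation μ ε E < (m + 1 : ℕ) * Real.pi := fun m E hE => by
    have := neg_left_of_upcrossing (f := fun w => rotation μ ε w - (m + 1 : ℕ) * Real.pi) hE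
      (hc.sub continuous_const).continuousOn (fun z _ hz => rotation_upcrossing hμ hε (m + 1) hz)
      (sub_eq_zero.2 (hb m))
    linarith
  obtain ⟨a, ha0, ha⟩ : ∃ a : ℕ → ℝ, a 0 = 0 ∧ ∀ m, a (m + 1) = b m :=
    ⟨fun n => Nat.casesOn n 0 b, rfl, fun _ => rfl⟩
  refine ⟨a, ha0, strictMono_nat_of_lt_succ fun n => ?_, fun m => by rw [ha, hb],
    fun m E h => hup m E (by rwa [ha] at h), fun m E h => hdown m E (by rwa [ha] at h)⟩
  cases n with
  | zero => rw [ha0, ha]; exact hb0 0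
  | succ n =>
    rw [ha, ha]
    by_contra hcon
    have h1 := hb (n + 1)
    have h2 : rotation μ ε (b (n + 1)) ≤ (n + 1 : ℕ) * Real.pi := by
      rcases (not_lt.1 hcon).eq_or_lt with h | h
      · rw [h, hb n]
      · exact (hdown n _ h).le
    rw [h1] at h2
    push_cast at h2
    linarith [Real.pi_pos]

end Photonic

/-! ### Level sets of the discriminant between Dirichlet energies. -/

namespace Photonic

variable {μ ε : ℝ → ℝ}

lemma hasDerivAt_disc (hμ : IsProfile μ) (hε : IsProfile ε) (E : ℝ) :
    HasDerivAt (disc μ ε) (weightUV μ ε E * colU₁ μ ε E 1 - weightUU μ ε E * colV₁ μ ε E 1 +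
      (weightVV μ ε E * colU₂ μ ε E 1 - weightUV μ ε E * colV₂ μ ε E 1)) E :=
  (hasDerivAt_colU₁ E hμ hε).add (hasDerivAt_colV₂ E hμ hε)

lemma continuous_disc (hμ : IsProfile μ) (hε : IsProfile ε) : Continuous (disc μ ε) :=
  continuous_iff_continuousAt.2 fun E => (hasDerivAt_disc hμ hε E).continuousAt

lemma disc_sq_sub_four (hμ : IsProfile μ) (hε : IsProfile ε) (E : ℝ) :
    disc μ ε E ^ 2 - 4 = (colU₁ μ ε E 1 - colV₂ μ ε E 1) ^ 2 + 4 * colV₁ μ ε E 1 * colU₂ μ ε E 1 := by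
  have := (isFundamental_col E hμ hε).det 1
  unfold disc
  linear_combination 4 * this

/-- Inside the bands the discriminant moves against the sign of the Dirichlet solution. -/
lemma colV₁_mul_deriv_neg (hμ : IsCoefficient μ) (hε : IsCoefficient ε) {E : ℝ}
    (hD : disc μ ε E ^ 2 ≤ 4) (hv : colV₁ μ ε E 1 ≠ 0) :
    colV₁ μ ε E 1 * (weightUV μ ε E * colU₁ μ ε E 1 - weightUU μ ε E * colV₁ μ ε E 1 +
      (weightVV μ ε E * colU₂ μ ε E 1 - weightUV μ ε E * colV₂ μ ε E 1)) < 0 := by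
  have h1 := disc_sq_sub_four hμ.toIsProfile hε.toIsProfile E
  have h2 := weightVV_pos hμ hε E
  -- Completing the square: minus the product in the goal is the form at this vector minus `weightVV
  -- * (disc² - 4) / 4`.
  have h3 := weight_pos hμ hε E (x := colV₁ μ ε E 1) (y := (colV₂ μ ε E 1 - colU₁ μ ε E 1) / 2)
    (Or.inl hv)
  have h4 : 0 ≤ weightVV μ ε E * (-((colU₁ μ ε E 1 - colV₂ μ ε E 1) ^ 2
      + 4 * colV₁ μ ε E 1 * colU₂ μ ε E 1)) := mul_nonneg h2.le (by linarith)
  nlinarith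

/-- At a point where the monodromy matrix is `± 1` the discriminant has a strict local extremum. -/
lemma eventually_disc_sq_lt (hμ : IsCoefficient μ) (hε : IsCoefficient ε) {E : ℝ}
    (hu : colU₂ μ ε E 1 = 0) (hv : colV₁ μ ε E 1 = 0) (huv : colU₁ μ ε E 1 = colV₂ μ ε E 1) :
    ∀ᶠ w in 𝓝[≠] E, disc μ ε w ^ 2 < 4 := by
  have hdet := (isFundamental_col E hμ.toIsProfile hε.toIsProfile).det 1
  rw [hu, huv, zero_mul, sub_zero] at hdet
  have d1 := (hasDerivAt_colU₁ E hμ.toIsProfile hε.toIsProfile).sub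
    (hasDerivAt_colV₂ E hμ.toIsProfile hε.toIsProfile)
  have d2 := hasDerivAt_colV₁ E hμ.toIsProfile hε.toIsProfile
  have d3 := hasDerivAt_colU₂ E hμ.toIsProfile hε.toIsProfile
  simp only [hu, hv, huv, mul_zero, sub_zero, zero_sub] at d1 d2 d3
  have t1 := hasDerivAt_iff_tendsto_slope.1 d1
  have t2 := hasDerivAt_iff_tendsto_slope.1 d2
  have t3 := hasDerivAt_iff_tendsto_slope.1 d3
  -- By `disc_sq_sub_four` this is the limit of `(disc² - 4) / (w - E)²`: all three entries involved
  -- vanish at `E`, and the limit is a negative multiple of the determinant of the weights.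
  have t := (t1.pow 2).add ((t2.mul t3).const_mul 4)
  have hneg : (weightUV μ ε E * colV₂ μ ε E 1 - -(weightUV μ ε E * colV₂ μ ε E 1)) ^ 2 +
      4 * (weightVV μ ε E * colV₂ μ ε E 1 * -(weightUU μ ε E * colV₂ μ ε E 1)) < 0 := by
    have := weight_det_pos hμ hε E
    calc _ = 4 * (weightUV μ ε E ^ 2 - weightUU μ ε E * weightVV μ ε E)
          * (colV₂ μ ε E 1 * colV₂ μ ε E 1) := by ring
      _ < 0 := by rw [hdet]; linarith
  filter_upwards [t.eventually (gt_mem_nhds hneg), self_mem_nhdsWithin] with w hw hne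
  have hne' : w - E ≠ 0 := sub_ne_zero.2 hne
  simp only [slope_def_field, hu, hv, sub_zero, Pi.sub_apply, huv, sub_self] at hw
  have h1 := disc_sq_sub_four hμ.toIsProfile hε.toIsProfile w
  have h2 : disc μ ε w ^ 2 - 4 = (w - E) ^ 2 *
      (((colU₁ μ ε w 1 - colV₂ μ ε w 1) / (w - E)) ^ 2
        + 4 * (colV₁ μ ε w 1 / (w - E) * (colU₂ μ ε w 1 / (w - E)))) := by
    rw [h1]; field_simp
  have h3 : 0 < (w - E) ^ 2 := by positivity
  have := mul_neg_of_pos_of_neg h3 hw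
  linarith

/-- Interior crossings of the level `c` are all downward, so there is at most one. Without an
interior crossing the sign of `h - c` on the open interval is constant and selects one of the
endpoints. -/
lemma exists_slot {h : ℝ → ℝ} {a b c : ℝ} (hab : a < b) (hc : Continuous h) (hca : c ≤ h a)
    (hcb : h b ≤ c) (hcross : ∀ z ∈ Ioo a b, h z = c →
      ∃ d < 0, HasDerivAt h d z) :
    ∃ e ∈ Icc a b, h e = c ∧ (∀ x ∈ Ioo a e, c < h x) ∧ ∀ x ∈ Ioo e b, h x < c := by
  have hup : ∀ z ∈ Ioo a b, c - h z = 0 →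
      (∀ᶠ w in 𝓝[<] z, c - h w < 0) ∧ ∀ᶠ w in 𝓝[>] z, 0 < c - h w := fun z hz h0 => by
    obtain ⟨d, hd, hder⟩ := hcross z hz (by linarith)
    exact eventually_of_hasDerivAt_pos (f := fun w => c - h w) (hder.const_sub c) (by linarith) h0
  have hcont : Continuous fun w => c - h w := continuous_const.sub hc
  by_cases hex : ∃ z ∈ Ioo a b, h z = c
  · obtain ⟨z, hz, h0⟩ := hex
    refine ⟨z, Ioo_subset_Icc_self hz, h0, fun x hx => ?_, fun x hx => ?_⟩
    · have := neg_left_of_upcrossing (f := fun w => c - h w) hx.2 hcont.continuousOn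
        (fun w hw => hup w ⟨hx.1.trans_le hw.1, hw.2.trans_lt hz.2⟩) (by rw [h0, sub_self])
      linarith
    · have := pos_right_of_upcrossing (f := fun w => c - h w) hx.1 hcont.continuousOn
        (fun w hw => hup w ⟨hz.1.trans_le hw.1, hw.2.trans_lt hx.2⟩) (by rw [h0, sub_self])
      linarith
  · push Not at hex
    rcases hca.eq_or_lt with h1 | h1
    · rcases hcb.eq_or_lt with h2 | h2
      -- Both endpoints are at the level `c`: if the graph is below it inside, the slot is `a`,
      -- otherwise `b`.
      · by_cases hs : ∃ z ∈ Ioo a b, h z < c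
        · obtain ⟨z, hz, hz'⟩ := hs
          refine ⟨a, left_mem_Icc.2 hab.le, h1.symm, by simp, fun x hx => ?_⟩
          by_contra hcon
          have hz2 : c < h x := lt_of_le_of_ne (not_lt.1 hcon) (hex x hx).symm
          obtain ⟨y, hy, hy0⟩ := isPreconnected_Ioo.intermediate_value hz hx hc.continuousOn
            (⟨hz'.le, hz2.le⟩ : c ∈ Icc (h z) (h x))
          exact hex y hy hy0
        · push Not at hs
          exact ⟨b, right_mem_Icc.2 hab.le, h2, fun x hx => lt_of_le_of_ne (hs x hx) (hex x hx).symm,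
            by simp⟩
      · refine ⟨a, left_mem_Icc.2 hab.le, h1.symm, by simp, fun x hx => ?_⟩
        by_contra hcon
        obtain ⟨y, hy, hy0⟩ := intermediate_value_Icc' hx.2.le hc.continuousOn
          (⟨h2.le, not_lt.1 hcon⟩ : c ∈ Icc (h b) (h x))
        rcases hy.2.eq_or_lt with rfl | hlt
        · exact h2.ne hy0
        · exact hex y ⟨hx.1.trans_le hy.1, hlt⟩ hy0
    · have hnon : ∀ x ∈ Ioo a b, c < h x := fun x hx => by
        by_contra hcon
        obtain ⟨y, hy, hy0⟩ := intermediate_value_Icc' hx.1.le hc.continuousOn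
          (⟨not_lt.1 hcon, h1.le⟩ : c ∈ Icc (h x) (h a))
        rcases hy.1.eq_or_lt with rfl | hlt
        · exact h1.ne' hy0
        · exact hex y ⟨hlt, hy.2.trans_lt hx.2⟩ hy0
      refine ⟨b, right_mem_Icc.2 hab.le, le_antisymm hcb ?_, hnon, by simp⟩
      have : Tendsto h (𝓝[<] b) (𝓝 (h b)) := hc.continuousAt.mono_left nhdsWithin_le_nhds
      refine ge_of_tendsto this ?_
      filter_upwards [Ioo_mem_nhdsLT hab] with x hx
      exact (hnon x hx).le

open Classical in
/-- Multiplicity of the level `c` of the discriminant. -/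
noncomputable def levelMult (μ ε : ℝ → ℝ) (c E : ℝ) : ℕ :=
  if disc μ ε E = c then (if colV₁ μ ε E 1 = 0 ∧ colU₂ μ ε E 1 = 0 then 2 else 1) else 0

/-- `a 0 = 0` and `a 1 < a 2 < ⋯` are the Dirichlet energies. -/
structure IsDirichletSeq (μ ε : ℝ → ℝ) (a : ℕ → ℝ) : Prop where
  zero : a 0 = 0
  strictMono : StrictMono a
  rotation_eq : ∀ m, rotation μ ε (a (m + 1)) = (m + 1 : ℕ) * Real.pi
  lt_rotation : ∀ m E, a (m + 1) < E → (m + 1 : ℕ) * Real.pi < rotation μ ε E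
  rotation_lt : ∀ m E, E < a (m + 1) → rotation μ ε E < (m + 1 : ℕ) * Real.pi

lemma neg_one_pow_mul_self (m : ℕ) : (-1 : ℝ) ^ m * (-1) ^ m = 1 := by
  rw [← mul_pow]; norm_num

namespace IsDirichletSeq

variable {a : ℕ → ℝ}

lemma colV₁_pos (ha : IsDirichletSeq μ ε a) (hμ : IsCoefficient μ) (hε : IsCoefficient ε) (m : ℕ)
    {E : ℝ} (h : E ∈ Ioo (a m) (a (m + 1))) : 0 < (-1) ^ m * colV₁ μ ε E 1 := by
  obtain ⟨r, hr, h1, -⟩ := exists_polar hμ.toIsProfile hε.toIsProfile E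
  have hlow : m * Real.pi < rotation μ ε E := by
    cases m with
    | zero =>
      have := h.1
      rw [ha.zero] at this
      simpa using rotation_pos hμ hε this.le
    | succ m => exact ha.lt_rotation m E h.1
  have hup := ha.rotation_lt m E h.2
  have hs : 0 < Real.sin (rotation μ ε E - m * Real.pi) :=
    Real.sin_pos_of_pos_of_lt_pi (by linarith) (by push_cast at hup; linarith)
  rw [h1, sin_eq_neg_one_pow_mul m]
  calc 0 < r * Real.sin (rotation μ ε E - m * Real.pi) := mul_pos hr hs
    _ = ((-1 : ℝ) ^ m * (-1) ^ m) * (r * Real.sin (rotation μ ε E - m * Real.pi)) := by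
      rw [neg_one_pow_mul_self, one_mul]
    _ = _ := by ring

lemma colV₁_eq (ha : IsDirichletSeq μ ε a) (hμ : IsCoefficient μ) (hε : IsCoefficient ε) (m : ℕ) :
    colV₁ μ ε (a (m + 1)) 1 = 0 ∧ 0 < (-1) ^ (m + 1) * colV₂ μ ε (a (m + 1)) 1 := by
  obtain ⟨r, hr, h1, h2⟩ := exists_polar hμ.toIsProfile hε.toIsProfile (a (m + 1))
  rw [ha.rotation_eq] at h1 h2
  rw [Real.sin_nat_mul_pi, mul_zero] at h1
  rw [Real.cos_nat_mul_pi] at h2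
  refine ⟨h1, ?_⟩
  rw [h2, mul_comm r, ← mul_assoc, neg_one_pow_mul_self, one_mul]
  exact hr

/-- At a Dirichlet energy `v₁ = 0` leaves `u₁ v₂ = 1`, so the signed trace is a positive number plus
its inverse. The sequence may start with `0` because the discriminant there is exactly `2`. -/
lemma two_le (ha : IsDirichletSeq μ ε a) (hμ : IsCoefficient μ) (hε : IsCoefficient ε) (m : ℕ) :
    2 ≤ (-1) ^ m * disc μ ε (a m) := by
  cases m with
  | zero => rw [ha.zero, disc_zero_energy hμ.toIsProfile hε.toIsProfile]; norm_num
  | succ m =>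
    obtain ⟨h1, h2⟩ := ha.colV₁_eq hμ hε m
    have hd := (isFundamental_col (a (m + 1)) hμ.toIsProfile hε.toIsProfile).det 1
    rw [h1, mul_zero, sub_zero] at hd
    have hs := neg_one_pow_mul_self (m + 1)
    set s : ℝ := (-1) ^ (m + 1)
    unfold disc
    set x := s * colV₂ μ ε (a (m + 1)) 1
    set y := s * colU₁ μ ε (a (m + 1)) 1
    have hxy : y * x = 1 := by
      calc y * x = (s * s) * (colU₁ μ ε (a (m + 1)) 1 * colV₂ μ ε (a (m + 1)) 1) := by
            simp only [x, y]; ring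
        _ = 1 := by rw [hs, hd, one_mul]
    have hy : 0 < y := (pos_iff_pos_of_mul_pos (by rw [hxy]; exact one_pos)).2 h2
    have : s * (colU₁ μ ε (a (m + 1)) 1 + colV₂ μ ε (a (m + 1)) 1) = y + x := by
      simp only [x, y]; ring
    rw [this]
    nlinarith [sq_nonneg (x - y)]

/-- The angle at `E` is finite, whereas an energy above every Dirichlet energy would have an angle
above every multiple of `π`. -/
lemma exists_nat (ha : IsDirichletSeq μ ε a) {E : ℝ} (hE : 0 ≤ E) :
    ∃ m, a m ≤ E ∧ E < a (m + 1) := by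
  have hex : ∃ n, E < a n := by
    by_contra hcon
    push Not at hcon
    obtain ⟨n, hn⟩ := exists_nat_gt (rotation μ ε E / Real.pi)
    rw [div_lt_iff₀ Real.pi_pos] at hn
    have h1 : a (n + 1) < E := (ha.strictMono (Nat.lt_succ_self (n + 1))).trans_le (hcon (n + 2))
    have h2 := ha.lt_rotation n E h1
    push_cast at h2
    nlinarith [Real.pi_pos]
  classical
  obtain ⟨m, hm⟩ : ∃ m, Nat.find hex = m + 1 := by
    refine Nat.exists_eq_succ_of_ne_zero fun h => ?_
    have := Nat.find_spec hex
    rw [h, ha.zero] at this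
    exact absurd hE (not_le.2 this)
  refine ⟨m, not_lt.1 (Nat.find_min hex (by omega)), ?_⟩
  rw [← hm]
  exact Nat.find_spec hex

/-- The energies at the level `c` of the discriminant, counted with multiplicity, interlace with
the Dirichlet energies. -/
lemma exists_slots (ha : IsDirichletSeq μ ε a) (hμ : IsCoefficient μ) (hε : IsCoefficient ε) {c : ℝ}
    (hc : |c| ≤ 2) : ∃ e : ℕ → ℝ, ∀ m, e m ∈ Icc (a m) (a (m + 1)) ∧ disc μ ε (e m) = c ∧
      (∀ x ∈ Ioo (a m) (e m), (-1) ^ m * c < (-1) ^ m * disc μ ε x) ∧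
      ∀ x ∈ Ioo (e m) (a (m + 1)), (-1) ^ m * disc μ ε x < (-1) ^ m * c := by
  have habs : ∀ m : ℕ, |(-1) ^ m * c| ≤ 2 := fun m => by
    rw [abs_mul, abs_pow, abs_neg, abs_one, one_pow, one_mul]; exact hc
  have key : ∀ m, ∃ e ∈ Icc (a m) (a (m + 1)), (-1) ^ m * disc μ ε e = (-1) ^ m * c ∧
      (∀ x ∈ Ioo (a m) e, (-1) ^ m * c < (-1) ^ m * disc μ ε x) ∧
      ∀ x ∈ Ioo e (a (m + 1)), (-1) ^ m * disc μ ε x < (-1) ^ m * c := fun m => by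
    have h1 := abs_le.1 (habs m)
    refine exists_slot (h := fun x => (-1) ^ m * disc μ ε x) (ha.strictMono (Nat.lt_succ_self m))
      (continuous_const.mul (continuous_disc hμ.toIsProfile hε.toIsProfile))
      (h1.2.trans (ha.two_le hμ hε m)) ?_ fun z hz h0 => ?_
    · have := ha.two_le hμ hε (m + 1)
      rw [pow_succ] at this
      linarith
    · refine ⟨_, ?_, (hasDerivAt_disc hμ.toIsProfile hε.toIsProfile z).const_mul _⟩
      have hv := ha.colV₁_pos hμ hε m hz
      have hs := neg_one_pow_mul_self m
      have hD : disc μ ε z ^ 2 ≤ 4 := by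
        have : disc μ ε z = c := by
          have hs0 : (-1 : ℝ) ^ m ≠ 0 := by positivity
          exact mul_left_cancel₀ hs0 h0
        rw [this]
        nlinarith [abs_le.1 hc]
      -- `v₁` has sign `(-1) ^ m` on this interval, so the signed discriminant decreases at the
      -- level.
      have := colV₁_mul_deriv_neg hμ hε hD (fun h => by rw [h, mul_zero] at hv; exact lt_irrefl _ hv)
      by_contra hcon
      rw [not_lt] at hcon
      have h2 := mul_nonneg hv.le hcon
      nlinarith
  choose e he1 he2 he3 he4 using key
  refine ⟨e, fun m => ⟨he1 m, ?_, he3 m, he4 m⟩⟩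
  have hs0 : (-1 : ℝ) ^ m ≠ 0 := by positivity
  exact mul_left_cancel₀ hs0 (he2 m)

end IsDirichletSeq

end Photonic

/-! ### From slots to the numbered bands. -/

namespace Photonic

variable {μ ε : ℝ → ℝ} {a : ℕ → ℝ}

namespace IsDirichletSeq

/-- Strictly between Dirichlet energies only the slot of that interval can hit `E`. At a Dirichlet
energy the two adjacent slots compete, and the behaviour of the discriminant on each side of `E`
decides which of them hit it: both exactly when the monodromy matrix is scalar. -/
lemma ncard_slots (ha : IsDirichletSeq μ ε a) (hμ : IsCoefficient μ) (hε : IsCoefficient ε) {c : ℝ}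
    (hc : |c| ≤ 2) {e : ℕ → ℝ} (he : ∀ m, e m ∈ Icc (a m) (a (m + 1)) ∧ disc μ ε (e m) = c ∧
      (∀ x ∈ Ioo (a m) (e m), (-1) ^ m * c < (-1) ^ m * disc μ ε x) ∧
      ∀ x ∈ Ioo (e m) (a (m + 1)), (-1) ^ m * disc μ ε x < (-1) ^ m * c) (E : ℝ) :
    {m | e m = E}.Finite ∧ {m | e m = E}.ncard = levelMult μ ε c E := by
  have hpμ := hμ.toIsProfile
  have hpε := hε.toIsProfile
  have hc2 : c ^ 2 ≤ 4 := by nlinarith [abs_le.1 hc]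
  have hempty : disc μ ε E ≠ c → {m | e m = E}.Finite ∧ {m | e m = E}.ncard = levelMult μ ε c E := by
    intro h
    have h1 : {m | e m = E} = ∅ := by
      ext m
      simp only [mem_ofPred_eq, mem_empty_iff_false, iff_false]
      intro h'
      exact h (by rw [← h', (he m).2.1])
    rw [h1, levelMult, if_neg h]
    simp
  by_cases hDc : disc μ ε E = c
  swap
  · exact hempty hDc
  have hE0 : 0 ≤ E := by
    by_contra hcon
    have := four_lt_disc_sq_of_neg hμ hε (not_le.1 hcon)
    rw [hDc] at this
    linarith
  obtain ⟨m, hm1, hm2⟩ := ha.exists_nat hE0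
  have hlt : ∀ n, n + 1 < m → e n ≠ E := fun n hn h => by
    have h1 := (he n).1.2
    have h2 := ha.strictMono hn
    rw [h] at h1
    linarith
  have hgt : ∀ n, m < n → e n ≠ E := fun n hn h => by
    have h1 := (he n).1.1
    have h2 := ha.strictMono.monotone (Nat.succ_le_of_lt hn)
    rw [h] at h1
    exact absurd (h2.trans h1) (not_le.2 hm2)
  have single : ∀ k, e k = E → (∀ n, n + 1 = m ∨ n = m → n ≠ k → e n ≠ E) →
      ¬(colV₁ μ ε E 1 = 0 ∧ colU₂ μ ε E 1 = 0) →
      {m | e m = E}.Finite ∧ {m | e m = E}.ncard = levelMult μ ε c E := by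
    intro k hk hn hv
    have h1 : {m | e m = E} = {k} := by
      ext n
      simp only [mem_ofPred_eq, mem_singleton_iff]
      refine ⟨fun h => ?_, fun h => h ▸ hk⟩
      by_contra hne
      rcases lt_trichotomy (n + 1) m with h2 | h2 | h2
      · exact hlt n h2 h
      · exact hn n (Or.inl h2) hne h
      · rcases (Nat.lt_succ_iff.1 h2).eq_or_lt with h3 | h3
        · exact hn n (Or.inr h3.symm) hne h
        · exact hgt n h3 h
    rw [h1, levelMult, if_pos hDc, if_neg hv]
    simp
  rcases hm1.lt_or_eq with hlt1 | heq
  · have hv := ha.colV₁_pos hμ hε m ⟨hlt1, hm2⟩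
    refine single m ?_ (fun n hn hne h => ?_) (fun h => by rw [h.1, mul_zero] at hv; exact lt_irrefl _ hv)
    · rcases lt_trichotomy (e m) E with h | h | h
      · have := (he m).2.2.2 E ⟨h, hm2⟩
        rw [hDc] at this
        exact absurd this (lt_irrefl _)
      · exact h
      · have := (he m).2.2.1 E ⟨hlt1, h⟩
        rw [hDc] at this
        exact absurd this (lt_irrefl _)
    · rcases hn with hn | hn
      · have h1 := (he n).1.2
        rw [h, hn] at h1
        linarith
      · exact hne hn
  · cases m with
    | zero =>
      have hE : E = 0 := by rw [← heq, ha.zero]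
      have hv0 : 0 < colV₁ μ ε E 1 := by rw [hE]; exact colV₁_zero_energy_pos hμ hpε
      have hD0 : disc μ ε E = 2 := by rw [hE]; exact disc_zero_energy hpμ hpε
      have hc' : c = 2 := by rw [← hDc, hD0]
      refine single 0 ?_ (fun n hn hne h => ?_) (fun h => hv0.ne' h.1)
      · by_contra hne
        -- Otherwise the discriminant would exceed `c = 2` just to the right of zero, where it is
        -- strictly decreasing.
        have hpos : E < e 0 := lt_of_le_of_ne (by rw [← heq]; exact (he 0).1.1) (Ne.symm hne)
        have hneg := colV₁_mul_deriv_neg hμ hε (E := E) (by rw [hDc]; exact hc2) hv0.ne'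
        have hd := (hasDerivAt_disc hpμ hpε E).const_sub 2
        have hev := (eventually_of_hasDerivAt_pos (f := fun w => 2 - disc μ ε w) hd
          (neg_pos.2 ((pos_iff_neg_of_mul_neg hneg).1 hv0)) (by rw [hD0]; norm_num)).2
        obtain ⟨w, hw, hw1, hw2⟩ := (hev.and (Ioo_mem_nhdsGT hpos)).exists
        have := (he 0).2.2.1 w ⟨by rw [heq]; exact hw1, hw2⟩
        simp only [pow_zero, one_mul] at this
        linarith
      · rcases hn with hn | hn
        · omega
        · exact hne hn
    | succ m =>
      obtain ⟨hv, hv2⟩ := ha.colV₁_eq hμ hε m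
      have h2le := ha.two_le hμ hε (m + 1)
      rw [heq] at hv hv2 h2le
      rw [hDc] at h2le
      have hs := neg_one_pow_mul_self (m + 1)
      have hsc : (-1) ^ (m + 1) * c = 2 := by
        refine le_antisymm ((le_abs_self _).trans ?_) h2le
        rw [abs_mul, abs_pow, abs_neg, abs_one, one_pow, one_mul]; exact hc
      have hsm : ∀ x : ℝ, (-1) ^ m * x = -((-1) ^ (m + 1) * x) := fun x => by rw [pow_succ]; ring
      have hdet := (isFundamental_col E hpμ hpε).det 1
      rw [hv, mul_zero, sub_zero] at hdet
      have huv : colU₁ μ ε E 1 = colV₂ μ ε E 1 := by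
        have h1 := disc_sq_sub_four hpμ hpε E
        have h3 : disc μ ε E ^ 2 = 4 := by
          rw [hDc]
          calc c ^ 2 = ((-1) ^ (m + 1) * (-1) ^ (m + 1)) * c ^ 2 := by rw [hs, one_mul]
            _ = ((-1) ^ (m + 1) * c) ^ 2 := by ring
            _ = 4 := by rw [hsc]; norm_num
        rw [h3, hv, mul_zero, zero_mul, add_zero, sub_self] at h1
        have := pow_eq_zero_iff (two_ne_zero) |>.1 h1.symm
        linarith
      -- The next four facts read off, from one-sided signs of the signed discriminant minus `2`,
      -- whether the right slot `m + 1` and the left slot `m` sit at `E`.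
      have eR : (∃ᶠ w in 𝓝[>] E, (-1) ^ (m + 1) * disc μ ε w ≤ 2) → e (m + 1) = E := fun hfr => by
        by_contra hne
        have hpos : E < e (m + 1) := lt_of_le_of_ne (by rw [← heq]; exact (he _).1.1) (Ne.symm hne)
        obtain ⟨w, hw, hw1, hw2⟩ := (hfr.and_eventually (Ioo_mem_nhdsGT hpos)).exists
        have := (he (m + 1)).2.2.1 w ⟨by rw [heq]; exact hw1, hw2⟩
        linarith
      have eL : (∃ᶠ w in 𝓝[<] E, (-1) ^ (m + 1) * disc μ ε w ≤ 2) → e m = E := fun hfr => by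
        by_contra hne
        have hpos : e m < E := lt_of_le_of_ne (by rw [← heq]; exact (he _).1.2) hne
        obtain ⟨w, hw, hw1, hw2⟩ := (hfr.and_eventually (Ioo_mem_nhdsLT hpos)).exists
        have := (he m).2.2.2 w ⟨hw1, by rw [heq]; exact hw2⟩
        rw [hsm, hsm] at this
        linarith
      have neR : (∃ᶠ w in 𝓝[>] E, 2 ≤ (-1) ^ (m + 1) * disc μ ε w) → e (m + 1) ≠ E := fun hfr h => by
        obtain ⟨w, hw, hw1, hw2⟩ := (hfr.and_eventually (Ioo_mem_nhdsGT hm2)).exists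
        have := (he (m + 1)).2.2.2 w ⟨by rw [h]; exact hw1, hw2⟩
        linarith
      have neL : (∃ᶠ w in 𝓝[<] E, 2 ≤ (-1) ^ (m + 1) * disc μ ε w) → e m ≠ E := fun hfr h => by
        have hlt2 : a m < E := by rw [← heq]; exact ha.strictMono (Nat.lt_succ_self m)
        obtain ⟨w, hw, hw1, hw2⟩ := (hfr.and_eventually (Ioo_mem_nhdsLT hlt2)).exists
        have := (he m).2.2.1 w ⟨hw1, by rw [h]; exact hw2⟩
        rw [hsm, hsm] at this
        linarith
      -- If `u₂ = 0` the matrix is scalar and the discriminant has a strict extremum, so both slots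
      -- hit. Otherwise its derivative `weightVV * u₂` is nonzero, it passes through the level, and
      -- exactly one slot hits.
      by_cases hu : colU₂ μ ε E 1 = 0
      · have hev := eventually_disc_sq_lt hμ hε hu hv huv
        have hev' : ∀ᶠ w in 𝓝[≠] E, (-1) ^ (m + 1) * disc μ ε w ≤ 2 := by
          filter_upwards [hev] with w hw
          refine (abs_le_of_sq_le_sq' ?_ two_pos.le).2
          calc ((-1) ^ (m + 1) * disc μ ε w) ^ 2
              = ((-1) ^ (m + 1) * (-1) ^ (m + 1)) * disc μ ε w ^ 2 := by ring
            _ ≤ 2 ^ 2 := by rw [hs, one_mul]; linarith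
        have hR : ∀ᶠ w in 𝓝[>] E, (-1) ^ (m + 1) * disc μ ε w ≤ 2 :=
          hev'.filter_mono (nhdsWithin_mono _ fun w (hw : E < w) => hw.ne')
        have hL : ∀ᶠ w in 𝓝[<] E, (-1) ^ (m + 1) * disc μ ε w ≤ 2 :=
          hev'.filter_mono (nhdsWithin_mono _ fun w (hw : w < E) => hw.ne)
        have h1 := eR hR.frequently
        have h2 := eL hL.frequently
        have h3 : {m | e m = E} = {m, m + 1} := by
          ext n
          simp only [mem_ofPred_eq, mem_insert_iff, mem_singleton_iff]
          constructor
          · intro h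
            by_contra hne
            rcases lt_or_ge (n + 1) (m + 1) with h4 | h4
            · exact hlt n h4 h
            · exact hgt n (by omega) h
          · rintro (rfl | rfl)
            · exact h2
            · exact h1
        rw [h3, levelMult, if_pos hDc, if_pos ⟨hv, hu⟩, ncard_pair (by omega)]
        exact ⟨by simp, rfl⟩
      · have hder := (hasDerivAt_disc hpμ hpε E).const_mul ((-1 : ℝ) ^ (m + 1))
        rw [hv, huv, mul_zero, sub_zero] at hder
        have hd0 : (-1 : ℝ) ^ (m + 1) * (weightUV μ ε E * colV₂ μ ε E 1 +
            (weightVV μ ε E * colU₂ μ ε E 1 - weightUV μ ε E * colV₂ μ ε E 1)) ≠ 0 := by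
          have e1 : weightUV μ ε E * colV₂ μ ε E 1 +
            (weightVV μ ε E * colU₂ μ ε E 1 - weightUV μ ε E * colV₂ μ ε E 1)
              = weightVV μ ε E * colU₂ μ ε E 1 := by ring
          rw [e1]
          exact mul_ne_zero (by positivity) (mul_ne_zero (weightVV_pos hμ hε E).ne' hu)
        rcases lt_or_gt_of_ne hd0 with hneg | hpos
        · have hev := eventually_of_hasDerivAt_pos (f := fun w => 2 - (-1) ^ (m + 1) * disc μ ε w)
            (hder.const_sub 2) (neg_pos.2 hneg) (by rw [hDc, hsc, sub_self])
          refine single (m + 1) (eR (hev.2.mono fun w hw => by linarith).frequently)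
            (fun n hn hne => ?_) (fun h => hu h.2)
          obtain rfl : n = m := by omega
          exact neL (hev.1.mono fun w hw => by linarith).frequently
        · have hev := eventually_of_hasDerivAt_pos (f := fun w => (-1) ^ (m + 1) * disc μ ε w - 2)
            (hder.sub_const 2) hpos (by rw [hDc, hsc, sub_self])
          refine single m (eL (hev.1.mono fun w hw => by linarith).frequently)
            (fun n hn hne => ?_) (fun h => hu h.2)
          obtain rfl : n = m + 1 := by omega
          exact neR (hev.2.mono fun w hw => by linarith).frequently

end IsDirichletSeq

/-- If the multiplicities are those of a nondecreasing sequence, the `j`-th eigenvalue is the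
corresponding term of the sequence. -/
lemma band_eq_of_multiplicity {k : ℝ} {e : ℕ → ℝ} (hmono : Monotone e)
    (he : ∀ E, {m | e m = E}.Finite ∧ {m | e m = E}.ncard = multiplicity μ ε k E) (j : ℕ) :
    band μ ε (j + 1) k = e j := by
  classical
  -- Each index is sent to its value and the number of earlier indices with that value. This is a
  -- bijection onto the pairs counted by `eigenvalueCount`, with inverse given by `Nat.nth`.
  set g : ℕ → ℝ × ℕ := fun m => (e m, Nat.count (fun n => e n = e m) m)
  have hinj : Function.Injective g := by
    intro m n h
    simp only [g, Prod.mk.injEq] at h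
    have h1 := Nat.nth_count (p := fun i => e i = e m) (n := m) rfl
    have h2 := Nat.nth_count (p := fun i => e i = e m) (n := n) h.1.symm
    rw [← h1, ← h2]
    congr 1
    rw [h.2, h.1]
  have hset : ∀ t, {q : ℝ × ℕ | q.1 ≤ t ∧ q.2 < multiplicity μ ε k q.1} = g '' {m | e m ≤ t} := by
    intro t
    ext ⟨x, i⟩
    simp only [mem_ofPred_eq, mem_image, g, Prod.mk.injEq]
    constructor
    · rintro ⟨hx, hi⟩
      obtain ⟨hfin, hcard⟩ := he x
      have hi' : ∀ hf : (Set.ofPred fun n => e n = x).Finite, i < hf.toFinset.card := fun hf => by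
        rw [← ncard_eq_toFinset_card _ hf]
        exact hi.trans_eq hcard.symm
      have h1 : e (Nat.nth (fun n => e n = x) i) = x := Nat.nth_mem i hi'
      refine ⟨Nat.nth (fun n => e n = x) i, by rw [h1]; exact hx, h1, ?_⟩
      rw [h1]
      exact Nat.count_nth hi'
    · rintro ⟨m, hm, rfl, rfl⟩
      refine ⟨hm, ?_⟩
      obtain ⟨hfin, hcard⟩ := he (e m)
      rw [← hcard, ncard_eq_toFinset_card _ hfin]
      exact Nat.count_lt_card hfin rfl
  have hcount : ∀ t, ((j + 1 : ℕ) : ℕ∞) ≤ eigenvalueCount μ ε k t ↔ e j ≤ t := by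
    intro t
    rw [eigenvalueCount, hset, hinj.encard_image]
    constructor
    · intro h
      by_contra hcon
      have hsub : {m | e m ≤ t} ⊆ (Finset.range j : Set ℕ) := fun m hm => by
        simp only [Finset.coe_range, mem_Iio]
        by_contra hmj
        exact hcon ((hmono (not_lt.1 hmj)).trans hm)
      have h2 := encard_le_encard hsub
      rw [encard_coe_eq_coe_finsetCard, Finset.card_range] at h2
      have := h.trans h2
      rw [Nat.cast_le] at this
      omega
    · intro h
      have hsub : (Finset.range (j + 1) : Set ℕ) ⊆ {m | e m ≤ t} := fun m hm => by
        simp only [Finset.coe_range, mem_Iio] at hm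
        exact (hmono (Nat.lt_succ_iff.1 hm)).trans h
      have h2 := encard_le_encard hsub
      rwa [encard_coe_eq_coe_finsetCard, Finset.card_range] at h2
  have : {t : ℝ | ((j + 1 : ℕ) : ℕ∞) ≤ eigenvalueCount μ ε k t} = Ici (e j) := by
    ext t
    exact hcount t
  rw [band, this, csInf_Ici]

end Photonic

/-! ### Bloch modes as eigenvectors of the monodromy matrix. -/

namespace Photonic

variable {μ ε : ℝ → ℝ} {E : ℝ}

lemma IsFlow.isSolution {ψ p : ℝ → ℝ} (hμ : IsTame μ) (hε : IsTame ε)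
    (h : IsFlow μ (fun x => E * ε x) ψ p) : IsSolution μ ε E ψ p := by
  refine ⟨fun x => ?_, fun x => ?_, fun x => ?_, fun x => ?_⟩
  · exact (hμ.mul_continuous h.right.continuous).intervalIntegrable _ _
  · exact (hε.mul_continuous h.left.continuous).intervalIntegrable _ _
  · have := h.left.integral_eq 0 x
    simp only [smul_eq_mul]
    linarith
  · have := h.right.integral_eq 0 x
    simp only [smul_eq_mul]
    rw [← intervalIntegral.integral_const_mul]
    have e : ∫ t in (0 : ℝ)..x, -(E * ε t * ψ t) = -∫ t in (0 : ℝ)..x, E * (ε t * ψ t) := by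
      rw [← intervalIntegral.integral_neg]
      congr 1
      ext t
      ring
    linarith

lemma intervalIntegrable_of_zero {f : ℝ → ℝ} (h : ∀ x, IntervalIntegrable f volume 0 x) (a b : ℝ) :
    IntervalIntegrable f volume a b := (h a).symm.trans (h b)

lemma IsSolution.isFlow {ψ p : ℝ → ℝ} (hμ : IsTame μ) (hε : IsTame ε)
    (h : IsSolution μ ε E ψ p) : IsFlow μ (fun x => E * ε x) ψ p := by
  have hcψ : Continuous ψ := by
    have : ψ = fun x => ψ 0 + ∫ t in (0 : ℝ)..x, μ t • p t := funext h.eq_left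
    rw [this]
    exact continuous_const.add
      (intervalIntegral.continuous_primitive (intervalIntegrable_of_zero h.integrable_left) 0)
  have hcp : Continuous p := by
    have : p = fun x => p 0 - E • ∫ t in (0 : ℝ)..x, ε t • ψ t := funext h.eq_right
    rw [this]
    exact continuous_const.sub ((intervalIntegral.continuous_primitive
      (intervalIntegrable_of_zero h.integrable_right) 0).const_smul E)
  constructor
  · have := IsPrim.of_integral (hμ.mul_continuous hcp) (ψ 0)
    rwa [show (fun x => ψ 0 + ∫ t in (0 : ℝ)..x, μ t * p t) = ψ from
      funext fun x => (h.eq_left x).symm] at this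
  · have := IsPrim.of_integral ((hε.mul_continuous hcψ).const_mul (-E)) (p 0)
    rw [show (fun x => p 0 + ∫ t in (0 : ℝ)..x, -E * (ε t * ψ t)) = p from funext fun x => by
      rw [h.eq_right x, intervalIntegral.integral_const_mul]
      simp only [smul_eq_mul]
      ring] at this
    exact this.congr fun x => by ring

lemma IsSolution.ofReal {ψ p : ℝ → ℝ} (h : IsSolution μ ε E ψ p) :
    IsSolution μ ε E (fun x => (ψ x : ℂ)) (fun x => (p x : ℂ)) := by
  refine ⟨fun x => ?_, fun x => ?_, fun x => ?_, fun x => ?_⟩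
  · have := Complex.ofRealCLM.integrable_comp (h.integrable_left x).1
    have h2 := Complex.ofRealCLM.integrable_comp (h.integrable_left x).2
    simp only [Complex.ofRealCLM_apply, smul_eq_mul, Complex.ofReal_mul] at this h2
    exact ⟨by simpa only [Complex.real_smul] using! this, by simpa only [Complex.real_smul] using! h2⟩
  · have := Complex.ofRealCLM.integrable_comp (h.integrable_right x).1
    have h2 := Complex.ofRealCLM.integrable_comp (h.integrable_right x).2
    simp only [Complex.ofRealCLM_apply, smul_eq_mul, Complex.ofReal_mul] at this h2
    exact ⟨by simpa only [Complex.real_smul] using! this, by simpa only [Complex.real_smul] using! h2⟩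
  · have e : ∫ t in (0 : ℝ)..x, μ t • (p t : ℂ) = ((∫ t in (0 : ℝ)..x, μ t • p t : ℝ) : ℂ) := by
      rw [← intervalIntegral.integral_ofReal]
      simp
    rw [e, ← Complex.ofReal_add, ← h.eq_left x]
  · have e : ∫ t in (0 : ℝ)..x, ε t • (ψ t : ℂ) = ((∫ t in (0 : ℝ)..x, ε t • ψ t : ℝ) : ℂ) := by
      rw [← intervalIntegral.integral_ofReal]
      simp
    rw [e, Complex.real_smul, ← Complex.ofReal_mul, ← Complex.ofReal_sub, ← smul_eq_mul, ← h.eq_right x]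

lemma IsSolution.comp_clm {ψ p : ℝ → ℂ} (h : IsSolution μ ε E ψ p) (L : ℂ →L[ℝ] ℝ) :
    IsSolution μ ε E (fun x => L (ψ x)) (fun x => L (p x)) := by
  refine ⟨fun x => ?_, fun x => ?_, fun x => ?_, fun x => ?_⟩
  · have h1 := L.integrable_comp (h.integrable_left x).1
    have h2 := L.integrable_comp (h.integrable_left x).2
    simp only [map_smul] at h1 h2
    exact ⟨h1, h2⟩
  · have h1 := L.integrable_comp (h.integrable_right x).1
    have h2 := L.integrable_comp (h.integrable_right x).2
    simp only [map_smul] at h1 h2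
    exact ⟨h1, h2⟩
  · rw [h.eq_left x, map_add, ← L.intervalIntegral_comp_comm (h.integrable_left x)]
    simp only [map_smul]
  · rw [h.eq_right x, map_sub, map_smul, ← L.intervalIntegral_comp_comm (h.integrable_right x)]
    simp only [map_smul]

lemma IsFundamental.eq_comb_complex {u₁ u₂ v₁ v₂ : ℝ → ℝ} (hμ : IsTame μ) (hε : IsTame ε)
    (hf : IsFundamental μ (fun x => E * ε x) u₁ u₂ v₁ v₂) {ψ p : ℝ → ℂ} (h : IsSolution μ ε E ψ p)
    (x : ℝ) : ψ x = ψ 0 * u₁ x + p 0 * v₁ x := by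
  have h1 := (hf.eq_comb ((h.comp_clm Complex.reCLM).isFlow hμ hε) x).1
  have h2 := (hf.eq_comb ((h.comp_clm Complex.imCLM).isFlow hμ hε) x).1
  simp only [Complex.reCLM_apply, Complex.imCLM_apply] at h1 h2
  apply Complex.ext <;> simp [h1, h2]

lemma IsFundamental.shift {m q u₁ u₂ v₁ v₂ : ℝ → ℝ} (hf : IsFundamental m q u₁ u₂ v₁ v₂)
    (hm : ∀ x, m (x + 1) = m x) (hq : ∀ x, q (x + 1) = q x) (x : ℝ) :
    (u₁ (x + 1) = u₁ 1 * u₁ x + u₂ 1 * v₁ x ∧ u₂ (x + 1) = u₁ 1 * u₂ x + u₂ 1 * v₂ x) ∧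
    (v₁ (x + 1) = v₁ 1 * u₁ x + v₂ 1 * v₁ x ∧ v₂ (x + 1) = v₁ 1 * u₂ x + v₂ 1 * v₂ x) := by
  have h1 := hf.eq_comb (hf.u.shift hm hq) x
  have h2 := hf.eq_comb (hf.v.shift hm hq) x
  simp only [zero_add] at h1 h2
  exact ⟨h1, h2⟩

/-- The map `M - ζ` on `ℂ²`, for the matrix `M` with rows `(a, b)` and `(c, d)`. -/
def subScalar (a b c d ζ : ℂ) : ℂ × ℂ →ₗ[ℂ] ℂ × ℂ :=
  ((a - ζ) • LinearMap.fst ℂ ℂ ℂ + b • LinearMap.snd ℂ ℂ ℂ).prod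
    (c • LinearMap.fst ℂ ℂ ℂ + (d - ζ) • LinearMap.snd ℂ ℂ ℂ)

lemma mem_ker_subScalar {a b c d ζ : ℂ} {w : ℂ × ℂ} : w ∈ LinearMap.ker (subScalar a b c d ζ) ↔
    (a - ζ) * w.1 + b * w.2 = 0 ∧ c * w.1 + (d - ζ) * w.2 = 0 := by
  simp [subScalar, LinearMap.mem_ker]

lemma finrank_ker_eq_zero {a b c d ζ : ℂ} (h : (a - ζ) * (d - ζ) - b * c ≠ 0) :
    Module.finrank ℂ (LinearMap.ker (subScalar a b c d ζ)) = 0 := by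
  have : LinearMap.ker (subScalar a b c d ζ) = ⊥ := by
    rw [eq_bot_iff]
    intro w hw
    rw [mem_ker_subScalar] at hw
    have h1 : ((a - ζ) * (d - ζ) - b * c) * w.1 = 0 := by
      linear_combination (d - ζ) * hw.1 - b * hw.2
    have h2 : ((a - ζ) * (d - ζ) - b * c) * w.2 = 0 := by
      linear_combination (a - ζ) * hw.2 - c * hw.1
    exact Prod.ext ((mul_eq_zero.1 h1).resolve_left h) ((mul_eq_zero.1 h2).resolve_left h)
  rw [this, finrank_bot]

lemma finrank_ker_eq_one {a b c d ζ : ℂ} (h : (a - ζ) * (d - ζ) - b * c = 0)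
    (hbc : ¬(b = 0 ∧ c = 0)) : Module.finrank ℂ (LinearMap.ker (subScalar a b c d ζ)) = 1 := by
  by_cases hb : b = 0
  · have hc : c ≠ 0 := fun hc => hbc ⟨hb, hc⟩
    have : LinearMap.ker (subScalar a b c d ζ) = Submodule.span ℂ {(ζ - d, c)} := by
      ext w
      rw [mem_ker_subScalar, Submodule.mem_span_singleton]
      constructor
      · rintro ⟨-, h2⟩
        refine ⟨w.2 / c, Prod.ext ?_ ?_⟩
        · simp only [Prod.smul_mk, smul_eq_mul]
          field_simp
          linear_combination -h2
        · simp only [Prod.smul_mk, smul_eq_mul]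
          field_simp
      · rintro ⟨t, rfl⟩
        simp only [Prod.smul_mk, smul_eq_mul]
        exact ⟨by linear_combination -t * h, by ring⟩
    rw [this, finrank_span_singleton]
    exact fun h0 => hc (Prod.ext_iff.1 h0).2
  · have : LinearMap.ker (subScalar a b c d ζ) = Submodule.span ℂ {(b, ζ - a)} := by
      ext w
      rw [mem_ker_subScalar, Submodule.mem_span_singleton]
      constructor
      · rintro ⟨h1, -⟩
        refine ⟨w.1 / b, Prod.ext ?_ ?_⟩
        · simp only [Prod.smul_mk, smul_eq_mul]
          field_simp
        · simp only [Prod.smul_mk, smul_eq_mul]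
          field_simp
          linear_combination -h1
      · rintro ⟨t, rfl⟩
        simp only [Prod.smul_mk, smul_eq_mul]
        exact ⟨by ring, by linear_combination -t * h⟩
    rw [this, finrank_span_singleton]
    exact fun h0 => hb (Prod.ext_iff.1 h0).1

lemma finrank_ker_eq_two {a b c d ζ : ℂ} (ha : a = ζ) (hb : b = 0) (hc : c = 0) (hd : d = ζ) :
    Module.finrank ℂ (LinearMap.ker (subScalar a b c d ζ)) = 2 := by
  have : LinearMap.ker (subScalar a b c d ζ) = ⊤ := by
    rw [eq_top_iff]
    intro w _
    rw [mem_ker_subScalar, ha, hb, hc, hd]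
    simp
  rw [this, finrank_top, Module.finrank_prod, Module.finrank_self]

lemma isSolution_comb (hμ : IsProfile μ) (hε : IsProfile ε) (α β : ℂ) :
    ∃ p : ℝ → ℂ, IsSolution μ ε E (fun x => α * colU₁ μ ε E x + β * colV₁ μ ε E x) p := by
  have hf := isFundamental_col E hμ hε
  have hu := (hf.u.isSolution hμ.isTame hε.isTame).ofReal
  have hv := (hf.v.isSolution hμ.isTame hε.isTame).ofReal
  refine ⟨fun x => α * colU₂ μ ε E x + β * colV₂ μ ε E x, fun x => ?_, fun x => ?_, fun x => ?_,
    fun x => ?_⟩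
  · simpa [mul_add, mul_left_comm] using
      ((hu.integrable_left x).const_mul α).add ((hv.integrable_left x).const_mul β)
  · simpa [mul_add, mul_left_comm] using
      ((hu.integrable_right x).const_mul α).add ((hv.integrable_right x).const_mul β)
  · have e : ∫ t in (0 : ℝ)..x, μ t • (α * (colU₂ μ ε E t : ℂ) + β * (colV₂ μ ε E t : ℂ)) =
        α * (∫ t in (0 : ℝ)..x, μ t • (colU₂ μ ε E t : ℂ))
          + β * ∫ t in (0 : ℝ)..x, μ t • (colV₂ μ ε E t : ℂ) := by
      rw [← intervalIntegral.integral_const_mul, ← intervalIntegral.integral_const_mul,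
        ← intervalIntegral.integral_add ((hu.integrable_left x).const_mul α)
          ((hv.integrable_left x).const_mul β)]
      congr 1
      ext t
      simp only [Complex.real_smul]
      ring
    rw [e, hu.eq_left x, hv.eq_left x]
    ring
  · have e : ∫ t in (0 : ℝ)..x, ε t • (α * (colU₁ μ ε E t : ℂ) + β * (colV₁ μ ε E t : ℂ)) =
        α * (∫ t in (0 : ℝ)..x, ε t • (colU₁ μ ε E t : ℂ))
          + β * ∫ t in (0 : ℝ)..x, ε t • (colV₁ μ ε E t : ℂ) := by
      rw [← intervalIntegral.integral_const_mul, ← intervalIntegral.integral_const_mul,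
        ← intervalIntegral.integral_add ((hu.integrable_right x).const_mul α)
          ((hv.integrable_right x).const_mul β)]
      congr 1
      ext t
      simp only [Complex.real_smul]
      ring
    rw [e, hu.eq_right x, hv.eq_right x]
    simp only [Complex.real_smul]
    ring

lemma comb_eq_zero (hμ : IsCoefficient μ) (hε : IsCoefficient ε) {α β : ℂ}
    (h : ∀ x, α * colU₁ μ ε E x + β * colV₁ μ ε E x = 0) : α = 0 ∧ β = 0 := by
  have hf := isFundamental_col E hμ.toIsProfile hε.toIsProfile
  have hα : α = 0 := by simpa [hf.u₁_zero, hf.v₁_zero] using h 0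
  refine ⟨hα, ?_⟩
  by_contra hβ
  have hv : ∀ x, colV₁ μ ε E x = 0 := fun x => by
    have := h x
    rw [hα, zero_mul, zero_add] at this
    exact_mod_cast (mul_eq_zero.1 this).resolve_left hβ
  have := weightVV_pos hμ hε E
  simp [weightVV, hv] at this

lemma comb_mem_blochSpace_iff (hμ : IsCoefficient μ) (hε : IsCoefficient ε) (k : ℝ) (w : ℂ × ℂ) :
    (fun x => w.1 * colU₁ μ ε E x + w.2 * colV₁ μ ε E x) ∈ blochSpace μ ε k E ↔
    w ∈ LinearMap.ker (subScalar (colU₁ μ ε E 1) (colV₁ μ ε E 1) (colU₂ μ ε E 1) (colV₂ μ ε E 1)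
      (Complex.exp (Complex.I * k))) := by
  have hf := isFundamental_col E hμ.toIsProfile hε.toIsProfile
  set ζ := Complex.exp (Complex.I * k) with hζ
  have key : ∀ x, w.1 * colU₁ μ ε E (x + 1) + w.2 * colV₁ μ ε E (x + 1)
      - ζ * (w.1 * colU₁ μ ε E x + w.2 * colV₁ μ ε E x) =
      ((colU₁ μ ε E 1 - ζ) * w.1 + colV₁ μ ε E 1 * w.2) * colU₁ μ ε E x +
      (colU₂ μ ε E 1 * w.1 + (colV₂ μ ε E 1 - ζ) * w.2) * colV₁ μ ε E x := fun x => by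
    obtain ⟨⟨h1, -⟩, h2, -⟩ := hf.shift hμ.periodic (fun x => by rw [hε.periodic]) x
    rw [h1, h2]
    push_cast
    ring
  rw [mem_ker_subScalar]
  constructor
  · rintro ⟨-, h⟩
    exact comb_eq_zero hμ hε fun x => by rw [← key, sub_eq_zero]; exact h x
  · rintro ⟨h1, h2⟩
    refine ⟨isSolution_comb hμ.toIsProfile hε.toIsProfile _ _, fun x => ?_⟩
    rw [← sub_eq_zero]
    exact (key x).trans (by rw [h1, h2]; simp)

/-- Initial data identify solutions with `ℂ²`, and a shift by one period acts on the data as the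
monodromy matrix. -/
lemma multiplicity_eq_finrank_ker (hμ : IsCoefficient μ) (hε : IsCoefficient ε) (k E : ℝ) :
    multiplicity μ ε k E = Module.finrank ℂ (LinearMap.ker (subScalar (colU₁ μ ε E 1)
      (colV₁ μ ε E 1) (colU₂ μ ε E 1) (colV₂ μ ε E 1) (Complex.exp (Complex.I * k)))) := by
  have hf := isFundamental_col E hμ.toIsProfile hε.toIsProfile
  set K := LinearMap.ker (subScalar (colU₁ μ ε E 1)
      (colV₁ μ ε E 1) (colU₂ μ ε E 1) (colV₂ μ ε E 1) (Complex.exp (Complex.I * k)))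
  let T : K →ₗ[ℂ] blochSpace μ ε k E :=
    { toFun := fun w => ⟨fun x => w.1.1 * colU₁ μ ε E x + w.1.2 * colV₁ μ ε E x,
        (comb_mem_blochSpace_iff hμ hε k w.1).2 w.2⟩
      map_add' := fun w z => by
        ext x
        simp only [Submodule.coe_add, Prod.fst_add, Prod.snd_add, Pi.add_apply]
        ring
      map_smul' := fun c w => by
        ext x
        simp only [Submodule.coe_smul, Prod.smul_fst, Prod.smul_snd, smul_eq_mul, Pi.smul_apply,
          RingHom.id_apply]
        ring }
  have hT : Function.Bijective T := by
    constructor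
    · rw [← LinearMap.ker_eq_bot, eq_bot_iff]
      intro w hw
      have h1 : ∀ x, w.1.1 * colU₁ μ ε E x + w.1.2 * colV₁ μ ε E x = 0 := fun x =>
        congrFun (congrArg Subtype.val (LinearMap.mem_ker.1 hw)) x
      obtain ⟨h2, h3⟩ := comb_eq_zero hμ hε h1
      exact Subtype.ext (Prod.ext h2 h3)
    · rintro ⟨ψ, hψ⟩
      obtain ⟨⟨p, hp⟩, hper⟩ := hψ
      have h1 := hf.eq_comb_complex hμ.isTame hε.isTame hp
      have h2 : (fun x => ψ 0 * colU₁ μ ε E x + p 0 * colV₁ μ ε E x) = ψ := funext fun x => (h1 x).symm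
      refine ⟨⟨(ψ 0, p 0), (comb_mem_blochSpace_iff hμ hε k (ψ 0, p 0)).1 ?_⟩, Subtype.ext h2⟩
      simp only [h2]
      exact ⟨⟨p, hp⟩, hper⟩
  exact (LinearEquiv.ofBijective T hT).finrank_eq.symm

/-- The determinant of `M - ζ` vanishes exactly on the level set `disc = 2 cos k`. On it the kernel
is two-dimensional only if `M` is scalar, and for this vanishing off-diagonal entries suffice:
`disc² - 4` is then a square, while `4 cos² k - 4 ≤ 0`. -/
lemma multiplicity_eq_levelMult (hμ : IsCoefficient μ) (hε : IsCoefficient ε) (k E : ℝ) :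
    multiplicity μ ε k E = levelMult μ ε (2 * Real.cos k) E := by
  rw [multiplicity_eq_finrank_ker hμ hε, levelMult]
  have hdet := (isFundamental_col E hμ.toIsProfile hε.toIsProfile).det 1
  have hdetC : (colU₁ μ ε E 1 : ℂ) * colV₂ μ ε E 1 - colU₂ μ ε E 1 * colV₁ μ ε E 1 = 1 := by
    exact_mod_cast hdet
  have hζ : Complex.exp (Complex.I * k) = Real.cos k + Real.sin k * Complex.I := by
    rw [mul_comm, Complex.exp_mul_I]
    push_cast
    ring
  set ζ := Complex.exp (Complex.I * k) with hζdef
  have hζ0 : ζ ≠ 0 := Complex.exp_ne_zero _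
  have hsc : ((Real.sin k : ℂ)) ^ 2 + (Real.cos k : ℂ) ^ 2 = 1 := by
    exact_mod_cast Real.sin_sq_add_cos_sq k
  have hζ2 : ζ ^ 2 + 1 = 2 * Real.cos k * ζ := by
    rw [hζ]
    linear_combination (-1 : ℂ) * hsc + (Real.sin k : ℂ) ^ 2 * Complex.I_sq
  -- The characteristic polynomial is `ζ² - disc ζ + 1`, and `ζ² + 1 = 2 cos k ζ` on the unit
  -- circle.
  have hchar : (colU₁ μ ε E 1 - ζ) * (colV₂ μ ε E 1 - ζ) - colV₁ μ ε E 1 * colU₂ μ ε E 1 =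
      ζ * (((2 * Real.cos k - disc μ ε E : ℝ)) : ℂ) := by
    unfold disc
    push_cast
    push_cast at hζ2
    linear_combination hdetC + hζ2
  split_ifs with h1 h2
  · have h3 := disc_sq_sub_four hμ.toIsProfile hε.toIsProfile E
    rw [h2.1, h1, mul_zero, zero_mul, add_zero] at h3
    have h4 := Real.sin_sq_add_cos_sq k
    have h5 : Real.sin k = 0 := by
      have : Real.sin k ^ 2 = 0 := by
        nlinarith [sq_nonneg (Real.sin k), sq_nonneg (colU₁ μ ε E 1 - colV₂ μ ε E 1)]
      exact pow_eq_zero_iff (two_ne_zero) |>.1 this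
    have h6 : colU₁ μ ε E 1 - colV₂ μ ε E 1 = 0 := by
      have : (colU₁ μ ε E 1 - colV₂ μ ε E 1) ^ 2 = 0 := by
        rw [h5] at h4
        nlinarith
      exact pow_eq_zero_iff (two_ne_zero) |>.1 this
    unfold disc at h1
    have hζ' : ζ = (Real.cos k : ℂ) := by rw [hζ, h5]; simp
    refine finrank_ker_eq_two ?_ (by rw [h2.1]; simp) (by rw [h2.2]; simp) ?_
    · rw [hζ']
      exact_mod_cast (by linarith : colU₁ μ ε E 1 = Real.cos k)
    · rw [hζ']
      exact_mod_cast (by linarith : colV₂ μ ε E 1 = Real.cos k)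
  · refine finrank_ker_eq_one ?_ fun h => h2 (by exact_mod_cast h)
    rw [hchar, h1, sub_self]
    simp
  · refine finrank_ker_eq_zero ?_
    rw [hchar]
    refine mul_ne_zero hζ0 ?_
    exact_mod_cast sub_ne_zero.2 (Ne.symm h1)

/-- Interlacing of the bands with the Dirichlet energies. -/
lemma IsDirichletSeq.band {a : ℕ → ℝ} (ha : IsDirichletSeq μ ε a) (hμ : IsCoefficient μ)
    (hε : IsCoefficient ε) (m : ℕ) (k : ℝ) :
    band μ ε (m + 1) k ∈ Icc (a m) (a (m + 1)) ∧ disc μ ε (band μ ε (m + 1) k) = 2 * Real.cos k ∧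
    (∀ t ∈ Icc (a m) (a (m + 1)), (-1) ^ m * disc μ ε t < -2 → band μ ε (m + 1) k ≤ t) ∧
    ∀ t ∈ Icc (a m) (a (m + 1)), 2 < (-1) ^ m * disc μ ε t → t ≤ band μ ε (m + 1) k := by
  have hc : |2 * Real.cos k| ≤ 2 := by
    rw [abs_mul, abs_two]
    linarith [Real.abs_cos_le_one k]
  obtain ⟨e, he⟩ := ha.exists_slots hμ hε hc
  have hcount := ha.ncard_slots hμ hε hc he
  simp only [← multiplicity_eq_levelMult hμ hε] at hcount
  have hmono : Monotone e := monotone_nat_of_le_succ fun n => (he n).1.2.trans (he (n + 1)).1.1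
  rw [band_eq_of_multiplicity hmono hcount]
  have hcm : |(-1) ^ m * (2 * Real.cos k)| ≤ 2 := by
    rw [abs_mul, abs_pow, abs_neg, abs_one, one_pow, one_mul]; exact hc
  have hcm' := _root_.abs_le.1 hcm
  refine ⟨(he m).1, (he m).2.1, fun t ht hlt => ?_, fun t ht hlt => ?_⟩
  · by_contra hcon
    rw [not_le] at hcon
    rcases ht.1.eq_or_lt with h | h
    · have := ha.two_le hμ hε m
      rw [h] at this
      linarith
    · have := (he m).2.2.1 t ⟨h, hcon⟩
      linarith
  · by_contra hcon
    rw [not_le] at hcon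
    rcases ht.2.eq_or_lt with h | h
    · have := ha.two_le hμ hε (m + 1)
      rw [← h, pow_succ] at this
      linarith
    · have := (he m).2.2.2 t ⟨hcon, h⟩
      linarith

end Photonic

/-! ### Gaps, the Dirac point and the expansion of the monodromy matrix. -/

namespace Photonic

variable {μ ε μ₁ ε₁ : ℝ → ℝ}

lemma exists_isDirichletSeq (hμ : IsCoefficient μ) (hε : IsCoefficient ε) :
    ∃ a, IsDirichletSeq μ ε a :=
  let ⟨a, h1, h2, h3, h4, h5⟩ := exists_dirichlet hμ hε
  ⟨a, h1, h2, h3, h4, h5⟩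

/-- An interval of energies at which the discriminant exceeds `2` in absolute value and the
rotation is close to `(m + 1) π` separates the bands `m + 1` and `m + 2`. -/
lemma bands_separated (hμ : IsCoefficient μ) (hε : IsCoefficient ε) (m : ℕ) {g g' : ℝ} (hg : 0 < g)
    (hgg' : g ≤ g') (hD : ∀ E ∈ Icc g g', 2 < (-1) ^ (m + 1) * disc μ ε E)
    (hR : m * Real.pi < rotation μ ε g') (hR' : rotation μ ε g < (m + 2 : ℕ) * Real.pi) :
    bandMax μ ε (m + 1) ≤ g ∧ g' ≤ bandMin μ ε (m + 2) := by
  obtain ⟨a, ha⟩ := exists_isDirichletSeq hμ hε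
  have hgap : ∀ n k, band μ ε (n + 1) k ∉ Icc g g' := fun n k hmem => by
    have h1 := hD _ hmem
    rw [(ha.band hμ hε n k).2.1] at h1
    have h2 := le_abs_self ((-1) ^ (m + 1) * (2 * Real.cos k))
    rw [abs_mul, abs_pow, abs_neg, abs_one, one_pow, one_mul, abs_mul, abs_two] at h2
    linarith [Real.abs_cos_le_one k]
  have low : ∀ k, band μ ε (m + 1) k ≤ g := fun k => by
    obtain ⟨hmem, -, h3, -⟩ := ha.band hμ hε m k
    -- It suffices to reach `g'`, since no band value lies in the window. The angle bound places
    -- `g'` to the right of `a m`; in the Dirichlet interval the sign of the discriminant then puts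
    -- the band below it.
    have hle : band μ ε (m + 1) k ≤ g' := by
      rcases le_or_gt g' (a (m + 1)) with h | h
      · refine h3 g' ⟨?_, h⟩ ?_
        · cases m with
          | zero => rw [ha.zero]; linarith
          | succ m =>
            by_contra hcon
            exact lt_asymm hR (ha.rotation_lt m g' (not_le.1 hcon))
        · have := hD g' ⟨hgg', le_rfl⟩
          rw [pow_succ] at this
          linarith
      · exact hmem.2.trans h.le
    by_contra hcon
    exact hgap m k ⟨(not_le.1 hcon).le, hle⟩
  have high : ∀ k, g' ≤ band μ ε (m + 2) k := fun k => by
    obtain ⟨hmem, -, -, h4⟩ := ha.band hμ hε (m + 1) k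
    have hle : g ≤ band μ ε (m + 2) k := by
      rcases le_or_gt (a (m + 1)) g with h | h
      · refine h4 g ⟨h, ?_⟩ (hD g ⟨le_rfl, hgg'⟩)
        by_contra hcon
        exact lt_asymm hR' (ha.lt_rotation (m + 1) g (not_le.1 hcon))
      · exact h.le.trans hmem.1
    by_contra hcon
    exact hgap (m + 1) k ⟨hle, (not_le.1 hcon).le⟩
  have hne : (Icc (-Real.pi) Real.pi).Nonempty := ⟨0, by simp [Real.pi_pos.le]⟩
  constructor
  · refine csSup_le (hne.image _) ?_
    rintro _ ⟨k, -, rfl⟩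
    exact low k
  · refine le_csInf (hne.image _) ?_
    rintro _ ⟨k, -, rfl⟩
    exact high k

/-- At a Dirac point the monodromy matrix is `± 1`, and the rotation is a multiple of `π`. -/
lemma IsDiracPoint.monodromy (hμ : IsCoefficient μ) (hε : IsCoefficient ε) {m : ℕ} {kStar EStar : ℝ}
    (h : IsDiracPoint μ ε (m + 1) kStar EStar) :
    0 < EStar ∧ rotation μ ε EStar = (m + 1 : ℕ) * Real.pi ∧ colV₁ μ ε EStar 1 = 0 ∧
    colU₂ μ ε EStar 1 = 0 ∧ colU₁ μ ε EStar 1 = (-1) ^ (m + 1) ∧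
    colV₂ μ ε EStar 1 = (-1) ^ (m + 1) := by
  obtain ⟨a, ha⟩ := exists_isDirichletSeq hμ hε
  -- The two touching bands lie on opposite sides of this Dirichlet energy.
  have hE : EStar = a (m + 1) := by
    have h1 := (ha.band hμ hε m kStar).1.2
    have h2 := (ha.band hμ hε (m + 1) kStar).1.1
    rw [h.band_eq] at h1
    rw [h.band_succ_eq] at h2
    exact le_antisymm h1 h2
  have hmult := h.multiplicity_eq
  rw [multiplicity_eq_levelMult hμ hε, levelMult] at hmult
  split_ifs at hmult with h1 h2
  swap
  · exact absurd hmult (by norm_num)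
  obtain ⟨hv, hv2⟩ := ha.colV₁_eq hμ hε m
  rw [← hE] at hv hv2
  have hu := h2.2
  have h3 := disc_sq_sub_four hμ.toIsProfile hε.toIsProfile EStar
  rw [hv, h1, mul_zero, zero_mul, add_zero] at h3
  have h6 : colU₁ μ ε EStar 1 - colV₂ μ ε EStar 1 = 0 := by
    have : (colU₁ μ ε EStar 1 - colV₂ μ ε EStar 1) ^ 2 = 0 := by
      nlinarith [sq_nonneg (colU₁ μ ε EStar 1 - colV₂ μ ε EStar 1), Real.cos_sq_le_one kStar]
    exact pow_eq_zero_iff (two_ne_zero) |>.1 this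
  have hdet := (isFundamental_col EStar hμ.toIsProfile hε.toIsProfile).det 1
  have hs := neg_one_pow_mul_self (m + 1)
  set s : ℝ := (-1) ^ (m + 1)
  have h7 : s * colV₂ μ ε EStar 1 = 1 := by
    have h8 : (s * colV₂ μ ε EStar 1) ^ 2 = 1 := by
      rw [hv, mul_zero, sub_zero, sub_eq_zero.1 h6] at hdet
      calc (s * colV₂ μ ε EStar 1) ^ 2
          = (s * s) * (colV₂ μ ε EStar 1 * colV₂ μ ε EStar 1) := by ring
        _ = 1 := by rw [hs, hdet, one_mul]
    nlinarith
  have h9 : colV₂ μ ε EStar 1 = s := by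
    calc colV₂ μ ε EStar 1 = (s * s) * colV₂ μ ε EStar 1 := by rw [hs, one_mul]
      _ = s * (s * colV₂ μ ε EStar 1) := by ring
      _ = s := by rw [h7, mul_one]
  refine ⟨?_, by rw [hE]; exact ha.rotation_eq m, hv, hu, by rw [← h9]; linarith, h9⟩
  rw [hE]
  have := ha.strictMono (Nat.succ_pos m)
  rwa [ha.zero] at this

/-- Both alternatives imply that the form is indefinite; in the second, `2 a c < b² < 2 b²` because
`b ≠ 0`. Uniqueness of solutions replaces the given fundamental system by the chosen one. -/
lemma PerturbationCondition.forms (hμ : IsProfile μ) (hε : IsProfile ε) {E : ℝ}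
    (h : PerturbationCondition μ ε μ₁ ε₁ E) :
    perturbForm μ₁ ε₁ E (colV₁ μ ε E) (colV₂ μ ε E) (colV₁ μ ε E) (colV₂ μ ε E) *
      perturbForm μ₁ ε₁ E (colU₁ μ ε E) (colU₂ μ ε E) (colU₁ μ ε E) (colU₂ μ ε E) <
    perturbForm μ₁ ε₁ E (colU₁ μ ε E) (colU₂ μ ε E) (colV₁ μ ε E) (colV₂ μ ε E) ^ 2 := by
  obtain ⟨u₁, u₂, v₁, v₂, ⟨hu, hu1, hu2⟩, ⟨hv, hv1, hv2⟩, hcond⟩ := h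
  have hf := isFundamental_col E hμ hε
  have eu := hf.eq_comb (hu.isFlow hμ.isTame hε.isTame)
  have ev := hf.eq_comb (hv.isFlow hμ.isTame hε.isTame)
  simp only [hu1, hu2, hv1, hv2, one_mul, zero_mul, add_zero, zero_add] at eu ev
  obtain rfl : u₁ = colU₁ μ ε E := funext fun x => (eu x).1
  obtain rfl : u₂ = colU₂ μ ε E := funext fun x => (eu x).2
  obtain rfl : v₁ = colV₁ μ ε E := funext fun x => (ev x).1
  obtain rfl : v₂ = colV₂ μ ε E := funext fun x => (ev x).2
  rcases hcond with ⟨-, h⟩ | ⟨hneg, h⟩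
  · exact h
  · nlinarith [mul_pos_of_neg_of_neg hneg hneg]

set_option maxHeartbeats 1000000 in
/-- First order expansion of the monodromy matrix at a point where it is the scalar `s`. -/
lemma exists_monodromy_expansion (hμ : IsProfile μ) (hε : IsProfile ε) (hμ₁ : IsProfile μ₁)
    (hε₁ : IsProfile ε₁) {E₀ s : ℝ} (hs : s * s = 1) (hv₁ : colV₁ μ ε E₀ 1 = 0)
    (hu₂ : colU₂ μ ε E₀ 1 = 0) (hu₁ : colU₁ μ ε E₀ 1 = s) (hv₂ : colV₂ μ ε E₀ 1 = s) :
    ∃ C : ℝ, ∀ δ l : ℝ, |δ| ≤ 1 → |l| ≤ 1 →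
    (|s * colU₁ (perturbed μ μ₁ δ) (perturbed ε ε₁ δ) (E₀ + δ * l) 1 - (1 + δ *
      (perturbForm μ₁ ε₁ E₀ (colU₁ μ ε E₀) (colU₂ μ ε E₀) (colV₁ μ ε E₀) (colV₂ μ ε E₀)
        + l * weightUV μ ε E₀))| ≤ C * δ ^ 2 ∧
    |s * colU₂ (perturbed μ μ₁ δ) (perturbed ε ε₁ δ) (E₀ + δ * l) 1 + δ *
      (perturbForm μ₁ ε₁ E₀ (colU₁ μ ε E₀) (colU₂ μ ε E₀) (colU₁ μ ε E₀) (colU₂ μ ε E₀)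
        + l * weightUU μ ε E₀)| ≤ C * δ ^ 2) ∧
    (|s * colV₁ (perturbed μ μ₁ δ) (perturbed ε ε₁ δ) (E₀ + δ * l) 1 - δ *
      (perturbForm μ₁ ε₁ E₀ (colV₁ μ ε E₀) (colV₂ μ ε E₀) (colV₁ μ ε E₀) (colV₂ μ ε E₀)
        + l * weightVV μ ε E₀)| ≤ C * δ ^ 2 ∧
    |s * colV₂ (perturbed μ μ₁ δ) (perturbed ε ε₁ δ) (E₀ + δ * l) 1 - (1 - δ *
      (perturbForm μ₁ ε₁ E₀ (colU₁ μ ε E₀) (colU₂ μ ε E₀) (colV₁ μ ε E₀) (colV₂ μ ε E₀)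
        + l * weightUV μ ε E₀))| ≤ C * δ ^ 2) := by
  obtain ⟨K₁, h10, h1⟩ := hμ.bounded
  obtain ⟨K₂, h20, h2⟩ := hε.bounded
  obtain ⟨K₃, h30, h3⟩ := hμ₁.bounded
  obtain ⟨K₄, h40, h4⟩ := hε₁.bounded
  set B := |E₀| + 1 with hB
  have hB0 : 0 < B := by positivity
  set L := K₁ + K₃ + B * (K₂ + K₄) with hL
  set H := K₃ + K₂ + B * K₄ with hH
  have hH0 : 0 < H := by positivity
  have hf := isFundamental_col E₀ hμ hε
  have bd1 : ∀ δ, |δ| ≤ 1 → ∀ x, |perturbed μ μ₁ δ x| ≤ L := fun δ hδ x => by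
    have e1 : |δ * μ₁ x| ≤ 1 * K₃ := by rw [abs_mul]; gcongr; exact h3 x
    have e2 : 0 ≤ B * (K₂ + K₄) := by positivity
    have e3 := abs_add_le (μ x) (δ * μ₁ x)
    have e4 := h1 x
    simp only [perturbed]
    linarith
  have bd2 : ∀ δ E, |δ| ≤ 1 → |E| ≤ B → ∀ x, |E * perturbed ε ε₁ δ x| ≤ L := fun δ E hδ hE x => by
    have e0 : |perturbed ε ε₁ δ x| ≤ K₂ + K₄ := by
      have e1 : |δ * ε₁ x| ≤ 1 * K₄ := by rw [abs_mul]; gcongr; exact h4 x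
      have e3 := abs_add_le (ε x) (δ * ε₁ x)
      have e4 := h2 x
      simp only [perturbed]
      linarith
    have e1 : |E * perturbed ε ε₁ δ x| ≤ B * (K₂ + K₄) := by
      rw [abs_mul]; gcongr
    linarith
  have z1 : ∀ x, |μ x| ≤ L := by simpa [perturbed_zero] using bd1 0 (by simp)
  have z2 : ∀ x, |E₀ * ε x| ≤ L := by
    simpa [perturbed_zero] using bd2 0 E₀ (by simp) (by simp [hB])
  set C := 16 * Real.exp L ^ 5 * H ^ 2 + K₄ * (Real.exp L * Real.exp L) with hCdef
  refine ⟨C, fun δ l hδ hl => ?_⟩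
  have hδl : |δ * l| ≤ |δ| := by
    rw [abs_mul]; exact mul_le_of_le_one_right (abs_nonneg _) hl
  have hE : |E₀ + δ * l| ≤ B := (abs_add_le _ _).trans (by linarith)
  have hf' := isFundamental_col (E₀ + δ * l) (hμ.perturbed hμ₁ δ) (hε.perturbed hε₁ δ)
  have c1 : ∀ x, |perturbed μ μ₁ δ x - μ x| ≤ |δ| * H := fun x => by
    have e1 : perturbed μ μ₁ δ x - μ x = δ * μ₁ x := by simp only [perturbed]; ring
    rw [e1, abs_mul]
    have : 0 ≤ K₂ + B * K₄ := by positivity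
    exact mul_le_mul_of_nonneg_left ((h3 x).trans (by linarith)) (abs_nonneg _)
  have c2 : ∀ x, |(E₀ + δ * l) * perturbed ε ε₁ δ x - E₀ * ε x| ≤ |δ| * H := fun x => by
    have e1 : (E₀ + δ * l) * perturbed ε ε₁ δ x - E₀ * ε x
        = (δ * l) * ε x + (E₀ + δ * l) * (δ * ε₁ x) := by simp only [perturbed]; ring
    have e2 : |(δ * l) * ε x| ≤ |δ| * K₂ := by rw [abs_mul]; gcongr; exact h2 x
    have e3 : |(E₀ + δ * l) * (δ * ε₁ x)| ≤ B * (|δ| * K₄) := by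
      rw [abs_mul, abs_mul]; gcongr; exact h4 x
    have e4 : 0 ≤ |δ| * K₃ := by positivity
    have := abs_add_le ((δ * l) * ε x) ((E₀ + δ * l) * (δ * ε₁ x))
    rw [e1, hH]
    linarith
  have hC16 : 16 * Real.exp L ^ 5 * (|δ| * H) ^ 2 = 16 * Real.exp L ^ 5 * H ^ 2 * δ ^ 2 := by
    rw [mul_pow, sq_abs]; ring
  have hgram : ∀ y₁ y₂ z₁ z₂ : ℝ → ℝ, Continuous y₁ → Continuous y₂ → Continuous z₁ → Continuous z₂ →
      (∀ t ∈ Icc (0 : ℝ) 1, |y₁ t| ≤ Real.exp L) → (∀ t ∈ Icc (0 : ℝ) 1, |z₁ t| ≤ Real.exp L) →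
      |gram (fun x => perturbed μ μ₁ δ x - μ x)
        (fun x => (E₀ + δ * l) * perturbed ε ε₁ δ x - E₀ * ε x) y₁ y₂ z₁ z₂ -
        δ * (perturbForm μ₁ ε₁ E₀ y₁ y₂ z₁ z₂ + l * ∫ x in (0 : ℝ)..1, ε x * (y₁ x * z₁ x))| ≤
      K₄ * (Real.exp L * Real.exp L) * δ ^ 2 := by
    intro y₁ y₂ z₁ z₂ hy₁ hy₂ hz₁ hz₂ by₁ bz₁
    have i1 : IntervalIntegrable (fun x => y₁ x * (E₀ * ε₁ x) * z₁ x + y₂ x * μ₁ x * z₂ x)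
        volume 0 1 := by
      have := ((hε₁.isTame.mul_continuous (hy₁.mul hz₁)).const_mul E₀).add
        (hμ₁.isTame.mul_continuous (hy₂.mul hz₂))
      refine (this.intervalIntegrable 0 1).congr (fun x _ => ?_)
      simp only [Pi.mul_apply]
      ring
    have i2 : IntervalIntegrable (fun x => ε x * (y₁ x * z₁ x)) volume 0 1 :=
      (hε.isTame.mul_continuous (hy₁.mul hz₁)).intervalIntegrable 0 1
    have i3 : IntervalIntegrable (fun x => ε₁ x * (y₁ x * z₁ x)) volume 0 1 :=
      (hε₁.isTame.mul_continuous (hy₁.mul hz₁)).intervalIntegrable 0 1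
    -- The only second order term is the cross term `(δ l) (δ ε₁)` of the energy shift and the
    -- coefficient perturbation.
    have e : gram (fun x => perturbed μ μ₁ δ x - μ x)
        (fun x => (E₀ + δ * l) * perturbed ε ε₁ δ x - E₀ * ε x) y₁ y₂ z₁ z₂ =
        δ * (perturbForm μ₁ ε₁ E₀ y₁ y₂ z₁ z₂ + l * ∫ x in (0 : ℝ)..1, ε x * (y₁ x * z₁ x))
        + (l * δ ^ 2) * ∫ x in (0 : ℝ)..1, ε₁ x * (y₁ x * z₁ x) := by
      unfold gram perturbForm
      rw [← intervalIntegral.integral_const_mul, ← intervalIntegral.integral_add i1 (i2.const_mul l),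
        ← intervalIntegral.integral_const_mul, ← intervalIntegral.integral_const_mul,
        ← intervalIntegral.integral_add ((i1.add (i2.const_mul l)).const_mul δ) (i3.const_mul _)]
      congr 1
      ext x
      simp only [perturbed]
      ring
    rw [e, add_sub_cancel_left, abs_mul, abs_mul, abs_of_nonneg (sq_nonneg δ)]
    have h5 : |∫ x in (0 : ℝ)..1, ε₁ x * (y₁ x * z₁ x)| ≤ K₄ * (Real.exp L * Real.exp L) :=
      abs_integral_le_of_abs_le (by simp) fun t ht => by
        have e1 := h4 t
        have e2 := by₁ t ht
        have e3 := bz₁ t ht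
        rw [abs_mul, abs_mul]
        gcongr
    calc |l| * δ ^ 2 * |∫ x in (0 : ℝ)..1, ε₁ x * (y₁ x * z₁ x)|
        ≤ 1 * δ ^ 2 * (K₄ * (Real.exp L * Real.exp L)) := by gcongr
      _ = _ := by ring
  have cu₁ := hf.u.left.continuous
  have cu₂ := hf.u.right.continuous
  have cv₁ := hf.v.left.continuous
  have cv₂ := hf.v.right.continuous
  have bu : ∀ t ∈ Icc (0 : ℝ) 1, |colU₁ μ ε E₀ t| ≤ Real.exp L := fun t ht => (hf.abs_le z1 z2 ht).1.1
  have bv : ∀ t ∈ Icc (0 : ℝ) 1, |colV₁ μ ε E₀ t| ≤ Real.exp L := fun t ht => (hf.abs_le z1 z2 ht).2.1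
  have gUU := hgram _ _ _ _ cu₁ cu₂ cu₁ cu₂ bu bu
  have gUV := hgram _ _ _ _ cu₁ cu₂ cv₁ cv₂ bu bv
  have gVV := hgram _ _ _ _ cv₁ cv₂ cv₁ cv₂ bv bv
  have hsymm : ∀ f g : ℝ → ℝ, gram f g (colV₁ μ ε E₀) (colV₂ μ ε E₀) (colU₁ μ ε E₀) (colU₂ μ ε E₀) =
      gram f g (colU₁ μ ε E₀) (colU₂ μ ε E₀) (colV₁ μ ε E₀) (colV₂ μ ε E₀) := fun f g => by
    unfold gram
    congr 1
    ext x
    ring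
  have eu := hf'.u.first_order hf hμ.isTame (hε.isTame.const_mul E₀) (hμ.perturbed hμ₁ δ).isTame
    ((hε.perturbed hε₁ δ).isTame.const_mul _) z1 z2 (bd1 δ hδ) (bd2 δ _ hδ hE) c1 c2
    (by simp [hf'.u₁_zero, hf'.u₂_zero]) (y₁ := colU₁ μ ε E₀) (y₂ := colU₂ μ ε E₀)
    (by simp [hf'.u₁_zero, hf'.u₂_zero]) (by simp [hf'.u₁_zero, hf'.u₂_zero])
  have ev := hf'.v.first_order hf hμ.isTame (hε.isTame.const_mul E₀) (hμ.perturbed hμ₁ δ).isTame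
    ((hε.perturbed hε₁ δ).isTame.const_mul _) z1 z2 (bd1 δ hδ) (bd2 δ _ hδ hE) c1 c2
    (by simp [hf'.v₁_zero, hf'.v₂_zero]) (y₁ := colV₁ μ ε E₀) (y₂ := colV₂ μ ε E₀)
    (by simp [hf'.v₁_zero, hf'.v₂_zero]) (by simp [hf'.v₁_zero, hf'.v₂_zero])
  rw [hC16, hv₁, hu₂, hu₁, hv₂] at eu ev
  rw [hsymm] at ev
  simp only [mul_zero, sub_zero, zero_add, add_zero, zero_sub] at eu ev
  have habs : |s| = 1 := by
    rcases mul_self_eq_one_iff.1 hs with h | h <;> simp [h]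
  -- Two errors add up to `C`: the remainder of the first order expansion, and the second order part
  -- of the Gram integral `G` whose linear part is `P`.
  have combine : ∀ {x y G P : ℝ}, |x - y| ≤ 16 * Real.exp L ^ 5 * H ^ 2 * δ ^ 2 →
      |G - P| ≤ K₄ * (Real.exp L * Real.exp L) * δ ^ 2 → ∀ {r z : ℝ},
      (s * x - z = s * (x - y) + r * (G - P)) → |r| = 1 → |s * x - z| ≤ C * δ ^ 2 := by
    intro x y G P h1 h2 r z h3 hr
    rw [h3]
    refine (abs_add_le _ _).trans ?_
    rw [abs_mul, abs_mul, habs, hr, one_mul, one_mul, hCdef, add_mul]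
    exact add_le_add h1 h2
  refine ⟨⟨?_, ?_⟩, ?_, ?_⟩
  · exact combine eu.1 gUV (r := 1) (by unfold weightUV; linear_combination (-1 -
      gram (fun x => perturbed μ μ₁ δ x - μ x)
        (fun x => (E₀ + δ * l) * perturbed ε ε₁ δ x - E₀ * ε x) (colU₁ μ ε E₀) (colU₂ μ ε E₀)
        (colV₁ μ ε E₀) (colV₂ μ ε E₀)) * -hs) (by simp)
  · rw [← sub_neg_eq_add]
    exact combine eu.2 gUU (r := -1) (by unfold weightUU; linear_combination (-
      gram (fun x => perturbed μ μ₁ δ x - μ x)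
        (fun x => (E₀ + δ * l) * perturbed ε ε₁ δ x - E₀ * ε x) (colU₁ μ ε E₀) (colU₂ μ ε E₀)
        (colU₁ μ ε E₀) (colU₂ μ ε E₀)) * hs) (by simp)
  · exact combine ev.1 gVV (r := 1) (by unfold weightVV; linear_combination (
      gram (fun x => perturbed μ μ₁ δ x - μ x)
        (fun x => (E₀ + δ * l) * perturbed ε ε₁ δ x - E₀ * ε x) (colV₁ μ ε E₀) (colV₂ μ ε E₀)
        (colV₁ μ ε E₀) (colV₂ μ ε E₀)) * hs) (by simp)
  · exact combine ev.2 gUV (r := -1) (by unfold weightUV; linear_combination (1 -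
      gram (fun x => perturbed μ μ₁ δ x - μ x)
        (fun x => (E₀ + δ * l) * perturbed ε ε₁ δ x - E₀ * ε x) (colU₁ μ ε E₀) (colU₂ μ ε E₀)
        (colV₁ μ ε E₀) (colV₂ μ ε E₀)) * hs) (by simp)

end Photonic

/-! ### The stable direction and its crossing. -/

namespace Photonic

/-- The eigenvector for the eigenvalue `-√(x² + y z)` of the traceless matrix with rows `(x, y)`,
`(z, -x)` obtained from `w`. -/
noncomputable def stable (w : ℝ × ℝ) (x y z : ℝ) : ℝ × ℝ :=
  ((x - √(x ^ 2 + y * z)) * w.1 + y * w.2, z * w.1 + (-x - √(x ^ 2 + y * z)) * w.2)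

/-- A traceless matrix `N` satisfies `N² = κ²`, so `(N + κ)(N - κ) = 0` and the image of `N - κ`
consists of eigenvectors for `-κ`. This formula is continuous in the entries for fixed `w`. -/
lemma stable_eigen (w : ℝ × ℝ) {x y z : ℝ} (h : 0 ≤ x ^ 2 + y * z) :
    x * (stable w x y z).1 + y * (stable w x y z).2 = -√(x ^ 2 + y * z) * (stable w x y z).1 ∧
    z * (stable w x y z).1 - x * (stable w x y z).2 = -√(x ^ 2 + y * z) * (stable w x y z).2 := by
  have hs := Real.mul_self_sqrt h
  simp only [stable]
  constructor
  · linear_combination -w.1 * hs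
  · linear_combination -w.2 * hs

lemma exists_stable_ne_zero {x y z : ℝ} (h : 0 < x ^ 2 + y * z) : ∃ w, stable w x y z ≠ 0 := by
  have hs := Real.sqrt_pos.2 h
  by_cases hx : x - √(x ^ 2 + y * z) = 0
  · refine ⟨(0, 1), fun h0 => ?_⟩
    have := (Prod.ext_iff.1 h0).2
    simp only [stable, mul_zero, mul_one, zero_add, Prod.snd_zero] at this
    linarith
  · refine ⟨(1, 0), fun h0 => hx ?_⟩
    have := (Prod.ext_iff.1 h0).1
    simpa [stable] using this

lemma tendsto_stable {α : Type*} {l : Filter α} (w : ℝ × ℝ) {X Y Z : α → ℝ} {x y z : ℝ}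
    (hX : Tendsto X l (𝓝 x)) (hY : Tendsto Y l (𝓝 y)) (hZ : Tendsto Z l (𝓝 z)) :
    Tendsto (fun t => stable w (X t) (Y t) (Z t)) l (𝓝 (stable w x y z)) := by
  have h1 := ((hX.pow 2).add (hY.mul hZ)).sqrt
  exact (((hX.sub h1).mul_const _).add (hY.mul_const _)).prodMk_nhds
    ((hZ.mul_const _).add ((hX.neg.sub h1).mul_const _))

lemma exists_smul_of_det_eq_zero {v w : ℝ × ℝ} (hv : v ≠ 0) (hw : w ≠ 0)
    (h : v.1 * w.2 - v.2 * w.1 = 0) : ∃ t : ℝ, t ≠ 0 ∧ w.1 = t * v.1 ∧ w.2 = t * v.2 := by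
  by_cases h1 : v.1 = 0
  · have h2 : v.2 ≠ 0 := fun h2 => hv (Prod.ext h1 h2)
    have h3 : w.1 = 0 := by
      rw [h1, zero_mul, zero_sub, neg_eq_zero] at h
      exact (mul_eq_zero.1 h).resolve_left h2
    have h4 : w.2 ≠ 0 := fun h4 => hw (Prod.ext h3 h4)
    exact ⟨w.2 / v.2, div_ne_zero h4 h2, by rw [h1, h3, mul_zero], by field_simp⟩
  · have e2 : w.2 = w.1 / v.1 * v.2 := by field_simp; linarith
    refine ⟨w.1 / v.1, fun h0 => ?_, by field_simp, e2⟩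
    rw [h0, zero_mul] at e2
    exact hw (Prod.ext ((div_eq_zero_iff.1 h0).resolve_right h1) e2)

/-- The stable directions of `n + t n₀` and `n - t n₀` differ. -/
lemma stable_det_ne_zero {a b c a₀ b₀ c₀ t : ℝ} (w : ℝ × ℝ)
    (hpos : ∀ x y : ℝ, x ≠ 0 ∨ y ≠ 0 → 0 < x ^ 2 * a₀ + 2 * x * y * b₀ + y ^ 2 * c₀) (ht : t ≠ 0)
    (h1 : 0 ≤ (b + t * b₀) ^ 2 + (c + t * c₀) * -(a + t * a₀))
    (h2 : 0 ≤ (b + -t * b₀) ^ 2 + (c + -t * c₀) * -(a + -t * a₀))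
    (hv : stable w (b + t * b₀) (c + t * c₀) (-(a + t * a₀)) ≠ 0)
    (hv' : stable w (b + -t * b₀) (c + -t * c₀) (-(a + -t * a₀)) ≠ 0) :
    (stable w (b + t * b₀) (c + t * c₀) (-(a + t * a₀))).1 *
      (stable w (b + -t * b₀) (c + -t * c₀) (-(a + -t * a₀))).2 -
    (stable w (b + t * b₀) (c + t * c₀) (-(a + t * a₀))).2 *
      (stable w (b + -t * b₀) (c + -t * c₀) (-(a + -t * a₀))).1 ≠ 0 := by
  intro h
  obtain ⟨r, hr, e1, e2⟩ := exists_smul_of_det_eq_zero hv hv' h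
  obtain ⟨q1, q2⟩ := stable_eigen w h1
  obtain ⟨q3, q4⟩ := stable_eigen w h2
  rw [e1, e2] at q3 q4
  set v := stable w (b + t * b₀) (c + t * c₀) (-(a + t * a₀))
  set κ := √((b + t * b₀) ^ 2 + (c + t * c₀) * -(a + t * a₀))
  set κ' := √((b + -t * b₀) ^ 2 + (c + -t * c₀) * -(a + -t * a₀))
  have hne : v.1 ≠ 0 ∨ v.2 ≠ 0 := by
    by_contra hcon
    push Not at hcon
    exact hv (Prod.ext hcon.1 hcon.2)
  have q3' : (b + -t * b₀) * v.1 + (c + -t * c₀) * v.2 = -κ' * v.1 :=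
    mul_left_cancel₀ hr (by linear_combination q3)
  have q4' : -(a + -t * a₀) * v.1 - (b + -t * b₀) * v.2 = -κ' * v.2 :=
    mul_left_cancel₀ hr (by linear_combination q4)
  -- The expression `v₂ (N v)₁ - v₁ (N v)₂` vanishes on eigenvectors and, for these matrices, is a
  -- quadratic form in `v` linear in the coefficients. Subtracting the two vanishing forms leaves `2
  -- t` times the positive one.
  have key : 2 * t * (v.1 ^ 2 * a₀ + 2 * v.1 * v.2 * b₀ + v.2 ^ 2 * c₀) = 0 := by
    linear_combination (-v.1) * q2 + v.2 * q1 + v.1 * q4' - v.2 * q3'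
  have := hpos v.1 v.2 hne
  rcases mul_eq_zero.1 key with h0 | h0
  · exact ht (by linarith)
  · exact this.ne' h0

section Crossing

variable {X Y Z : ℝ → ℝ → ℝ} {a b c a₀ b₀ c₀ C : ℝ}

/-- The punctured filter in `δ` is needed because the rescaled entries contain a division by `δ`. -/
lemma tendsto_of_abs_sub_le {F : ℝ → ℝ → ℝ} {p q : ℝ}
    (h : ∀ δ l, δ ≠ 0 → |δ| ≤ 1 → |l| ≤ 1 → |F δ l - (p + l * q)| ≤ C * |δ|) {l₀ : ℝ} (hl₀ : |l₀| < 1) :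
    Tendsto (fun s : ℝ × ℝ => F s.1 s.2) (𝓝[≠] 0 ×ˢ 𝓝 l₀) (𝓝 (p + l₀ * q)) := by
  have e1 : ∀ᶠ δ : ℝ in 𝓝[≠] 0, δ ≠ 0 ∧ |δ| ≤ 1 := by
    filter_upwards [self_mem_nhdsWithin, nhdsWithin_le_nhds (Metric.closedBall_mem_nhds (0 : ℝ) one_pos)]
      with δ h1 h2
    exact ⟨h1, by simpa [Metric.mem_closedBall, Real.dist_eq] using h2⟩
  have e2 : ∀ᶠ l : ℝ in 𝓝 l₀, |l| ≤ 1 :=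
    (continuous_abs.continuousAt.eventually_lt continuousAt_const hl₀).mono fun l h => h.le
  have h1 : Tendsto (fun s : ℝ × ℝ => F s.1 s.2 - (p + s.2 * q)) (𝓝[≠] 0 ×ˢ 𝓝 l₀) (𝓝 0) := by
    refine squeeze_zero_norm' (a := fun s : ℝ × ℝ => C * |s.1|) ?_ ?_
    · filter_upwards [e1.prod_mk e2] with s hs
      exact h s.1 s.2 hs.1.1 hs.1.2 hs.2
    · have : Tendsto (fun s : ℝ × ℝ => s.1) (𝓝[≠] 0 ×ˢ 𝓝 l₀) (𝓝 0) :=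
        (tendsto_id.mono_left nhdsWithin_le_nhds).comp tendsto_fst
      simpa using this.abs.const_mul C
  have h2 : Tendsto (fun s : ℝ × ℝ => p + s.2 * q) (𝓝[≠] (0 : ℝ) ×ˢ 𝓝 l₀) (𝓝 (p + l₀ * q)) :=
    (tendsto_snd.mul_const q).const_add p
  simpa using h1.add h2

lemma exists_radius {P : ℝ → ℝ → Prop} (h : ∀ᶠ s : ℝ × ℝ in 𝓝[≠] 0 ×ˢ 𝓝 0, P s.1 s.2) :
    ∃ r > 0, ∀ δ l : ℝ, δ ≠ 0 → |δ| < r → |l| < r → P δ l := by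
  rw [eventually_prod_iff] at h
  obtain ⟨p, hp, q, hq, hpq⟩ := h
  rw [eventually_nhdsWithin_iff, Metric.eventually_nhds_iff] at hp
  rw [Metric.eventually_nhds_iff] at hq
  obtain ⟨r, hr, hp⟩ := hp
  obtain ⟨r', hr', hq⟩ := hq
  refine ⟨min r r', lt_min hr hr', fun δ l h0 hδ hl => hpq (hp ?_ h0) (hq ?_)⟩
  · rw [Real.dist_eq, sub_zero]; exact hδ.trans_le (min_le_left _ _)
  · rw [Real.dist_eq, sub_zero]; exact hl.trans_le (min_le_right _ _)

/-- The stable directions at `(δ, l)` and `(-δ, -l)` agree for some small `l`. -/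
lemma exists_stable_crossing (hX : ∀ δ, Continuous (X δ)) (hY : ∀ δ, Continuous (Y δ))
    (hZ : ∀ δ, Continuous (Z δ))
    (bX : ∀ δ l, δ ≠ 0 → |δ| ≤ 1 → |l| ≤ 1 → |X δ l - (b + l * b₀)| ≤ C * |δ|)
    (bY : ∀ δ l, δ ≠ 0 → |δ| ≤ 1 → |l| ≤ 1 → |Y δ l - (c + l * c₀)| ≤ C * |δ|)
    (bZ : ∀ δ l, δ ≠ 0 → |δ| ≤ 1 → |l| ≤ 1 → |Z δ l - (-a + l * -a₀)| ≤ C * |δ|)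
    (hpos : ∀ x y : ℝ, x ≠ 0 ∨ y ≠ 0 → 0 < x ^ 2 * a₀ + 2 * x * y * b₀ + y ^ 2 * c₀)
    (habc : c * a < b ^ 2) {r : ℝ} (hr : 0 < r) :
    ∃ w : ℝ × ℝ, ∃ η > 0, η < r ∧ ∃ δ₀ > 0, ∀ δ : ℝ, 0 < δ → δ < δ₀ →
      (∀ l, |l| ≤ η → 0 < X δ l ^ 2 + Y δ l * Z δ l ∧ 0 < X (-δ) l ^ 2 + Y (-δ) l * Z (-δ) l) ∧
      ∃ l, |l| < η ∧ stable w (X δ l) (Y δ l) (Z δ l) ≠ 0 ∧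
        stable w (X (-δ) (-l)) (Y (-δ) (-l)) (Z (-δ) (-l)) ≠ 0 ∧
        (stable w (X δ l) (Y δ l) (Z δ l)).1 * (stable w (X (-δ) (-l)) (Y (-δ) (-l)) (Z (-δ) (-l))).2
        - (stable w (X δ l) (Y δ l) (Z δ l)).2 *
          (stable w (X (-δ) (-l)) (Y (-δ) (-l)) (Z (-δ) (-l))).1 = 0 := by
  have h0 : 0 < b ^ 2 + c * -a := by linarith
  obtain ⟨w, hw⟩ := exists_stable_ne_zero h0
  have l0 : |(0 : ℝ)| < 1 := by simp
  have tX := tendsto_of_abs_sub_le bX l0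
  have tY := tendsto_of_abs_sub_le bY l0
  have tZ := tendsto_of_abs_sub_le bZ l0
  simp only [zero_mul, add_zero] at tX tY tZ
  obtain ⟨r₁, hr₁, H₁⟩ := exists_radius (P := fun δ l => 0 < X δ l ^ 2 + Y δ l * Z δ l)
    (((tX.pow 2).add (tY.mul tZ)).eventually (lt_mem_nhds h0))
  obtain ⟨r₂, hr₂, H₂⟩ := exists_radius (P := fun δ l => stable w (X δ l) (Y δ l) (Z δ l) ≠ 0)
    ((tendsto_stable w tX tY tZ).eventually (isOpen_ne.mem_nhds hw))
  have cB : Tendsto (fun l : ℝ => b + l * b₀) (𝓝 0) (𝓝 b) := by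
    have : Continuous fun l : ℝ => b + l * b₀ := by fun_prop
    simpa using this.tendsto 0
  have cC : Tendsto (fun l : ℝ => c + l * c₀) (𝓝 0) (𝓝 c) := by
    have : Continuous fun l : ℝ => c + l * c₀ := by fun_prop
    simpa using this.tendsto 0
  have cA : Tendsto (fun l : ℝ => -(a + l * a₀)) (𝓝 0) (𝓝 (-a)) := by
    have : Continuous fun l : ℝ => -(a + l * a₀) := by fun_prop
    simpa using this.tendsto 0
  have ev := (((cB.pow 2).add (cC.mul cA)).eventually (lt_mem_nhds h0)).and
    ((tendsto_stable w cB cC cA).eventually (isOpen_ne.mem_nhds hw))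
  obtain ⟨r₃, hr₃, H₃⟩ := Metric.eventually_nhds_iff.1 ev
  -- Strictly below every radius, so that both endpoints `±η` are admissible; the bound `1` is the
  -- range of the expansion.
  set η := min (min r₁ r₂) (min (min r₃ r) 1) / 2 with hη
  have hm : 0 < min (min r₁ r₂) (min (min r₃ r) 1) := by positivity
  have hη0 : 0 < η := by positivity
  have hηm : η < min (min r₁ r₂) (min (min r₃ r) 1) := half_lt_self hm
  simp only [lt_min_iff] at hηm
  obtain ⟨⟨hη1, hη2⟩, ⟨hη3, hηr⟩, hη4⟩ := hηm
  have hηabs : |η| = η := abs_of_pos hη0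
  have lim1 := H₃ (y := η) (by rw [Real.dist_eq, sub_zero, hηabs]; exact hη3)
  have lim2 := H₃ (y := -η) (by rw [Real.dist_eq, sub_zero, abs_neg, hηabs]; exact hη3)
  have hω := stable_det_ne_zero w hpos hη0.ne' lim1.1.le lim2.1.le lim1.2 lim2.2
  set V : ℝ → ℝ → ℝ × ℝ := fun δ l => stable w (X δ l) (Y δ l) (Z δ l) with hV
  set V₁ := stable w (b + η * b₀) (c + η * c₀) (-(a + η * a₀))
  set V₂ := stable w (b + -η * b₀) (c + -η * c₀) (-(a + -η * a₀))
  have tV : ∀ l₀ : ℝ, |l₀| < 1 → Tendsto (fun δ => V δ l₀) (𝓝[≠] 0)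
      (𝓝 (stable w (b + l₀ * b₀) (c + l₀ * c₀) (-(a + l₀ * a₀)))) := fun l₀ hl₀ => by
    have hz : -a + l₀ * -a₀ = -(a + l₀ * a₀) := by ring
    have hmap : Tendsto (fun δ : ℝ => (δ, l₀)) (𝓝[≠] 0) (𝓝[≠] 0 ×ˢ 𝓝 l₀) :=
      tendsto_id.prodMk tendsto_const_nhds
    have := tendsto_stable w ((tendsto_of_abs_sub_le bX hl₀).comp hmap)
      ((tendsto_of_abs_sub_le bY hl₀).comp hmap) ((tendsto_of_abs_sub_le bZ hl₀).comp hmap)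
    rw [hz] at this
    exact this
  have t1 := tV η (by rw [hηabs]; exact hη4)
  have t2 := tV (-η) (by rw [abs_neg, hηabs]; exact hη4)
  have hneg : Tendsto (fun δ : ℝ => -δ) (𝓝[≠] 0) (𝓝[≠] 0) := by
    refine tendsto_nhdsWithin_of_tendsto_nhds_of_eventually_within _ ?_ ?_
    · have : Tendsto (fun δ : ℝ => -δ) (𝓝 0) (𝓝 (-0)) := continuous_neg.tendsto 0
      rw [neg_zero] at this
      exact this.mono_left nhdsWithin_le_nhds
    · filter_upwards [self_mem_nhdsWithin] with δ hδ
      exact neg_ne_zero.2 hδ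
  have t3 := t1.comp hneg
  have t4 := t2.comp hneg
  set f : ℝ → ℝ → ℝ := fun δ l => (V δ l).1 * (V (-δ) (-l)).2 - (V δ l).2 * (V (-δ) (-l)).1 with hf
  have fst : ∀ {F : ℝ → ℝ × ℝ} {v : ℝ × ℝ}, Tendsto F (𝓝[≠] 0) (𝓝 v) →
      Tendsto (fun δ => (F δ).1) (𝓝[≠] 0) (𝓝 v.1) := fun h => (continuous_fst.tendsto _).comp h
  have snd : ∀ {F : ℝ → ℝ × ℝ} {v : ℝ × ℝ}, Tendsto F (𝓝[≠] 0) (𝓝 v) →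
      Tendsto (fun δ => (F δ).2) (𝓝[≠] 0) (𝓝 v.2) := fun h => (continuous_snd.tendsto _).comp h
  -- Passing from `η` to `-η` exchanges the two limiting directions, so the limit of the product is
  -- minus the square of a nonzero determinant.
  have tf : Tendsto (fun δ => f δ η * f δ (-η)) (𝓝[≠] 0)
      (𝓝 ((V₁.1 * V₂.2 - V₁.2 * V₂.1) * (V₂.1 * V₁.2 - V₂.2 * V₁.1))) := by
    have s1 := ((fst t1).mul (snd t4)).sub ((snd t1).mul (fst t4))
    have s2 := ((fst t2).mul (snd t3)).sub ((snd t2).mul (fst t3))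
    refine (s1.mul s2).congr fun δ => ?_
    simp only [hf, Function.comp_apply, neg_neg]
  have hlt : (V₁.1 * V₂.2 - V₁.2 * V₂.1) * (V₂.1 * V₁.2 - V₂.2 * V₁.1) < 0 := by
    have := mul_self_pos.2 hω
    nlinarith
  have evf := tf.eventually (gt_mem_nhds hlt)
  rw [eventually_nhdsWithin_iff, Metric.eventually_nhds_iff] at evf
  obtain ⟨r₄, hr₄, H₄⟩ := evf
  refine ⟨w, η, hη0, hηr, min (min r₁ r₂) r₄, by positivity, fun δ hδ hδlt => ?_⟩
  simp only [lt_min_iff] at hδlt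
  obtain ⟨⟨hδ1, hδ2⟩, hδ4⟩ := hδlt
  have hδabs : |δ| = δ := abs_of_pos hδ
  refine ⟨fun l hl => ⟨H₁ δ l hδ.ne' (by rwa [hδabs]) (hl.trans_lt hη1),
    H₁ (-δ) l (neg_ne_zero.2 hδ.ne') (by rwa [abs_neg, hδabs]) (hl.trans_lt hη1)⟩, ?_⟩
  have hprod := H₄ (y := δ) (by rw [Real.dist_eq, sub_zero, hδabs]; exact hδ4) hδ.ne'
  have hfc : Continuous (f δ) := by
    have hVc : ∀ δ, Continuous (V δ) := fun δ => continuous_iff_continuousAt.2 fun l =>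
      tendsto_stable w (hX δ).continuousAt (hY δ).continuousAt (hZ δ).continuousAt
    have h1 := hVc δ
    have h2 : Continuous fun l => V (-δ) (-l) := (hVc (-δ)).comp continuous_neg
    exact (h1.fst.mul h2.snd).sub (h1.snd.mul h2.fst)
  have hroot : ∃ l ∈ Icc (-η) η, f δ l = 0 := by
    rcases mul_neg_iff.1 hprod with ⟨hp, hn⟩ | ⟨hn, hp⟩
    · exact intermediate_value_Icc (by linarith) hfc.continuousOn ⟨hn.le, hp.le⟩
    · exact intermediate_value_Icc' (by linarith) hfc.continuousOn ⟨hn.le, hp.le⟩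
  obtain ⟨l, hl, hl0⟩ := hroot
  have hlt' : |l| < η := by
    rw [abs_lt]
    constructor
    · refine lt_of_le_of_ne hl.1 fun h => ?_
      rw [← h] at hl0
      rw [hl0, mul_zero] at hprod
      exact lt_irrefl _ hprod
    · refine lt_of_le_of_ne hl.2 fun h => ?_
      rw [h] at hl0
      rw [hl0, zero_mul] at hprod
      exact lt_irrefl _ hprod
  exact ⟨l, hlt', H₂ δ l hδ.ne' (by rwa [hδabs]) (hlt'.trans hη2),
    H₂ (-δ) (-l) (neg_ne_zero.2 hδ.ne') (by rwa [abs_neg, hδabs]) (by rw [abs_neg]; exact hlt'.trans hη2),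
    hl0⟩

end Crossing

end Photonic

/-! ### Exponential decay and gluing at the interface. -/

namespace Photonic

variable {μ ε : ℝ → ℝ} {E : ℝ}

/-- A solution whose data are an eigenvector of the monodromy matrix is exponentially bounded. -/
lemma exists_abs_le_exp (hμ : IsProfile μ) (hε : IsProfile ε) {e₁ e₂ τ : ℝ} (hτ : 0 < |τ|)
    (h1 : colU₁ μ ε E 1 * e₁ + colV₁ μ ε E 1 * e₂ = τ * e₁)
    (h2 : colU₂ μ ε E 1 * e₁ + colV₂ μ ε E 1 * e₂ = τ * e₂) :
    ∃ C : ℝ, ∀ x, |e₁ * colU₁ μ ε E x + e₂ * colV₁ μ ε E x| ≤ C * Real.exp (Real.log |τ| * x) := by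
  have hf := isFundamental_col E hμ hε
  have hcont := (hf.u.comb hf.v e₁ e₂).left.continuous
  set ψ := fun x => e₁ * colU₁ μ ε E x + e₂ * colV₁ μ ε E x with hψ
  have hshift : ∀ x, ψ (x + 1) = τ * ψ x := fun x => by
    obtain ⟨⟨s1, -⟩, s2, -⟩ := hf.shift hμ.periodic (fun x => by rw [hε.periodic]) x
    simp only [hψ, s1, s2]
    linear_combination colU₁ μ ε E x * h1 + colV₁ μ ε E x * h2
  -- Dividing by the Floquet growth leaves a continuous periodic function, hence a bounded one.
  set g := fun x => |ψ x| * Real.exp (-(Real.log |τ| * x)) with hg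
  have hper : Function.Periodic g 1 := fun x => by
    simp only [hg, hshift, abs_mul]
    rw [mul_add, mul_one, neg_add, Real.exp_add, Real.exp_neg (Real.log |τ|), Real.exp_log hτ]
    field_simp
  have hgc : Continuous g := hcont.abs.mul (by fun_prop)
  obtain ⟨C, hC⟩ := (isCompact_Icc (a := (0 : ℝ)) (b := 1)).exists_bound_of_continuousOn hgc.continuousOn
  refine ⟨C, fun x => ?_⟩
  obtain ⟨y, hy, he⟩ := hper.exists_mem_Ico₀ one_pos x
  have h3 := hC y (Ico_subset_Icc_self hy)
  rw [← he, Real.norm_eq_abs, abs_of_nonneg (by positivity)] at h3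
  calc |ψ x| = g x * Real.exp (Real.log |τ| * x) := by
        simp only [hg]
        rw [mul_assoc, ← Real.exp_add, neg_add_cancel, Real.exp_zero, mul_one]
    _ ≤ C * Real.exp (Real.log |τ| * x) := by gcongr

lemma memLp_two_of_abs_le_exp {ψ : ℝ → ℂ} (hψ : Continuous ψ) {C C' a a' : ℝ} (ha : a < 0) (ha' : 0 < a')
    (h : ∀ x, 0 ≤ x → ‖ψ x‖ ≤ C * Real.exp (a * x)) (h' : ∀ x, x < 0 → ‖ψ x‖ ≤ C' * Real.exp (a' * x)) :
    MemLp ψ 2 volume := by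
  rw [memLp_two_iff_integrable_sq_norm hψ.aestronglyMeasurable]
  have hc : Continuous fun x => ‖ψ x‖ ^ 2 := by fun_prop
  rw [← integrableOn_univ, ← Iic_union_Ioi (a := (0 : ℝ))]
  have hsq : ∀ (C a x : ℝ), (C * Real.exp (a * x)) ^ 2 = C ^ 2 * Real.exp (2 * a * x) := fun C a x => by
    rw [mul_pow, sq (Real.exp _), ← Real.exp_add]
    ring_nf
  have hC0 : ∀ x, 0 ≤ x → ‖ψ x‖ ^ 2 ≤ C ^ 2 * Real.exp (2 * a * x) := fun x hx => by
    rw [← hsq]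
    exact pow_le_pow_left₀ (norm_nonneg _) (h x hx) 2
  have hC' : ∀ x, x < 0 → ‖ψ x‖ ^ 2 ≤ C' ^ 2 * Real.exp (2 * a' * x) := fun x hx => by
    rw [← hsq]
    exact pow_le_pow_left₀ (norm_nonneg _) (h' x hx) 2
  refine IntegrableOn.union ?_ ?_
  · rw [integrableOn_Iic_iff_integrableOn_Iio]
    refine Integrable.mono' (((integrableOn_exp_mul_Iic (by linarith : 0 < 2 * a') 0).mono_set
      Iio_subset_Iic_self).const_mul (C' ^ 2)) hc.aestronglyMeasurable
      ((ae_restrict_iff' measurableSet_Iio).2 (Eventually.of_forall fun x hx => ?_))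
    rw [Real.norm_eq_abs, abs_of_nonneg (sq_nonneg _)]
    exact hC' x hx
  · refine Integrable.mono' ((integrableOn_exp_mul_Ioi (by linarith : 2 * a < 0) 0).const_mul (C ^ 2))
      hc.aestronglyMeasurable
      ((ae_restrict_iff' measurableSet_Ioi).2 (Eventually.of_forall fun x hx => ?_))
    rw [Real.norm_eq_abs, abs_of_nonneg (sq_nonneg _)]
    exact hC0 x (le_of_lt hx)

/-- Gluing of solutions at `0`. -/
lemma IsSolution.glue {μ' ε' ψ p ψ' p' : ℝ → ℝ} (h : IsSolution μ' ε' E ψ' p')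
    (k : IsSolution μ ε E ψ p) (hψ : ψ' 0 = ψ 0) (hp : p' 0 = p 0) :
    IsSolution (fun x => if x < 0 then μ' x else μ x) (fun x => if x < 0 then ε' x else ε x) E
      (fun x => if x < 0 then ψ' x else ψ x) (fun x => if x < 0 then p' x else p x) := by
  have hne : ∀ᵐ t : ℝ, t ≠ 0 := by simp [ae_iff]
  have neg : ∀ {f g F G : ℝ → ℝ} {x : ℝ}, x < 0 → ∀ᵐ t : ℝ, t ∈ uIoc 0 x →
      (if t < 0 then f t else g t) • (if t < 0 then F t else G t) = f t • F t := by
    intro f g F G x hx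
    filter_upwards [hne] with t ht htx
    rw [uIoc_of_ge hx.le] at htx
    have : t < 0 := lt_of_le_of_ne htx.2 ht
    simp only [this, if_true]
  have pos : ∀ {f g F G : ℝ → ℝ} {x : ℝ}, ¬x < 0 → ∀ᵐ t : ℝ, t ∈ uIoc 0 x →
      (if t < 0 then f t else g t) • (if t < 0 then F t else G t) = g t • G t := by
    intro f g F G x hx
    filter_upwards with t htx
    rw [uIoc_of_le (not_lt.1 hx)] at htx
    have : ¬t < 0 := not_lt.2 htx.1.le
    simp only [this, if_false]
  have integ : ∀ {f g F G : ℝ → ℝ}, (∀ x, IntervalIntegrable (fun t => f t • F t) volume 0 x) →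
      (∀ x, IntervalIntegrable (fun t => g t • G t) volume 0 x) → ∀ x, IntervalIntegrable
        (fun t => (if t < 0 then f t else g t) • (if t < 0 then F t else G t)) volume 0 x := by
    intro f g F G h1 h2 x
    by_cases hx : x < 0
    · refine (h1 x).congr_ae ((ae_restrict_iff' measurableSet_uIoc).2 ?_)
      filter_upwards [neg (f := f) (g := g) (F := F) (G := G) hx] with t ht hm
      exact (ht hm).symm
    · refine (h2 x).congr_ae ((ae_restrict_iff' measurableSet_uIoc).2 ?_)
      filter_upwards [pos (f := f) (g := g) (F := F) (G := G) hx] with t ht hm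
      exact (ht hm).symm
  refine ⟨integ h.integrable_left k.integrable_left, integ h.integrable_right k.integrable_right,
    fun x => ?_, fun x => ?_⟩
  · by_cases hx : x < 0
    · rw [intervalIntegral.integral_congr_ae (neg hx)]
      simp only [hx, if_true, lt_irrefl, if_false]
      rw [← hψ]
      exact h.eq_left x
    · rw [intervalIntegral.integral_congr_ae (pos hx)]
      simp only [hx, lt_irrefl, if_false]
      exact k.eq_left x
  · by_cases hx : x < 0
    · rw [intervalIntegral.integral_congr_ae (neg hx)]
      simp only [hx, if_true, lt_irrefl, if_false]
      rw [← hp]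
      exact h.eq_right x
    · rw [intervalIntegral.integral_congr_ae (pos hx)]
      simp only [hx, lt_irrefl, if_false]
      exact k.eq_right x

/-- An interface mode from a common direction that decays on both sides. -/
lemma exists_interfaceMode {μ' ε' : ℝ → ℝ} (hμ : IsCoefficient μ) (hε : IsCoefficient ε) (hμ' : IsProfile μ')
    (hε' : IsProfile ε') {e₁ e₂ τ τ' : ℝ} (he : e₁ ≠ 0 ∨ e₂ ≠ 0) (hτ : 0 < |τ|) (hτ1 : |τ| < 1)
    (hτ' : 1 < |τ'|)
    (h1 : colU₁ μ ε E 1 * e₁ + colV₁ μ ε E 1 * e₂ = τ * e₁)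
    (h2 : colU₂ μ ε E 1 * e₁ + colV₂ μ ε E 1 * e₂ = τ * e₂)
    (h1' : colU₁ μ' ε' E 1 * e₁ + colV₁ μ' ε' E 1 * e₂ = τ' * e₁)
    (h2' : colU₂ μ' ε' E 1 * e₁ + colV₂ μ' ε' E 1 * e₂ = τ' * e₂) :
    ∃ ψ : ℝ → ℂ, IsInterfaceMode (fun x => if x < 0 then μ' x else μ x)
      (fun x => if x < 0 then ε' x else ε x) E ψ := by
  have hf := isFundamental_col E hμ.toIsProfile hε.toIsProfile
  have hf' := isFundamental_col E hμ' hε'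
  have F := hf.u.comb hf.v e₁ e₂
  have F' := hf'.u.comb hf'.v e₁ e₂
  obtain ⟨C, hC⟩ := exists_abs_le_exp hμ.toIsProfile hε.toIsProfile hτ h1 h2
  obtain ⟨C', hC'⟩ := exists_abs_le_exp hμ' hε' (one_pos.trans hτ') h1' h2'
  set ψ := fun x => e₁ * colU₁ μ ε E x + e₂ * colV₁ μ ε E x with hψ
  set p := fun x => e₁ * colU₂ μ ε E x + e₂ * colV₂ μ ε E x with hp
  set ψ' := fun x => e₁ * colU₁ μ' ε' E x + e₂ * colV₁ μ' ε' E x with hψ'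
  set p' := fun x => e₁ * colU₂ μ' ε' E x + e₂ * colV₂ μ' ε' E x with hp'
  have z1 : ψ 0 = e₁ := by simp [hψ, hf.u₁_zero, hf.v₁_zero]
  have z2 : p 0 = e₂ := by simp [hp, hf.u₂_zero, hf.v₂_zero]
  have z3 : ψ' 0 = e₁ := by simp [hψ', hf'.u₁_zero, hf'.v₁_zero]
  have z4 : p' 0 = e₂ := by simp [hp', hf'.u₂_zero, hf'.v₂_zero]
  have G := (F'.isSolution hμ'.isTame hε'.isTame).glue (F.isSolution hμ.isTame hε.isTame)
    (by rw [z1, z3]) (by rw [z2, z4])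
  have hcont : Continuous fun x => if x < 0 then ψ' x else ψ x := by
    refine continuous_if' ?_ ?_ F'.left.continuous.continuousOn F.left.continuous.continuousOn
    · intro a ha
      have ha0 : a = 0 := by
        have : a ∈ frontier (Iio (0 : ℝ)) := ha
        rwa [frontier_Iio, mem_singleton_iff] at this
      subst ha0
      have := F'.left.continuous.tendsto 0
      simp only [lt_irrefl, if_false]
      rw [z1]
      rw [z3] at this
      exact this.mono_left nhdsWithin_le_nhds
    · intro a ha
      have ha0 : a = 0 := by
        have : a ∈ frontier (Iio (0 : ℝ)) := ha
        rwa [frontier_Iio, mem_singleton_iff] at this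
      subst ha0
      simp only [lt_irrefl, if_false]
      exact (F.left.continuous.tendsto 0).mono_left nhdsWithin_le_nhds
  refine ⟨fun x => ((if x < 0 then ψ' x else ψ x : ℝ) : ℂ), fun h0 => ?_, ?_, _, G.ofReal⟩
  -- Nontrivial data could have `e₁ = 0`; then the right half is a nonzero multiple of `v₁`, which
  -- is excluded by `weightVV_pos`.
  · have hpos : ∀ x, 0 ≤ x → ψ x = 0 := fun x hx => by
      have := congrFun h0 x
      simpa [not_lt.2 hx] using this
    have he1 : e₁ = 0 := by rw [← z1]; exact hpos 0 le_rfl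
    have he2 : e₂ ≠ 0 := he.resolve_left fun h => h he1
    have hv : ∀ x, 0 ≤ x → colV₁ μ ε E x = 0 := fun x hx => by
      have := hpos x hx
      simpa [hψ, he1, he2] using this
    have hw : weightVV μ ε E = 0 := by
      unfold weightVV
      rw [intervalIntegral.integral_congr (g := fun _ => (0 : ℝ)) fun x hx => ?_]
      · simp
      · rw [uIcc_of_le zero_le_one] at hx
        simp [hv x hx.1]
    exact (weightVV_pos hμ hε E).ne' hw
  · refine memLp_two_of_abs_le_exp (Complex.continuous_ofReal.comp hcont) (C := C) (C' := C')
      (Real.log_neg hτ hτ1) (Real.log_pos hτ') (fun x hx => ?_) fun x hx => ?_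
    · rw [Complex.norm_real, if_neg (not_lt.2 hx)]
      exact hC x
    · rw [Complex.norm_real, if_pos hx]
      exact hC' x

end Photonic

/-! ### Uniformity near the Dirac point, and the multipliers. -/

namespace Photonic

variable {μ ε μ₁ ε₁ : ℝ → ℝ}

/-- Near an energy of maximal trace at the `(m + 1)`-st Dirichlet level the structure keeps its
positivity, the sign of its discriminant and its rotation range. -/
lemma exists_uniform_radius (hμ : IsCoefficient μ) (hε : IsCoefficient ε) (hμ₁ : IsProfile μ₁)
    (hε₁ : IsProfile ε₁) {m : ℕ} {E₀ : ℝ} (hE₀ : 0 < E₀)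
    (hD : 0 < (-1) ^ (m + 1) * disc μ ε E₀) (hR : rotation μ ε E₀ = (m + 1 : ℕ) * Real.pi) :
    ∃ r > 0, ∀ δ, |δ| < r → IsCoefficient (perturbed μ μ₁ δ) ∧ IsCoefficient (perturbed ε ε₁ δ) ∧
      ∀ E, |E - E₀| < r → 0 < E ∧
        0 < (-1) ^ (m + 1) * disc (perturbed μ μ₁ δ) (perturbed ε ε₁ δ) E ∧
        m * Real.pi < rotation (perturbed μ μ₁ δ) (perturbed ε ε₁ δ) E ∧
        rotation (perturbed μ μ₁ δ) (perturbed ε ε₁ δ) E < (m + 2 : ℕ) * Real.pi := by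
  obtain ⟨r₁, hr₁, h₁⟩ := hμ.exists_perturbed hμ₁
  obtain ⟨r₂, hr₂, h₂⟩ := hε.exists_perturbed hε₁
  have hrot := continuous_rotation hμ.toIsProfile hε.toIsProfile hμ₁ hε₁
  have one_mem : (1 : ℝ) ∈ Icc (0 : ℝ) 1 := by simp
  have hdisc : Continuous fun s : ℝ × ℝ =>
      (-1) ^ (m + 1) * disc (perturbed μ μ₁ s.1) (perturbed ε ε₁ s.1) s.2 :=
    ((continuous_colU₁ hμ.toIsProfile hε.toIsProfile hμ₁ hε₁ one_mem).add
      (continuous_colV₂ hμ.toIsProfile hε.toIsProfile hμ₁ hε₁ one_mem)).const_mul _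
  have hpi := Real.pi_pos
  have ev : ∀ᶠ s : ℝ × ℝ in 𝓝 (0, E₀), 0 < s.2 ∧
      0 < (-1) ^ (m + 1) * disc (perturbed μ μ₁ s.1) (perturbed ε ε₁ s.1) s.2 ∧
      m * Real.pi < rotation (perturbed μ μ₁ s.1) (perturbed ε ε₁ s.1) s.2 ∧
      rotation (perturbed μ μ₁ s.1) (perturbed ε ε₁ s.1) s.2 < (m + 2 : ℕ) * Real.pi := by
    refine (continuous_snd.continuousAt.eventually_const_lt ?_).and
      ((hdisc.continuousAt.eventually_const_lt ?_).and
        ((hrot.continuousAt.eventually_const_lt ?_).and (hrot.continuousAt.eventually_lt_const ?_)))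
    · exact hE₀
    · simpa only [perturbed_zero] using hD
    · simp only [perturbed_zero, hR]
      push_cast
      nlinarith
    · simp only [perturbed_zero, hR]
      push_cast
      nlinarith
  obtain ⟨r₃, hr₃, h₃⟩ := Metric.eventually_nhds_iff.1 ev
  refine ⟨min r₃ (min r₁ r₂), by positivity, fun δ hδ => ?_⟩
  obtain ⟨hδ3, hδ1, hδ2⟩ := lt_min_iff.1 hδ |>.imp_right lt_min_iff.1
  refine ⟨h₁ δ hδ1, h₂ δ hδ2, fun E hE => h₃ (y := (δ, E)) ?_⟩
  rw [Prod.dist_eq, max_lt_iff, Real.dist_eq, Real.dist_eq, sub_zero]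
  exact ⟨hδ3, hE.trans_le (min_le_left _ _)⟩

lemma abs_div_sub_le {p q C δ : ℝ} (hδ : δ ≠ 0) (h : |p - δ * q| ≤ C * δ ^ 2) :
    |p / δ - q| ≤ C * |δ| := by
  have h0 := abs_pos.2 hδ
  rw [show p / δ - q = (p - δ * q) / δ by field_simp, abs_div, div_le_iff₀ h0]
  calc _ ≤ C * δ ^ 2 := h
    _ = C * |δ| * |δ| := by rw [← sq_abs]; ring

/-- With `τ` half the signed trace and `x = δ κ`, the multipliers are `s (τ ± x)` and their product
is one. -/
lemma abs_multiplier {s τ x : ℝ} (hs : s * s = 1) (hτ : 1 < τ) (hx : 0 < x) (h : τ ^ 2 - x ^ 2 = 1) :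
    0 < |s * (τ - x)| ∧ |s * (τ - x)| < 1 ∧ 1 < |s * (τ + x)| := by
  have hs' : |s| = 1 := by
    have := abs_mul_abs_self s
    rw [hs] at this
    nlinarith [abs_nonneg s]
  have h1 : (τ - x) * (τ + x) = 1 := by linarith
  have h2 : 0 < τ - x := by nlinarith
  rw [abs_mul, abs_mul, hs', one_mul, one_mul, abs_of_pos h2, abs_of_pos (by linarith : 0 < τ + x)]
  exact ⟨h2, by nlinarith, by linarith⟩

/-- The eigenvector of the monodromy matrix in terms of its rescaled trace-free part. -/
lemma monodromy_eigen {U₁ U₂ V₁ V₂ s δ κ : ℝ} {v : ℝ × ℝ} (hs : s * s = 1) (hδ : δ ≠ 0)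
    (h : s * (U₁ - V₂) / 2 / δ * v.1 + s * V₁ / δ * v.2 = -κ * v.1 ∧
      s * U₂ / δ * v.1 - s * (U₁ - V₂) / 2 / δ * v.2 = -κ * v.2) :
    U₁ * v.1 + V₁ * v.2 = s * (s * (U₁ + V₂) / 2 - δ * κ) * v.1 ∧
      U₂ * v.1 + V₂ * v.2 = s * (s * (U₁ + V₂) / 2 - δ * κ) * v.2 := by
  obtain ⟨h1, h2⟩ := h
  field_simp at h1 h2
  constructor
  · linear_combination s / 2 * h1 + (-(U₁ * v.1) / 2 + V₂ * v.1 / 2 - V₁ * v.2 -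
      (U₁ + V₂) * v.1 / 2) * hs
  · linear_combination s / 2 * h2 + (-(U₂ * v.1) + (U₁ - V₂) * v.2 / 2 - (U₁ + V₂) * v.2 / 2) * hs

end Photonic

/-! ### The interface mode in the common gap. -/

theorem mainTheorem6 (μ ε μ₁ ε₁ : ℝ → ℝ)
    (hμ : Photonic.IsCoefficient μ) (hε : Photonic.IsCoefficient ε)
    (hμ₁ : Photonic.IsProfile μ₁) (hε₁ : Photonic.IsProfile ε₁)
    (j : ℕ) (kStar EStar : ℝ) (hk : kStar = 0 ∨ kStar = Real.pi)
    (hDirac : Photonic.IsDiracPoint μ ε j kStar EStar)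
    (hpert : Photonic.PerturbationCondition μ ε μ₁ ε₁ EStar) :
    ∃ δ₀ > 0, ∃ C > 0, ∀ δ : ℝ, 0 < δ → δ < δ₀ →
      ∃ E : ℝ,
        E ∈ Set.Ioo
            (Photonic.bandMax (Photonic.perturbed μ μ₁ δ) (Photonic.perturbed ε ε₁ δ) j)
            (Photonic.bandMin (Photonic.perturbed μ μ₁ δ) (Photonic.perturbed ε ε₁ δ) (j + 1)) ∩
          Set.Ioo
            (Photonic.bandMax (Photonic.perturbed μ μ₁ (-δ)) (Photonic.perturbed ε ε₁ (-δ)) j)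
            (Photonic.bandMin (Photonic.perturbed μ μ₁ (-δ)) (Photonic.perturbed ε ε₁ (-δ))
              (j + 1)) ∧
        |E - EStar| ≤ C * δ ∧
        ∃ ψ : ℝ → ℂ,
          Photonic.IsInterfaceMode (Photonic.joint μ μ₁ δ) (Photonic.joint ε ε₁ δ) E ψ := by
  open Photonic in
  obtain ⟨m, rfl⟩ : ∃ m, j = m + 1 := ⟨j - 1, by have := hDirac.one_le; omega⟩
  obtain ⟨hE, hrot, hv₁, hu₂, hu₁, hv₂⟩ := hDirac.monodromy hμ hε
  have habc := hpert.forms hμ.toIsProfile hε.toIsProfile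
  have hs := neg_one_pow_mul_self (m + 1)
  have hD : 0 < (-1) ^ (m + 1) * disc μ ε EStar := by
    rw [disc, hu₁, hv₂, mul_add, hs]
    norm_num
  obtain ⟨r, hr, hrad⟩ := exists_uniform_radius hμ hε hμ₁ hε₁ hE hD hrot
  obtain ⟨C, hC⟩ := exists_monodromy_expansion hμ.toIsProfile hε.toIsProfile hμ₁ hε₁ hs hv₁ hu₂ hu₁ hv₂
  set s : ℝ := (-1) ^ (m + 1) with hsdef
  set a := perturbForm μ₁ ε₁ EStar (colU₁ μ ε EStar) (colU₂ μ ε EStar) (colU₁ μ ε EStar) (colU₂ μ ε EStar)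
  set b := perturbForm μ₁ ε₁ EStar (colU₁ μ ε EStar) (colU₂ μ ε EStar) (colV₁ μ ε EStar) (colV₂ μ ε EStar)
  set c := perturbForm μ₁ ε₁ EStar (colV₁ μ ε EStar) (colV₂ μ ε EStar) (colV₁ μ ε EStar) (colV₂ μ ε EStar)
  let U₁ : ℝ → ℝ → ℝ := fun δ l => colU₁ (perturbed μ μ₁ δ) (perturbed ε ε₁ δ) (EStar + δ * l) 1
  let U₂ : ℝ → ℝ → ℝ := fun δ l => colU₂ (perturbed μ μ₁ δ) (perturbed ε ε₁ δ) (EStar + δ * l) 1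
  let V₁ : ℝ → ℝ → ℝ := fun δ l => colV₁ (perturbed μ μ₁ δ) (perturbed ε ε₁ δ) (EStar + δ * l) 1
  let V₂ : ℝ → ℝ → ℝ := fun δ l => colV₂ (perturbed μ μ₁ δ) (perturbed ε ε₁ δ) (EStar + δ * l) 1
  -- `X`, `Y`, `Z` are the entries of the trace-free part of `s M`, divided by `δ`; they have finite
  -- limits as `δ → 0`.
  let X : ℝ → ℝ → ℝ := fun δ l => s * (U₁ δ l - V₂ δ l) / 2 / δ
  let Y : ℝ → ℝ → ℝ := fun δ l => s * V₁ δ l / δ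
  let Z : ℝ → ℝ → ℝ := fun δ l => s * U₂ δ l / δ
  have one_mem : (1 : ℝ) ∈ Icc (0 : ℝ) 1 := by simp
  have line : ∀ δ, Continuous fun l : ℝ => (δ, EStar + δ * l) := fun δ => by fun_prop
  have cU₁ : ∀ δ, Continuous (U₁ δ) := fun δ =>
    (continuous_colU₁ hμ.toIsProfile hε.toIsProfile hμ₁ hε₁ one_mem).comp (line δ)
  have cU₂ : ∀ δ, Continuous (U₂ δ) := fun δ =>
    (continuous_colU₂ hμ.toIsProfile hε.toIsProfile hμ₁ hε₁ one_mem).comp (line δ)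
  have cV₁ : ∀ δ, Continuous (V₁ δ) := fun δ =>
    (continuous_colV₁ hμ.toIsProfile hε.toIsProfile hμ₁ hε₁ one_mem).comp (line δ)
  have cV₂ : ∀ δ, Continuous (V₂ δ) := fun δ =>
    (continuous_colV₂ hμ.toIsProfile hε.toIsProfile hμ₁ hε₁ one_mem).comp (line δ)
  obtain ⟨w, η, hη, -, δ₁, hδ₁, hcross⟩ := exists_stable_crossing (X := X) (Y := Y) (Z := Z) (C := C)
    (fun δ => (((cU₁ δ).sub (cV₂ δ)).const_mul s).div_const 2 |>.div_const δ)
    (fun δ => ((cV₁ δ).const_mul s).div_const δ) (fun δ => ((cU₂ δ).const_mul s).div_const δ)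
    (b := b) (b₀ := weightUV μ ε EStar) (c := c) (c₀ := weightVV μ ε EStar) (a := a)
    (a₀ := weightUU μ ε EStar)
    (fun δ l h0 h1 h2 => abs_div_sub_le h0 (by
      obtain ⟨⟨e1, -⟩, -, e4⟩ := hC δ l h1 h2
      rw [abs_le] at e1 e4 ⊢
      simp only [U₁, V₂]
      constructor <;> linarith [e1.1, e1.2, e4.1, e4.2]))
    (fun δ l h0 h1 h2 => abs_div_sub_le h0 (hC δ l h1 h2).2.1)
    (fun δ l h0 h1 h2 => abs_div_sub_le h0 (by
      convert (hC δ l h1 h2).1.2 using 2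
      ring))
    (fun x y hxy => weight_pos hμ hε EStar hxy) habc one_pos
  -- Determinant one: the square of half the trace minus `(δ κ)²`, with `κ²` the radicand.
  have sq : ∀ δ l, δ ≠ 0 → (s * disc (perturbed μ μ₁ δ) (perturbed ε ε₁ δ) (EStar + δ * l) / 2) ^ 2 -
      δ ^ 2 * (X δ l ^ 2 + Y δ l * Z δ l) = 1 := fun δ l h0 => by
    have h := disc_sq_sub_four (hμ.toIsProfile.perturbed hμ₁ δ) (hε.toIsProfile.perturbed hε₁ δ)
      (EStar + δ * l)
    have h1 : δ ^ 2 * (X δ l ^ 2 + Y δ l * Z δ l) =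
        s * s * ((U₁ δ l - V₂ δ l) ^ 2 / 4 + V₁ δ l * U₂ δ l) := by
      simp only [X, Y, Z]
      field_simp
      ring
    rw [h1, hs, one_mul]
    simp only [U₁, U₂, V₁, V₂]
    rw [div_pow, mul_pow, pow_two s, hs]
    linarith
  -- the trace exceeds two wherever the radicand is positive
  have trace : ∀ δ l, δ ≠ 0 → 0 < s * disc (perturbed μ μ₁ δ) (perturbed ε ε₁ δ) (EStar + δ * l) →
      0 < X δ l ^ 2 + Y δ l * Z δ l →
      1 < s * disc (perturbed μ μ₁ δ) (perturbed ε ε₁ δ) (EStar + δ * l) / 2 := fun δ l h0 h1 h2 => by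
    have := sq δ l h0
    have h3 : 0 < δ ^ 2 * (X δ l ^ 2 + Y δ l * Z δ l) := by positivity
    nlinarith
  -- The last bound gives `η δ < r`, which keeps the energy window in the uniform neighbourhood; `η`
  -- itself serves as the constant `C`.
  refine ⟨min δ₁ (min r (r / (2 * η))), by positivity, η, hη, fun δ hδ hδ' => ?_⟩
  obtain ⟨hδ1, hδr, hδη⟩ := lt_min_iff.1 hδ' |>.imp_right lt_min_iff.1
  rw [lt_div_iff₀ (by positivity)] at hδη
  obtain ⟨hpos, l, hl, hw, hw', hdet⟩ := hcross δ hδ hδ1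
  have hηδ : 0 < η * δ := by positivity
  have near : ∀ E ∈ Icc (EStar - η * δ) (EStar + η * δ), |E - EStar| < r := fun E hE =>
    (abs_le.2 ⟨by linarith [hE.1], by linarith [hE.2]⟩ : |E - EStar| ≤ η * δ).trans_lt (by linarith)
  obtain ⟨pμ, pε, pE⟩ := hrad δ (by rwa [abs_of_pos hδ])
  obtain ⟨nμ, nε, nE⟩ := hrad (-δ) (by rwa [abs_neg, abs_of_pos hδ])
  have hleft : EStar - η * δ ∈ Icc (EStar - η * δ) (EStar + η * δ) := ⟨le_rfl, by linarith⟩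
  have hright : EStar + η * δ ∈ Icc (EStar - η * δ) (EStar + η * δ) := ⟨by linarith, le_rfl⟩
  have coord : ∀ E ∈ Icc (EStar - η * δ) (EStar + η * δ), |(E - EStar) / δ| ≤ η := fun E hE => by
    rw [abs_div, abs_of_pos hδ, div_le_iff₀ hδ]
    exact abs_le.2 ⟨by linarith [hE.1], by linarith [hE.2]⟩
  -- The energy `E` has coordinate `l = (E - EStar) / δ`, and for the structure with `-δ` the
  -- opposite coordinate, so the window is a gap for both structures.
  have pgap := bands_separated pμ pε m (pE _ (near _ hleft)).1 (by linarith) (fun E hE => by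
    have h := trace δ ((E - EStar) / δ) hδ.ne'
    rw [mul_div_cancel₀ _ hδ.ne', add_sub_cancel] at h
    have := h (pE E (near E hE)).2.1 (hpos _ (coord E hE)).1
    linarith) (pE _ (near _ hright)).2.2.1 (pE _ (near _ hleft)).2.2.2
  have ngap := bands_separated nμ nε m (nE _ (near _ hleft)).1 (by linarith) (fun E hE => by
    have h := trace (-δ) (-((E - EStar) / δ)) (neg_ne_zero.2 hδ.ne')
    rw [neg_mul_neg, mul_div_cancel₀ _ hδ.ne', add_sub_cancel] at h
    have := h (nE E (near E hE)).2.1 (hpos _ (by rw [abs_neg]; exact coord E hE)).2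
    linarith) (nE _ (near _ hright)).2.2.1 (nE _ (near _ hleft)).2.2.2
  obtain ⟨hl1, hl2⟩ := abs_lt.1 hl
  have hEl : EStar + δ * l ∈ Icc (EStar - η * δ) (EStar + η * δ) := ⟨by nlinarith, by nlinarith⟩
  refine ⟨EStar + δ * l, ⟨⟨pgap.1.trans_lt (by nlinarith), lt_of_lt_of_le (by nlinarith) pgap.2⟩,
    ngap.1.trans_lt (by nlinarith), lt_of_lt_of_le (by nlinarith) ngap.2⟩, ?_, ?_⟩
  · rw [add_sub_cancel_left, abs_mul, abs_of_pos hδ, mul_comm]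
    exact mul_le_mul_of_nonneg_right hl.le hδ.le
  obtain ⟨hpl, -⟩ := hpos l hl.le
  obtain ⟨-, hnl⟩ := hpos (-l) (by rw [abs_neg]; exact hl.le)
  -- The two stable directions are proportional, so one set of data at the interface is an
  -- eigenvector of both monodromy matrices.
  obtain ⟨t, ht, t1, t2⟩ := exists_smul_of_det_eq_zero hw hw' hdet
  have eig := monodromy_eigen hs hδ.ne' (stable_eigen w hpl.le)
  have eig' := monodromy_eigen (κ := √(X (-δ) (-l) ^ 2 + Y (-δ) (-l) * Z (-δ) (-l))) hs (neg_ne_zero.2 hδ.ne') (stable_eigen w hnl.le)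
  have m1 := abs_multiplier hs (trace δ l hδ.ne' (pE _ (near _ hEl)).2.1 hpl)
    (mul_pos hδ (Real.sqrt_pos.2 hpl)) (by
      rw [mul_pow, Real.sq_sqrt hpl.le]
      exact sq δ l hδ.ne')
  have heq : EStar + -δ * -l = EStar + δ * l := by ring
  -- For `-δ` the multiplier is `s (τ - (-δ) κ) = s (τ + δ κ)`, the expanding one, as required for
  -- decay to the left.
  have m2 := abs_multiplier hs (trace (-δ) (-l) (neg_ne_zero.2 hδ.ne')
    (by rw [heq]; exact (nE _ (near _ hEl)).2.1) hnl) (mul_pos hδ (Real.sqrt_pos.2 hnl)) (by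
      rw [mul_pow, Real.sq_sqrt hnl.le, ← neg_sq δ]
      exact sq (-δ) (-l) (neg_ne_zero.2 hδ.ne'))
  rw [t1, t2] at eig'
  simp only [U₁, U₂, V₁, V₂, heq] at eig eig'
  have hv : (stable w (X δ l) (Y δ l) (Z δ l)).1 ≠ 0 ∨ (stable w (X δ l) (Y δ l) (Z δ l)).2 ≠ 0 := by
    by_contra! h
    exact hw (Prod.ext h.1 h.2)
  refine exists_interfaceMode pμ pε nμ.toIsProfile nε.toIsProfile hv m1.1 m1.2.1 m2.2.2 eig.1 eig.2
    (mul_left_cancel₀ ht ?_) (mul_left_cancel₀ ht ?_)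
  · rw [heq, disc]
    linear_combination eig'.1
  · rw [heq, disc]
    linear_combination eig'.2
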